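/- **Definitions.** A *generalized permutation* is an ordered pair of nonempty finite words (the top and the bottom line) such that every symbol which is present appears exactly twice in total. It is *cylindrical* if the first symbol $\alpha_0$ of one of the lines is the last symbol of the other line, and if the set of symbols of neither line is a proper subset of the set of symbols of the other one. A *suspension* over a cylindrical generalized permutation is obtained as follows. Attach to $\alpha_0$ a complex number $v_{\alpha_0}$ with $\operatorname{Im} v_{\alpha_0}>0$ if $\alpha_0$ is the first symbol of the top line, and $\operatorname{Im} v_{\alpha_0}<0$ if it is the first symbol of the bottom line. Attach to every other symbol $\alpha$ a real number $v_\alpha>0$, so that the sum of the vectors over the top line is equal to the sum over the bottom line. The two broken lines which start at $0$ and have as consecutive edges the vectors of the top (respectively, bottom) line bound a parallelogram. Identify any two sides of this polygon which carry the same symbol, by a translation if they are in different lines and by a central symmetry if they are in the same line. The suspension is the resulting closed Riemann surface with the quadratic differential $q$ that is equal to $dz^2$ in the natural coordinate $z$ of the polygon. The *left endpoint* of the suspension is the point of the surface represented by $0$ (the left endpoint of the diagonal which joins the common starting point of the two broken lines to their common end). For integers $D_1,\dots,D_m\ge -1$ the *stratum* $\mathcal Q(D_1,\dots,D_m)$ consists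 of the meromorphic quadratic differentials $q$ on compact connected Riemann surfaces such that $q$ is not the global square of an Abelian differential and the zeroes and poles of $q$ are exactly $m$ distinct points, of orders $D_1,\dots,D_m$ (so the poles are simple); $-1^p$ stands for $p$ entries $-1$. A cylindrical generalized permutation *represents* $\mathcal Q(D_1,\dots,D_m)$ if suspensions over it exist, every one of them belongs to this stratum, and its quadratic differential has order $D_1$ at the left endpoint. **Proposition 3.1.** Let $d_1,\dots,d_n$ be an arbitrary (possibly empty) collection of strictly positive integers, and let $p=d_1+\dots+d_n+4$ (so that $d_1+\dots+d_n-p=4g-4$ with $g=0$). Erase from both lines of the generalized permutation $$ \begin{pmatrix} 0,\ 2p-6,\ 2p-6\\ 2,2,3,\quad 4,4,5,\quad \dots,\quad 2p-8,\ 2p-8,\ 2p-7,\qquad 2p-7,\ 2p-9,\ \dots,\ 3,\ 1,\quad 1,\ 0 \end{pmatrix} $$ (for $p=4$ it should be read as $\begin{pmatrix}0,\ 2,\ 2\\ 1,\ 1,\ 0\end{pmatrix}$) the symbols $$ \underbrace{3,5,\dots,2d_1-1}_{d_1-1},\quad \underbrace{2d_1+3,\dots,2(d_1+d_2)-1}_{d_2-1},\quad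 \dots,\quad \underbrace{2(d_1+\dots+d_{n-1})+3,\dots,2(d_1+\dots+d_n)-1}_{d_n-1}. $$ The result is a cylindrical generalized permutation, and it represents the stratum $\mathcal Q(d_1,\dots,d_n,-1^p)$. -/

import Mathlib

open scoped Manifold ContDiff Topology

/-! ### Quadratic differentials on Riemann surfaces and their strata -/

section QuadraticDifferentials

variable (X : Type*) [TopologicalSpace X] [ChartedSpace ℂ X]

/-- A holomorphic 1-form (Abelian differential) `η`, given in each chart `e` of the atlas by
a holomorphic function `η e` on the target of `e` (the form being `η e (z) dz`), subject to the
usual rule for changes of coordinates. -/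
structure AbelianDifferential where
  coeff : OpenPartialHomeomorph X ℂ → ℂ → ℂ
  holomorphic : ∀ e ∈ atlas ℂ X, DifferentiableOn ℂ (coeff e) e.target
  compatible : ∀ e ∈ atlas ℂ X, ∀ e' ∈ atlas ℂ X, ∀ z ∈ (e.symm.trans e').source,
    coeff e z = coeff e' (e' (e.symm z)) * deriv (e' ∘ e.symm) z

/-- A meromorphic quadratic differential `q`, given in each chart `e` of the atlas by a
meromorphic function `q e` on the target of `e` (the differential being `q e (z) dz²`), subject
to the usual rule for changes of coordinates. As the values of a meromorphic function at isolated
points carry no information, the rule is imposed on punctured neighbourhoods. -/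
structure QuadraticDifferential where
  coeff : OpenPartialHomeomorph X ℂ → ℂ → ℂ
  meromorphic : ∀ e ∈ atlas ℂ X, MeromorphicOn (coeff e) e.target
  compatible : ∀ e ∈ atlas ℂ X, ∀ e' ∈ atlas ℂ X, ∀ z ∈ (e.symm.trans e').source,
    ∀ᶠ w in 𝓝[≠] z, coeff e w = coeff e' (e' (e.symm w)) * deriv (e' ∘ e.symm) w ^ 2

variable {X}

/-- The degree of `q` at the point `x`: the order of vanishing (negative at a pole) of its
coefficient in a chart around `x`. -/
noncomputable def QuadraticDifferential.degree (q : QuadraticDifferential X) (x : X) :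
    WithTop ℤ :=
  meromorphicOrderAt (q.coeff (chartAt ℂ x)) (chartAt ℂ x x)

/-- `q` is the global square of an Abelian differential. -/
def QuadraticDifferential.IsGlobalSquare (q : QuadraticDifferential X) : Prop :=
  ∃ η : AbelianDifferential X, ∀ e ∈ atlas ℂ X, ∀ z ∈ e.target,
    ∀ᶠ w in 𝓝[≠] z, q.coeff e w = η.coeff e w ^ 2

/-- `(X, q)` belongs to the stratum `Q(D₁, …, D_m)`: `X` is a compact connected Riemann surface,
`q` is not the global square of an Abelian differential, and the singularities of `q` are exactly
`m` distinct points, of degrees `D₁, …, D_m` (a zero of order `k` has degree `k`, a simple pole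
has degree `-1`). -/
def QuadraticDifferential.InStratum (q : QuadraticDifferential X) (D : List ℤ) : Prop :=
  T2Space X ∧ CompactSpace X ∧ ConnectedSpace X ∧ IsManifold 𝓘(ℂ) ω X ∧
  ¬ q.IsGlobalSquare ∧
  ∃ s : Fin D.length → X, Function.Injective s ∧
    (∀ i, q.degree (s i) = ((D.get i : ℤ) : WithTop ℤ)) ∧
    ∀ x, x ∉ Set.range s → q.degree x = 0

end QuadraticDifferentials

/-! ### Generalized permutations -/

/-- A pair of words (lines) in the alphabet `ℕ`. -/
structure TwoLines where
  top : List ℕ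
  bot : List ℕ

namespace TwoLines

/-- Both lines are nonempty and every symbol which is present appears exactly twice. -/
def IsGeneralizedPermutation (π : TwoLines) : Prop :=
  π.top ≠ [] ∧ π.bot ≠ [] ∧ ∀ a ∈ π.top ++ π.bot, (π.top ++ π.bot).count a = 2

/-- A cylindrical generalized permutation: the first symbol of one of the lines is the last
symbol of the other one, and the set of symbols of neither line is a proper subset of the set of
symbols of the other one. -/
def IsCylindrical (π : TwoLines) : Prop :=
  π.IsGeneralizedPermutation ∧
  (π.top.head? = π.bot.getLast? ∨ π.bot.head? = π.top.getLast?) ∧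
  ¬ π.top.toFinset ⊂ π.bot.toFinset ∧ ¬ π.bot.toFinset ⊂ π.top.toFinset

/-- Erase in both lines all the symbols that belong to `E`. -/
def eraseSymbols (π : TwoLines) (E : List ℕ) : TwoLines where
  top := π.top.filter (fun a => a ∉ E)
  bot := π.bot.filter (fun a => a ∉ E)

/-! ### Suspensions over cylindrical generalized permutations -/

/-- Vectors `ζ` attached to the symbols of a cylindrical generalized permutation, `a` being the
symbol which is the first one in one line and the last one in the other line. All symbols
different from `a` carry positive horizontal vectors (the saddle connections on the boundary of
the cylinder), `ζ a` is transverse to them (the cut of the cylinder), and the two broken lines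
have a common endpoint. The sign of `Im (ζ a)` puts the top line above the bottom one. -/
structure IsSuspensionDatum (π : TwoLines) (a : ℕ) (ζ : ℕ → ℂ) : Prop where
  cut : (π.top.head? = some a ∧ π.bot.getLast? = some a ∧ 0 < (ζ a).im) ∨
    (π.bot.head? = some a ∧ π.top.getLast? = some a ∧ (ζ a).im < 0)
  horizontal : ∀ b ∈ π.top ++ π.bot, b ≠ a → 0 < (ζ b).re ∧ (ζ b).im = 0
  closes : (π.top.map ζ).sum = (π.bot.map ζ).sum

/-- The `i`-th vertex of the broken line which starts at `0` and whose consecutive edges are the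
vectors carried by the symbols of the word `l`. -/
def vertex (ζ : ℕ → ℂ) (l : List ℕ) (i : ℕ) : ℂ :=
  ((l.take i).map ζ).sum

/-- The closed region bounded by the top and the bottom broken lines. For a suspension datum it
is a parallelogram, hence it is the convex hull of the vertices. Its diagonal joining the start
`0` of the two broken lines to their common end is the segment of the generalized
interval-exchange transformation; so `0` is the left endpoint of that segment. -/
def polygon (π : TwoLines) (ζ : ℕ → ℂ) : Set ℂ :=
  convexHull ℝ (Set.range (vertex ζ π.top) ∪ Set.range (vertex ζ π.bot))

/-- The identification of the sides of the polygon: two sides carrying the same symbol are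
identified by a translation if they lie in different lines, and by a central symmetry if they
lie in the same line. -/
inductive SideGluing (π : TwoLines) (ζ : ℕ → ℂ) : ℂ → ℂ → Prop
  | translation (i j a : ℕ) (hi : π.top[i]? = some a) (hj : π.bot[j]? = some a)
      (t : ℝ) (ht : t ∈ Set.Icc (0 : ℝ) 1) :
      SideGluing π ζ (vertex ζ π.top i + t * ζ a) (vertex ζ π.bot j + t * ζ a)
  | symmetryTop (i j a : ℕ) (hij : i ≠ j) (hi : π.top[i]? = some a) (hj : π.top[j]? = some a)
      (t : ℝ) (ht : t ∈ Set.Icc (0 : ℝ) 1) :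
      SideGluing π ζ (vertex ζ π.top i + t * ζ a) (vertex ζ π.top j + (1 - t) * ζ a)
  | symmetryBot (i j a : ℕ) (hij : i ≠ j) (hi : π.bot[i]? = some a) (hj : π.bot[j]? = some a)
      (t : ℝ) (ht : t ∈ Set.Icc (0 : ℝ) 1) :
      SideGluing π ζ (vertex ζ π.bot i + t * ζ a) (vertex ζ π.bot j + (1 - t) * ζ a)

/-- `(X, q)` is the surface glued from the polygon of `(π, ζ)`, with gluing map `f`: `X` is the
quotient of the polygon by the identification of its sides, and `q` is `dz²` in the natural
coordinate `z` of the polygon.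

For a compact Hausdorff Riemann surface `X` these conditions determine `X` as a topological space
(a continuous surjection from a compact space to a Hausdorff one is a quotient map). They also
determine the complex structure and `q`: a homeomorphism of Riemann surfaces which is holomorphic
off finitely many straight segments of the flat metric is holomorphic. -/
structure IsGluedFromPolygon (π : TwoLines) (ζ : ℕ → ℂ)
    {X : Type*} [TopologicalSpace X] [ChartedSpace ℂ X]
    (q : QuadraticDifferential X) (f : ℂ → X) : Prop where
  continuous : ContinuousOn f (π.polygon ζ)
  surjective : Set.SurjOn f (π.polygon ζ) Set.univ
  fibers : ∀ z ∈ π.polygon ζ, ∀ w ∈ π.polygon ζ,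
    f z = f w ↔ Relation.EqvGen (π.SideGluing ζ) z w
  holomorphic : ∀ z ∈ interior (π.polygon ζ), ∀ e ∈ atlas ℂ X, f z ∈ e.source →
    DifferentiableAt ℂ (e ∘ f) z
  pullback : ∀ z ∈ interior (π.polygon ζ), ∀ e ∈ atlas ℂ X, f z ∈ e.source →
    ∀ᶠ w in 𝓝[≠] z, q.coeff e (e (f w)) * deriv (e ∘ f) w ^ 2 = 1

/-- The generalized permutation `π` is cylindrical and represents the stratum `Q(D₁, …, D_m)`:
suspensions over `π` exist, every suspension over `π` belongs to the stratum, and the degree of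
the singularity at the left endpoint is `D₁`. -/
def RepresentsStratum (π : TwoLines) (D : List ℤ) : Prop :=
  π.IsCylindrical ∧
  (∃ a ζ, π.IsSuspensionDatum a ζ) ∧
  ∀ a ζ, π.IsSuspensionDatum a ζ →
    ∃ (X : Type) (_ : TopologicalSpace X) (_ : ChartedSpace ℂ X)
      (q : QuadraticDifferential X) (f : ℂ → X),
      π.IsGluedFromPolygon ζ q f ∧ q.InStratum D ∧
      ∀ k ∈ D.head?, q.degree (f 0) = ((k : ℤ) : WithTop ℤ)

end TwoLines

/-! ### The explicit generalized permutation -/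

/-- The generalized permutation with top line `0, 2p-6, 2p-6` and bottom line
`2,2,3, 4,4,5, …, 2p-8,2p-8,2p-7, 2p-7,2p-9,…,3,1, 1,0` (for `p ≥ 4`). For `p = 4` the bottom line
is `1,1,0`. -/
def genusZeroPermutation (p : ℕ) : TwoLines where
  top := [0, 2 * p - 6, 2 * p - 6]
  bot := (List.range (p - 4)).flatMap (fun k => [2 * k + 2, 2 * k + 2, 2 * k + 3]) ++
    ((List.range (p - 3)).reverse.map (fun k => 2 * k + 1) ++ [1, 0])

/-- For each entry `x` of the list, with `S` the sum of `s` and of the entries before `x`, the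
`x - 1` symbols `2 S + 3, 2 S + 5, …, 2 (S + x) - 1`. -/
def erasedSymbolsFrom (s : ℕ) : List ℕ → List ℕ
  | [] => []
  | x :: l => (List.range (x - 1)).map (fun j => 2 * (s + j) + 3) ++ erasedSymbolsFrom (s + x) l

/-- The symbols `3, …, 2d₁-1`, then `2d₁+3, …, 2(d₁+d₂)-1`, and so on up to
`2(d₁+…+d_{n-1})+3, …, 2(d₁+…+d_n)-1`. -/
def erasedSymbols (d : List ℕ) : List ℕ :=
  erasedSymbolsFrom 0 d

/-! After the erasure the top line is `0 c c` and the bottom line is `w 0`, where `w` is a nested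
word followed by `1 1` (`eraseSymbols_genusZeroPermutation`). For every suspension datum the polygon
is a parallelogram (`IsFoldable.mem_polygon`). Gluing its two sides `0` gives a flat cylinder; the
pair `c c` folds the top circle in two, and the bottom circle is glued edge to edge by central
symmetries according to `w`. All identifications have the form `z ↦ ±z + const`, so `dz²` descends.
Where `k` half-discs meet, the cone angle is `kπ`, and in the coordinate `z^(2/k)` the differential
has order `k - 2`.

On the top circle `k = 1` at the two fold points and `k = 2` elsewhere. The bottom circle is the
walk around a plane tree. A pair `2j 2j` is an edge ending in a leaf, a surviving odd symbol is an
edge of the spine, and `1 1` is an edge attached to the first spine vertex. Without erasure every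
spine vertex carries one leaf and has valence 3. Erasing an odd symbol contracts a spine edge, so
the `i`-th spine vertex ends up with `d_i` leaves and two further edges: `k = d_i + 2`, a zero of
order `d_i`. The leaves are those of the pairs, the far end of the spine and the tip of the edge
`1`; with the two fold points this makes `d_1 + … + d_n + 4 = p` simple poles. Their presence
excludes a global square. The left endpoint is the corner `0` of the first spine vertex.

`FlatAtlas` turns natural coordinates and conical discs into a complex structure with a quadratic
differential. `FlatCylinder` builds the glued surface, with its topology and its cones, and
`FlatCylinder.flatAtlas` collects them. `IsFoldable.proj_eq_iff` shows that this surface is the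
quotient of the polygon. `IsNest` describes the permutation of the corners by the tree, and its
cycle lengths are the orders (`EdgePairing.order_vertexPoint`). -/

/-! ### Flat atlases -/

section FlatAtlas

open Filter Set

/-- The coefficient `(k/2)² w^(k-2)` of the flat quadratic differential at a point of cone angle
`k π`, in the coordinate `w = z^(2/k)`. -/
noncomputable def coneDensity (k : ℕ) (w : ℂ) : ℂ := ((k : ℂ) / 2) ^ 2 * w ^ ((k : ℤ) - 2)

theorem coneDensity_ne_zero {k : ℕ} (hk : 0 < k) {w : ℂ} (hw : w ≠ 0) : coneDensity k w ≠ 0 := by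
  have : (k : ℂ) ≠ 0 := by exact_mod_cast hk.ne'
  exact mul_ne_zero (pow_ne_zero 2 (div_ne_zero this two_ne_zero)) (zpow_ne_zero _ hw)

theorem meromorphicAt_coneDensity (k : ℕ) (w : ℂ) : MeromorphicAt (coneDensity k) w :=
  (MeromorphicAt.const _ _).mul ((MeromorphicAt.id w).zpow _)

theorem meromorphicOrderAt_coneDensity_zero {k : ℕ} (hk : 0 < k) :
    meromorphicOrderAt (coneDensity k) 0 = ((k - 2 : ℤ) : WithTop ℤ) := by
  rw [meromorphicOrderAt_eq_int_iff (meromorphicAt_coneDensity k 0)]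
  refine ⟨fun _ => ((k : ℂ) / 2) ^ 2, analyticAt_const, ?_, ?_⟩
  · have : (k : ℂ) ≠ 0 := by exact_mod_cast hk.ne'
    exact pow_ne_zero 2 (div_ne_zero this two_ne_zero)
  · exact Eventually.of_forall fun z => by simp [coneDensity, mul_comm]

variable {X : Type} [TopologicalSpace X]

/-- Near `w`, the map `F` is a natural parametrization composed with a holomorphic function whose
squared derivative at `w` is `c w`. -/
def FlatAt (nat : Set (ℂ → X)) (c : ℂ → ℂ) (F : ℂ → X) (w : ℂ) : Prop :=
  ∃ N ∈ nat, ∃ A : ℂ → ℂ, ∃ a : ℂ, A w = 0 ∧ HasStrictDerivAt A a w ∧ a ^ 2 = c w ∧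
    F =ᶠ[𝓝 w] N ∘ A

variable (X) in
/-- A flat structure with conical points: natural parametrizations around the regular points,
unique up to sign, and a parametrization by a disc around every point, in which the flat metric
is a cone of angle `order p * π`. -/
structure FlatAtlas where
  nat : Set (ℂ → X)
  nat_inj : ∀ N ∈ nat, ∃ U ∈ 𝓝 (0 : ℂ), Set.InjOn N U
  nat_map : ∀ N ∈ nat, map N (𝓝 0) = 𝓝 (N 0)
  nat_unique : ∀ N ∈ nat, ∀ N' ∈ nat, N 0 = N' 0 →
    ∃ σ : ℂ, σ ^ 2 = 1 ∧ ∀ᶠ z in 𝓝 0, N' z = N (σ * z)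
  order : X → ℕ
  order_pos : ∀ p, 0 < order p
  param : X → ℂ → X
  radius : X → ℝ
  radius_pos : ∀ p, 0 < radius p
  param_zero : ∀ p, param p 0 = p
  param_inj : ∀ p, Set.InjOn (param p) (Metric.ball 0 (radius p))
  param_map : ∀ p, map (param p) (𝓝 0) = 𝓝 p
  param_flat : ∀ p, ∀ w ∈ Metric.ball 0 (radius p), w ≠ 0 →
    FlatAt nat (coneDensity (order p)) (param p) w

namespace FlatAtlas

variable (𝒜 : FlatAtlas X)

theorem map_nhds_of_flatAt {c : ℂ → ℂ} {F : ℂ → X} {w : ℂ} (h : FlatAt 𝒜.nat c F w)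
    (hc : c w ≠ 0) : map F (𝓝 w) = 𝓝 (F w) := by
  obtain ⟨N, hN, A, a, hA0, hA, ha, hF⟩ := h
  have ha0 : a ≠ 0 := by
    rintro rfl
    exact hc (by rw [← ha]; simp)
  rw [map_congr hF, ← Filter.map_map, hA.map_nhds_eq ha0, hA0, 𝒜.nat_map N hN, hF.eq_of_nhds]
  simp [hA0]

theorem param_map_nhds (p : X) {w : ℂ} (hw : w ∈ Metric.ball 0 (𝒜.radius p)) :
    map (𝒜.param p) (𝓝 w) = 𝓝 (𝒜.param p w) := by
  by_cases h : w = 0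
  · rw [h, 𝒜.param_map, 𝒜.param_zero]
  · exact 𝒜.map_nhds_of_flatAt (𝒜.param_flat p w hw h) (coneDensity_ne_zero (𝒜.order_pos p) h)

/-- The parametrization of a neighbourhood of `p`, as an open partial homeomorphism. -/
noncomputable def paramHomeo (p : X) : OpenPartialHomeomorph ℂ X :=
  OpenPartialHomeomorph.ofContinuousOpenRestrict
    ((𝒜.param_inj p).bijOn_image.toPartialEquiv)
    (fun _ hw => (show Tendsto _ _ _ from (𝒜.param_map_nhds p hw).le).mono_left nhdsWithin_le_nhds)
    (by
      rw [isOpenMap_iff_nhds_le]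
      rintro ⟨w, hw⟩
      have hw' : w ∈ Metric.ball 0 (𝒜.radius p) := hw
      have h := 𝒜.param_map_nhds p hw'
      have h2 : map (Subtype.val : Metric.ball (0 : ℂ) (𝒜.radius p) → ℂ) (𝓝 ⟨w, hw'⟩) = 𝓝 w :=
        Metric.isOpen_ball.isOpenEmbedding_subtypeVal.map_nhds_eq _
      change 𝓝 (𝒜.param p w) ≤ map (𝒜.param p ∘ Subtype.val) (𝓝 ⟨w, hw'⟩)
      rw [← Filter.map_map, h2, h])
    Metric.isOpen_ball

/-- The chart around `p`. -/
noncomputable def chart (p : X) : OpenPartialHomeomorph X ℂ := (𝒜.paramHomeo p).symm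

theorem chart_target (p : X) : (𝒜.chart p).target = Metric.ball 0 (𝒜.radius p) := rfl

theorem chart_symm (p : X) : ⇑(𝒜.chart p).symm = 𝒜.param p := rfl

theorem zero_mem_chart_target (p : X) : (0 : ℂ) ∈ (𝒜.chart p).target := by
  rw [chart_target]; exact Metric.mem_ball_self (𝒜.radius_pos p)

theorem mem_chart_source (p : X) : p ∈ (𝒜.chart p).source := by
  have := (𝒜.chart p).map_target (𝒜.zero_mem_chart_target p)
  rwa [chart_symm, 𝒜.param_zero] at this

theorem chart_self (p : X) : 𝒜.chart p p = 0 := by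
  have := (𝒜.chart p).right_inv (𝒜.zero_mem_chart_target p)
  rwa [chart_symm, 𝒜.param_zero] at this

/-- The complex atlas of a flat atlas. -/
@[reducible] noncomputable def chartedSpace : ChartedSpace ℂ X where
  atlas := range 𝒜.chart
  chartAt := 𝒜.chart
  mem_chart_source := 𝒜.mem_chart_source
  chart_mem_atlas p := mem_range_self p

/-- Near `w` both `F` and the parametrization at `q` factor through natural parametrizations at the
same point, which agree up to a sign `σ`; hence `A = σ B ∘ T` with `T` the chart expression of `F`.
As `B' ≠ 0`, inverting `σ B` makes the merely continuous `T` differentiable, and squaring the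
derivative removes `σ`. -/
theorem hasDerivAt_chart_comp {c : ℂ → ℂ} {F : ℂ → X} {w : ℂ} (h : FlatAt 𝒜.nat c F w)
    (hF : ContinuousAt F w) (q : X) (hw : F w ∈ (𝒜.chart q).source) (h0 : 𝒜.chart q (F w) ≠ 0) :
    ∃ τ, HasDerivAt (𝒜.chart q ∘ F) τ w ∧
      coneDensity (𝒜.order q) (𝒜.chart q (F w)) * τ ^ 2 = c w := by
  set T := 𝒜.chart q ∘ F with hT
  have hTc : ContinuousAt T w := ((𝒜.chart q).continuousAt hw).comp hF
  have hball : T w ∈ Metric.ball 0 (𝒜.radius q) := (𝒜.chart q).map_source hw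
  obtain ⟨N, hN, A, a, hA0, hA, ha, hFA⟩ := h
  obtain ⟨N', hN', B, b, hB0, hB, hb, hFB⟩ := 𝒜.param_flat q (T w) hball h0
  have hFT : ∀ᶠ z in 𝓝 w, 𝒜.param q (T z) = F z := by
    filter_upwards [hF.eventually ((𝒜.chart q).open_source.mem_nhds hw)] with z hz
    exact (𝒜.chart q).left_inv hz
  have hNN : N 0 = N' 0 := by
    have h1 := hFA.eq_of_nhds
    have h2 := hFB.eq_of_nhds
    rw [hFT.self_of_nhds, h1] at h2
    simpa [hA0, hB0] using h2
  obtain ⟨σ, hσ, hNσ⟩ := 𝒜.nat_unique N hN N' hN' hNN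
  obtain ⟨U, hU, hinj⟩ := 𝒜.nat_inj N hN
  have hσ0 : σ ≠ 0 := by rintro rfl; simp at hσ
  have hb0 : b ≠ 0 := by
    rintro rfl
    exact coneDensity_ne_zero (𝒜.order_pos q) h0 (by rw [show 𝒜.chart q (F w) = T w from rfl, ← hb]; simp)
  have hBT : Tendsto (fun z => B (T z)) (𝓝 w) (𝓝 0) := by
    have := hB.hasDerivAt.continuousAt.tendsto.comp hTc.tendsto
    rwa [hB0] at this
  have hA' : Tendsto A (𝓝 w) (𝓝 0) := by
    have := hA.hasDerivAt.continuousAt.tendsto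
    rwa [hA0] at this
  have hσBT : Tendsto (fun z => σ * B (T z)) (𝓝 w) (𝓝 0) := by
    simpa using hBT.const_mul σ
  have key : ∀ᶠ z in 𝓝 w, A z = σ * B (T z) := by
    filter_upwards [hFT, hFA, hTc.tendsto.eventually hFB, hBT.eventually hNσ, hA'.eventually hU,
      hσBT.eventually hU] with z h1 h2 h3 h4 h5 h6
    refine hinj h5 h6 ?_
    rw [← h4]
    exact h2.symm.trans (h1.symm.trans h3)
  have hσB : HasStrictDerivAt (fun u => σ * B u) (σ * b) (T w) := hB.const_mul σ
  have hne : σ * b ≠ 0 := mul_ne_zero hσ0 hb0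
  have hinv := hσB.to_localInverse hne
  have hleft := hσB.hasStrictFDerivAt_equiv hne |>.eventually_left_inverse
  have hTeq : T =ᶠ[𝓝 w] fun z => hσB.localInverse _ _ _ hne (A z) := by
    filter_upwards [key, hTc.tendsto.eventually hleft] with z h1 h2
    rw [h1]
    exact h2.symm
  have hAw : A w = σ * B (T w) := key.self_of_nhds
  rw [← hAw] at hinv
  have hd : HasDerivAt T ((σ * b)⁻¹ * a) w :=
    (hinv.hasDerivAt.comp w hA.hasDerivAt).congr_of_eventuallyEq hTeq
  refine ⟨_, hd, ?_⟩
  change coneDensity (𝒜.order q) (T w) * _ = _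
  rw [← hb, ← ha]
  field_simp
  rw [hσ]; ring

/-- Flatness is only needed on a punctured neighbourhood: `hinj` keeps nearby points away from the
apex of the chart, and at `w` itself, possibly a cone point, continuity makes the singularity
removable. -/
theorem differentiableAt_chart_comp {c : ℂ → ℂ} {F : ℂ → X} {w : ℂ}
    (h : ∀ᶠ z in 𝓝[≠] w, FlatAt 𝒜.nat c F z) (hF : ∀ᶠ z in 𝓝 w, ContinuousAt F z)
    (hinj : ∀ᶠ z in 𝓝[≠] w, F z ≠ F w) (q : X) (hw : F w ∈ (𝒜.chart q).source) :
    DifferentiableAt ℂ (𝒜.chart q ∘ F) w ∧ ∀ᶠ z in 𝓝[≠] w,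
      coneDensity (𝒜.order q) (𝒜.chart q (F z)) * deriv (𝒜.chart q ∘ F) z ^ 2 = c z := by
  have hFw := hF.self_of_nhds
  have hTc : ContinuousAt (𝒜.chart q ∘ F) w := ((𝒜.chart q).continuousAt hw).comp hFw
  have hsrc : ∀ᶠ z in 𝓝[≠] w, F z ∈ (𝒜.chart q).source :=
    nhdsWithin_le_nhds (hFw.eventually ((𝒜.chart q).open_source.mem_nhds hw))
  have hne : ∀ᶠ z in 𝓝[≠] w, 𝒜.chart q (F z) ≠ 0 := by
    by_cases h0 : 𝒜.chart q (F w) = 0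
    · filter_upwards [hsrc, hinj] with z h1 h2 h3
      exact h2 ((𝒜.chart q).injOn h1 hw (h3.trans h0.symm))
    · exact nhdsWithin_le_nhds (hTc.eventually_ne h0)
  have key : ∀ᶠ z in 𝓝[≠] w, ∃ τ, HasDerivAt (𝒜.chart q ∘ F) τ z ∧
      coneDensity (𝒜.order q) (𝒜.chart q (F z)) * τ ^ 2 = c z := by
    filter_upwards [h, hsrc, hne, nhdsWithin_le_nhds hF] with z h1 h2 h3 h4
    exact 𝒜.hasDerivAt_chart_comp h1 h4 q h2 h3
  constructor
  · refine (Complex.analyticAt_of_differentiable_on_punctured_nhds_of_continuousAt ?_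
      hTc).differentiableAt
    filter_upwards [key] with z ⟨τ, hτ, _⟩ using hτ.differentiableAt
  · filter_upwards [key] with z ⟨τ, hτ, h2⟩
    rw [hτ.deriv, h2]

theorem differentiableAt_transition (p q : X) {w : ℂ} (hw : w ∈ Metric.ball 0 (𝒜.radius p))
    (hq : 𝒜.param p w ∈ (𝒜.chart q).source) :
    DifferentiableAt ℂ (𝒜.chart q ∘ 𝒜.param p) w ∧ ∀ᶠ z in 𝓝[≠] w,
      coneDensity (𝒜.order q) (𝒜.chart q (𝒜.param p z)) * deriv (𝒜.chart q ∘ 𝒜.param p) z ^ 2 =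
        coneDensity (𝒜.order p) z := by
  have hball := Metric.isOpen_ball.mem_nhds hw
  refine 𝒜.differentiableAt_chart_comp ?_ ?_ ?_ q hq
  · have h0 : ∀ᶠ z in 𝓝[≠] w, z ≠ 0 := by
      by_cases h : w = 0
      · rw [h]; exact self_mem_nhdsWithin
      · exact nhdsWithin_le_nhds (continuousAt_id.eventually_ne h)
    filter_upwards [h0, nhdsWithin_le_nhds hball] with z h1 h2
    exact 𝒜.param_flat p z h2 h1
  · filter_upwards [hball] with z hz using (𝒜.param_map_nhds p hz).le
  · filter_upwards [self_mem_nhdsWithin, nhdsWithin_le_nhds hball] with z h1 h2 h3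
    exact h1 (𝒜.param_inj p h2 hw h3)

theorem isManifold : @IsManifold ℂ _ ℂ _ _ ℂ _ 𝓘(ℂ) ω X _ 𝒜.chartedSpace := by
  let _ := 𝒜.chartedSpace
  refine isManifold_of_contDiffOn 𝓘(ℂ) ω X ?_
  rintro e e' ⟨p, rfl⟩ ⟨q, rfl⟩
  have h : DifferentiableOn ℂ (𝒜.chart q ∘ 𝒜.param p)
      (((𝒜.chart p).symm ≫ₕ 𝒜.chart q).source) := by
    intro w hw
    rw [OpenPartialHomeomorph.trans_source] at hw
    exact (𝒜.differentiableAt_transition p q hw.1 hw.2).1.differentiableWithinAt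
  have h2 := h.contDiffOn (n := ω) ((𝒜.chart p).symm ≫ₕ 𝒜.chart q).open_source
  simpa [Function.comp_def, chart_symm] using h2

/-- The quadratic differential of a flat atlas. -/
noncomputable def quadraticDifferential :
    @QuadraticDifferential X _ 𝒜.chartedSpace :=
  let _ := 𝒜.chartedSpace
  -- Coefficients are indexed by charts, not by points; `e.symm 0` recovers the centre `p` of `e =
  -- chart p`.
  { coeff := fun e => coneDensity (𝒜.order (e.symm 0))
    meromorphic := fun _ _ _ _ => meromorphicAt_coneDensity _ _
    compatible := by
      rintro e ⟨p, rfl⟩ e' ⟨q, rfl⟩ w hw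
      rw [OpenPartialHomeomorph.trans_source] at hw
      filter_upwards [(𝒜.differentiableAt_transition p q hw.1 hw.2).2] with z hz
      simp only [chart_symm, 𝒜.param_zero]
      exact hz.symm }

theorem degree_quadraticDifferential (p : X) :
    @QuadraticDifferential.degree X _ 𝒜.chartedSpace 𝒜.quadraticDifferential p =
      ((𝒜.order p - 2 : ℤ) : WithTop ℤ) := by
  change meromorphicOrderAt (coneDensity (𝒜.order ((𝒜.chart p).symm 0))) (𝒜.chart p p) = _
  rw [chart_symm, 𝒜.param_zero, chart_self, meromorphicOrderAt_coneDensity_zero (𝒜.order_pos p)]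

/-- At a point of cone angle `π` the differential has order `-1`, whereas the square of a
holomorphic coefficient has order at least 0. -/
theorem not_isGlobalSquare {p : X} (hp : 𝒜.order p = 1) :
    ¬ @QuadraticDifferential.IsGlobalSquare X _ 𝒜.chartedSpace 𝒜.quadraticDifferential := by
  let _ := 𝒜.chartedSpace
  rintro ⟨η, hη⟩
  have h1 := hη (𝒜.chart p) ⟨p, rfl⟩ 0 (𝒜.zero_mem_chart_target p)
  have h2 : AnalyticAt ℂ (η.coeff (𝒜.chart p)) 0 :=
    (η.holomorphic (𝒜.chart p) ⟨p, rfl⟩).analyticAt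
      ((𝒜.chart p).open_target.mem_nhds (𝒜.zero_mem_chart_target p))
  have h3 := 𝒜.degree_quadraticDifferential p
  change meromorphicOrderAt (𝒜.quadraticDifferential.coeff (𝒜.chart p)) (𝒜.chart p p) = _ at h3
  rw [chart_self, meromorphicOrderAt_congr h1, hp] at h3
  have h4 : (0 : WithTop ℤ) ≤ meromorphicOrderAt (fun w => η.coeff (𝒜.chart p) w ^ 2) 0 :=
    (h2.pow 2).meromorphicOrderAt_nonneg
  rw [h3] at h4
  exact absurd h4 (by decide)

/-- A natural parametrization is holomorphic, and the quadratic differential is `dz²` in it. -/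
theorem natural_pullback {F : ℂ → X} {w : ℂ} (h : ∀ᶠ z in 𝓝 w, FlatAt 𝒜.nat (fun _ => 1) F z)
    (hinj : ∀ᶠ z in 𝓝[≠] w, F z ≠ F w) (q : X) (hw : F w ∈ (𝒜.chart q).source) :
    DifferentiableAt ℂ (𝒜.chart q ∘ F) w ∧ ∀ᶠ z in 𝓝[≠] w,
      coneDensity (𝒜.order q) (𝒜.chart q (F z)) * deriv (𝒜.chart q ∘ F) z ^ 2 = 1 := by
  refine 𝒜.differentiableAt_chart_comp (c := fun _ => 1) (nhdsWithin_le_nhds h) ?_ hinj q hw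
  filter_upwards [h] with z hz
  exact (𝒜.map_nhds_of_flatAt hz one_ne_zero).le

theorem inStratum [T2Space X] [CompactSpace X] [ConnectedSpace X] {D : List ℤ}
    (hD : -1 ∈ D) (s : Fin D.length → X) (hs : Function.Injective s)
    (hs' : ∀ i, (𝒜.order (s i) : ℤ) = D.get i + 2) (hreg : ∀ x, x ∉ range s → 𝒜.order x = 2) :
    @QuadraticDifferential.InStratum X _ 𝒜.chartedSpace 𝒜.quadraticDifferential D := by
  let _ := 𝒜.chartedSpace
  refine ⟨inferInstance, inferInstance, inferInstance, 𝒜.isManifold, ?_, s, hs, ?_, ?_⟩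
  · obtain ⟨i, hi⟩ := List.get_of_mem hD
    refine 𝒜.not_isGlobalSquare (p := s i) ?_
    have := hs' i
    rw [hi] at this
    omega
  · intro i
    rw [degree_quadraticDifferential, hs' i]
    congr 1
    ring
  · intro x hx
    rw [degree_quadraticDifferential, hreg x hx]
    rfl

end FlatAtlas

end FlatAtlas

/-! ### Cylinders with glued boundary -/

theorem exists_pos_forall_mem {ι : Type*} (s : Finset ι) (P : ι → ℝ → Prop)
    (anti : ∀ i r r', r' ≤ r → P i r → P i r') (h : ∀ i ∈ s, ∃ r > 0, P i r) :
    ∃ r > 0, ∀ i ∈ s, P i r := by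
  classical
  induction s using Finset.induction_on with
  | empty => exact ⟨1, one_pos, by simp⟩
  | insert a s ha ih =>
    obtain ⟨r, hr, h1⟩ := ih fun i hi => h i (Finset.mem_insert_of_mem hi)
    obtain ⟨r', hr', h2⟩ := h a (Finset.mem_insert_self a s)
    refine ⟨min r r', lt_min hr hr', fun i hi => ?_⟩
    rcases Finset.mem_insert.1 hi with rfl | hi
    · exact anti _ _ _ (min_le_right _ _) h2
    · exact anti _ _ _ (min_le_left _ _) (h1 i hi)

/-- Every multiple of `L` other than the nearest one is at distance at least `L / 2` from `a`, so
only `round (a / L)` constrains `δ`. -/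
theorem exists_pos_sub_int_mul_eq {L : ℝ} (hL : 0 < L) (a : ℝ) :
    ∃ δ > 0, ∀ n : ℤ, |a - n * L| < δ → a = n * L := by
  have key : ∀ n : ℤ, n ≠ round (a / L) → L / 2 ≤ |a - n * L| := by
    intro n hn
    have h1 := abs_sub_round (a / L)
    have h2 : (1 : ℝ) ≤ |((n - round (a / L) : ℤ) : ℝ)| := by
      exact_mod_cast Int.one_le_abs (sub_ne_zero.2 hn)
    have h3 : |a - n * L| = |a / L - n| * L := by
      rw [← abs_of_pos hL, ← abs_mul, abs_of_pos hL]
      congr 1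
      field_simp
    have h4 : 1 / 2 ≤ |a / L - n| := by
      have : |((n - round (a / L) : ℤ) : ℝ)| ≤ |a / L - n| + |a / L - round (a / L)| := by
        push_cast
        rw [abs_sub_comm (a / L) n]
        refine (le_of_eq ?_).trans (abs_add_le _ _ |>.trans le_rfl)
        congr 1
        ring
      linarith
    rw [h3]
    nlinarith
  by_cases h0 : a = round (a / L) * L
  · refine ⟨L / 2, by positivity, fun n hn => ?_⟩
    by_contra h
    exact absurd hn (not_lt.2 (key n (by rintro rfl; exact h h0)))
  · refine ⟨min (L / 2) |a - round (a / L) * L|,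
      lt_min (by positivity) (abs_pos.2 (sub_ne_zero.2 h0)), fun n hn => ?_⟩
    by_cases h : n = round (a / L)
    · subst h
      exact absurd hn (not_lt.2 (min_le_right _ _))
    · exact absurd hn (not_lt.2 ((min_le_left _ _).trans (key n h)))

/-- The data for gluing both boundary components of a flat cylinder, of circumference `L`, by
piecewise central symmetries: `g false` and `g true` act on coordinates `x` of the lower boundary
`x` and of the upper boundary `H - x` of the strip `0 ≤ Im z ≤ Im H`. The boundary germ on the left
of `x` is folded onto the germ on the right of `g x`. -/
structure FlatCylinder where
  L : ℝ
  L_pos : 0 < L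
  H : ℂ
  H_pos : 0 < H.im
  g : Bool → Equiv.Perm ℝ
  g_add : ∀ b x, g b (x + L) = g b x - L
  flip : ∀ b x, ∃ r > 0, (∀ ρ, 0 ≤ ρ → ρ < r → g b (x - ρ) = g b x + ρ) ∧
    ∀ ρ, 0 < ρ → ρ < r → g b (x + ρ) = (g b).symm x - ρ
  finite_orbit : ∀ b x, ∃ k, 0 < k ∧ ∃ n : ℤ, (g b ^ k) x = x + n * L

namespace FlatCylinder

variable (C : FlatCylinder)

theorem g_add_int (b : Bool) (x : ℝ) (n : ℤ) : C.g b (x + n * C.L) = C.g b x - n * C.L := by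
  induction n with
  | zero => simp
  | succ n ih =>
    rw [show x + ((n + 1 : ℤ) : ℝ) * C.L = (x + (n : ℤ) * C.L) + C.L by push_cast; ring, C.g_add,
      ih]
    push_cast; ring
  | pred n ih =>
    have := C.g_add b (x + ((-n - 1 : ℤ) : ℝ) * C.L)
    rw [show x + ((-n - 1 : ℤ) : ℝ) * C.L + C.L = x + (-n : ℤ) * C.L by push_cast; ring, ih] at this
    push_cast at this ⊢
    linarith

theorem g_symm_add_int (b : Bool) (x : ℝ) (n : ℤ) :
    (C.g b).symm (x + n * C.L) = (C.g b).symm x - n * C.L := by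
  rw [Equiv.symm_apply_eq]
  have := C.g_add_int b ((C.g b).symm x) (-n)
  push_cast at this
  rw [sub_eq_add_neg, ← neg_mul, this]
  simp

/-- The iterates of the gluing map. -/
def it (b : Bool) (m : ℤ) (x : ℝ) : ℝ := (C.g b ^ m) x

@[simp] theorem it_zero (b : Bool) (x : ℝ) : C.it b 0 x = x := rfl

theorem it_one (b : Bool) (x : ℝ) : C.it b 1 x = C.g b x := by simp [it]

theorem it_it (b : Bool) (m n : ℤ) (x : ℝ) : C.it b m (C.it b n x) = C.it b (m + n) x := by
  simp [it, zpow_add]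

theorem g_it (b : Bool) (m : ℤ) (x : ℝ) : C.g b (C.it b m x) = C.it b (m + 1) x := by
  rw [← it_one, it_it, add_comm]

theorem g_symm_it (b : Bool) (m : ℤ) (x : ℝ) : (C.g b).symm (C.it b m x) = C.it b (m - 1) x := by
  rw [Equiv.symm_apply_eq, g_it, sub_add_cancel]

theorem it_induction (b : Bool) {P : ℝ → Prop} (h1 : ∀ x, P x → P (C.g b x))
    (h2 : ∀ x, P x → P ((C.g b).symm x)) {x : ℝ} (hx : P x) (m : ℤ) : P (C.it b m x) := by
  induction m with
  | zero => exact hx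
  | succ n ih => rw [← g_it]; exact h1 _ ih
  | pred n ih => rw [← g_symm_it]; exact h2 _ ih

/-- Each application of `g` reverses orientation and changes the sign of the translation. Only
congruence matters later, so the sign is left in an existential. -/
theorem it_add_int (b : Bool) (m : ℤ) (x : ℝ) (n : ℤ) :
    ∃ n' : ℤ, C.it b m (x + n * C.L) = C.it b m x + n' * C.L := by
  induction m with
  | zero => exact ⟨n, rfl⟩
  | succ k ih =>
    obtain ⟨n', h⟩ := ih
    refine ⟨-n', ?_⟩
    rw [← g_it, h, g_add_int, g_it]
    push_cast; ring
  | pred k ih =>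
    obtain ⟨n', h⟩ := ih
    refine ⟨-n', ?_⟩
    rw [← g_symm_it, h, g_symm_add_int, g_symm_it]
    push_cast; ring

/-- Congruence modulo the circumference. -/
def Cong (x y : ℝ) : Prop := ∃ n : ℤ, y = x + n * C.L

variable {C}

theorem Cong.refl (x : ℝ) : C.Cong x x := ⟨0, by simp⟩

theorem Cong.symm {x y : ℝ} (h : C.Cong x y) : C.Cong y x := by
  obtain ⟨n, rfl⟩ := h
  exact ⟨-n, by push_cast; ring⟩

theorem Cong.trans {x y z : ℝ} (h : C.Cong x y) (h' : C.Cong y z) : C.Cong x z := by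
  obtain ⟨n, rfl⟩ := h
  obtain ⟨n', rfl⟩ := h'
  exact ⟨n + n', by push_cast; ring⟩

theorem Cong.it {x y : ℝ} (h : C.Cong x y) (b : Bool) (m : ℤ) :
    C.Cong (C.it b m x) (C.it b m y) := by
  obtain ⟨n, rfl⟩ := h
  exact C.it_add_int b m x n

theorem Cong.of_it {x y : ℝ} {b : Bool} {m : ℤ} (h : C.Cong (C.it b m x) (C.it b m y)) :
    C.Cong x y := by
  have := h.it b (-m)
  simpa [it_it] using this

variable (C)

/-- The number of boundary points glued to `x`, modulo the circumference. -/
noncomputable def period (b : Bool) (x : ℝ) : ℕ := by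
  classical exact Nat.find (C.finite_orbit b x)

theorem period_pos (b : Bool) (x : ℝ) : 0 < C.period b x := by
  classical exact (Nat.find_spec (C.finite_orbit b x)).1

theorem cong_it_period (b : Bool) (x : ℝ) : C.Cong x (C.it b (C.period b x) x) := by
  classical
  obtain ⟨n, h⟩ := (Nat.find_spec (C.finite_orbit b x)).2
  exact ⟨n, by rw [← h, it, zpow_natCast]; rfl⟩

theorem period_le {b : Bool} {x : ℝ} {k : ℕ} (hk : 0 < k) (h : C.Cong x (C.it b k x)) :
    C.period b x ≤ k := by
  classical
  obtain ⟨n, h⟩ := h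
  exact Nat.find_min' _ ⟨hk, n, by rw [← h, it, zpow_natCast]⟩

theorem period_eq {b : Bool} {x : ℝ} {k : ℕ} (hk : 0 < k) (h : C.Cong x (C.it b k x))
    (h' : ∀ i : ℕ, 0 < i → i < k → ¬ C.Cong x (C.it b i x)) : C.period b x = k := by
  refine le_antisymm (C.period_le hk h) (not_lt.1 fun hlt => ?_)
  exact h' _ (C.period_pos b x) hlt (C.cong_it_period b x)

theorem cong_it_mul_period (b : Bool) (x : ℝ) (j : ℤ) :
    C.Cong x (C.it b (j * C.period b x) x) := by
  induction j with
  | zero => simpa using Cong.refl x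
  | succ j ih =>
    have := (C.cong_it_period b x).trans (ih.it b (C.period b x))
    rwa [it_it, show (C.period b x : ℤ) + j * C.period b x = (j + 1) * C.period b x by ring] at this
  | pred j ih =>
    refine Cong.of_it (b := b) (m := C.period b x) ?_
    rw [it_it, show (C.period b x : ℤ) + (-j - 1) * C.period b x = -j * C.period b x by ring]
    exact (C.cong_it_period b x).symm.trans ih

theorem cong_it_add_mul_period (b : Bool) (x : ℝ) (m j : ℤ) :
    C.Cong (C.it b m x) (C.it b (m + j * C.period b x) x) := by
  have := (C.cong_it_mul_period b x j).it b m
  rwa [it_it] at this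

theorem cong_it_emod (b : Bool) (x : ℝ) (m : ℤ) :
    C.Cong (C.it b (m % C.period b x) x) (C.it b m x) := by
  have := C.cong_it_add_mul_period b x (m % C.period b x) (m / C.period b x)
  rwa [mul_comm, Int.emod_add_mul_ediv] at this

/-- Division by the period: a nonzero remainder would be a smaller return time, against minimality.
Hence the indices `m` modulo the period enumerate, without repetition, the half-discs meeting at the
point. -/
theorem cong_it_iff {b : Bool} {x : ℝ} {m m' : ℤ} :
    C.Cong (C.it b m x) (C.it b m' x) ↔ ∃ j : ℤ, m' = m + j * C.period b x := by
  constructor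
  · intro h
    have h1 : C.Cong x (C.it b (m' - m) x) := by
      refine Cong.of_it (b := b) (m := m) ?_
      rwa [it_it, add_sub_cancel]
    have h2 := h1.trans (C.cong_it_emod b x (m' - m)).symm
    set k := C.period b x with hk
    have hk0 : (0 : ℤ) < k := by exact_mod_cast C.period_pos b x
    have h3 := Int.emod_nonneg (m' - m) hk0.ne'
    have h4 := Int.emod_lt_of_pos (m' - m) hk0
    have h5 : (m' - m) % k = 0 := by
      by_contra hne
      have := C.period_le (b := b) (x := x) (k := ((m' - m) % k).toNat) (by omega)
        (by rwa [Int.toNat_of_nonneg h3])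
      omega
    obtain ⟨j, hj⟩ := Int.dvd_of_emod_eq_zero h5
    exact ⟨j, by linarith⟩
  · rintro ⟨j, rfl⟩
    exact C.cong_it_add_mul_period b x m j

theorem period_it (b : Bool) (x : ℝ) (m : ℤ) : C.period b (C.it b m x) = C.period b x := by
  refine C.period_eq (C.period_pos b x) ?_ ?_
  · rw [it_it]
    exact C.cong_it_iff.2 ⟨1, by ring⟩
  · intro i hi hik h
    rw [it_it] at h
    obtain ⟨j, hj⟩ := C.cong_it_iff.1 h
    have : (i : ℤ) = j * C.period b x := by linarith
    have h1 : 0 < j := by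
      by_contra hj0
      nlinarith [C.period_pos b x]
    nlinarith [C.period_pos b x]

theorem period_congr {b : Bool} {x y : ℝ} (h : C.Cong x y) : C.period b y = C.period b x := by
  refine C.period_eq (C.period_pos b x) ?_ ?_
  · exact h.symm.trans ((C.cong_it_period b x).trans (h.it b _))
  · intro i hi hik h'
    exact absurd (C.period_le hi (h.trans (h'.trans (h.symm.it b _)))) (not_le.2 hik)

/-! #### The strip and its boundary coordinates -/

/-- The closed strip covering the cylinder. -/
def strip : Set ℂ := {z | 0 ≤ z.im ∧ z.im ≤ C.H.im}

/-- The coordinates in which a boundary component is the real line and the strip is above it. -/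
def cap (b : Bool) (w : ℂ) : ℂ := bif b then C.H - w else w

/-- The sign of the boundary coordinate. -/
def capSign (b : Bool) : ℂ := bif b then -1 else 1

theorem capSign_sq (b : Bool) : capSign b ^ 2 = 1 := by cases b <;> simp [capSign]

theorem cap_add (b : Bool) (w u : ℂ) : C.cap b (w + u) = C.cap b w + capSign b * u := by
  cases b <;> simp [cap, capSign]; ring

theorem cap_injective (b : Bool) : Function.Injective (C.cap b) := by
  intro w u h
  cases b <;> simpa [cap] using h

theorem norm_cap_sub (b : Bool) (w u : ℂ) : ‖C.cap b w - C.cap b u‖ = ‖w - u‖ := by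
  cases b
  · rfl
  · simp only [cap, cond_true]
    rw [← norm_neg]; congr 1; ring

theorem cap_im (b : Bool) (w : ℂ) : (C.cap b w).im = bif b then C.H.im - w.im else w.im := by
  cases b <;> simp [cap]

theorem cap_mem_strip {b : Bool} {w : ℂ} (h0 : 0 ≤ w.im) (h1 : w.im ≤ C.H.im) :
    C.cap b w ∈ C.strip := by
  cases b <;> simp [strip, cap, h0, h1]

theorem cap_ofReal_mem_strip (b : Bool) (x : ℝ) : C.cap b x ∈ C.strip :=
  C.cap_mem_strip (by simp) (by simpa using C.H_pos.le)

theorem cap_ofReal_bool_inj {b b' : Bool} {x y : ℝ} (h : ‖C.cap b x - C.cap b' y‖ < C.H.im) :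
    b = b' := by
  have := (Complex.abs_im_le_norm _).trans_lt h
  cases b <;> cases b' <;> simp [cap, abs_of_pos C.H_pos] at this ⊢

theorem cap_ofReal_eq {b b' : Bool} {x y : ℝ} (h : C.cap b x = C.cap b' y) : b = b' ∧ x = y := by
  obtain rfl : b = b' := C.cap_ofReal_bool_inj (x := x) (y := y) (by rw [h]; simpa using C.H_pos)
  exact ⟨rfl, by exact_mod_cast C.cap_injective b h⟩

theorem exists_eq_cap {z : ℂ} (hz : z ∈ C.strip) (h : ¬ (0 < z.im ∧ z.im < C.H.im)) :
    ∃ b, ∃ x : ℝ, z = C.cap b x := by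
  obtain ⟨h0, h1⟩ := hz
  rcases h0.eq_or_lt with h2 | h2
  · exact ⟨false, z.re, Complex.ext (by simp [cap]) (by simp [cap, ← h2])⟩
  · have h3 : z.im = C.H.im := le_antisymm h1 (not_lt.1 fun h4 => h ⟨h2, h4⟩)
    exact ⟨true, C.H.re - z.re, Complex.ext (by simp [cap]) (by simp [cap, h3])⟩

/-- The points of the plane identified by the translation and by the gluing of the boundary. -/
def Rel (z w : ℂ) : Prop :=
  (∃ n : ℤ, w = z + n * C.L) ∨
    ∃ b, ∃ x y : ℝ, ∃ m : ℤ, z = C.cap b x ∧ w = C.cap b y ∧ C.Cong (C.it b m x) y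

theorem cap_add_int (b : Bool) (w : ℂ) (n : ℤ) :
    ∃ n' : ℤ, C.cap b w + n * C.L = C.cap b (w + n' * C.L) := by
  cases b
  · exact ⟨n, rfl⟩
  · exact ⟨-n, by simp [cap]; ring⟩

theorem rel_cap {b : Bool} {x : ℝ} {w : ℂ} :
    C.Rel (C.cap b x) w ↔ ∃ (m : ℤ) (y : ℝ), C.Cong (C.it b m x) y ∧ w = C.cap b y := by
  constructor
  · rintro (⟨n, rfl⟩ | ⟨b', x', y, m, h, rfl, h'⟩)
    · obtain ⟨n', h⟩ := C.cap_add_int b x n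
      exact ⟨0, x + n' * C.L, ⟨n', rfl⟩, by rw [h]; push_cast; rfl⟩
    · obtain ⟨rfl, rfl⟩ := C.cap_ofReal_eq h
      exact ⟨m, y, h', rfl⟩
  · rintro ⟨m, y, h, rfl⟩
    exact Or.inr ⟨b, x, y, m, rfl, rfl, h⟩

theorem rel_cap_cap {b b' : Bool} {x y : ℝ} :
    C.Rel (C.cap b x) (C.cap b' y) ↔ b = b' ∧ ∃ m : ℤ, C.Cong (C.it b m x) y := by
  rw [rel_cap]
  constructor
  · rintro ⟨m, y', h, h'⟩
    obtain ⟨rfl, rfl⟩ := C.cap_ofReal_eq h'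
    exact ⟨rfl, m, h⟩
  · rintro ⟨rfl, m, h⟩
    exact ⟨m, y, h, rfl⟩

theorem rel_refl (z : ℂ) : C.Rel z z := Or.inl ⟨0, by simp⟩

theorem rel_symm {z w : ℂ} (h : C.Rel z w) : C.Rel w z := by
  rcases h with ⟨n, rfl⟩ | ⟨b, x, y, m, rfl, rfl, h⟩
  · exact Or.inl ⟨-n, by push_cast; ring⟩
  · refine Or.inr ⟨b, y, x, -m, rfl, rfl, ?_⟩
    have := (h.it b (-m)).symm
    simpa [it_it] using this

theorem rel_trans {z w v : ℂ} (h : C.Rel z w) (h' : C.Rel w v) : C.Rel z v := by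
  rcases h with ⟨n, rfl⟩ | ⟨b, x, y, m, rfl, rfl, h⟩
  · rcases h' with ⟨n', rfl⟩ | ⟨b, x, y, m, hx, rfl, h⟩
    · exact Or.inl ⟨n + n', by push_cast; ring⟩
    · obtain ⟨n', h1⟩ := C.cap_add_int b x (-n)
      have h2 : z = C.cap b ((x + n' * C.L : ℝ) : ℂ) := by
        have : z = C.cap b x + ((-n : ℤ) : ℂ) * C.L := by rw [← hx]; push_cast; ring
        rw [this, h1]; push_cast; rfl
      rw [h2, rel_cap]
      exact ⟨m, y, (Cong.it ⟨n', rfl⟩ b m).symm.trans h, rfl⟩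
  · obtain ⟨m', y', h1, rfl⟩ := C.rel_cap.1 h'
    rw [rel_cap]
    refine ⟨m' + m, y', ?_, rfl⟩
    have := (h.it b m').trans h1
    rwa [it_it] at this

theorem rel_of_interior {z w : ℂ} (h0 : 0 < z.im) (h1 : z.im < C.H.im) (h : C.Rel z w) :
    ∃ n : ℤ, w = z + n * C.L := by
  rcases h with h | ⟨b, x, y, m, rfl, rfl, h⟩
  · exact h
  · exfalso
    cases b <;> simp [cap] at h0 h1

/-- Equivalence classes are infinite because of the translations but finite modulo them. Since
`proj` is periodic, this suffices for choosing one radius that works at all points of a class. -/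
theorem rel_orbit_finite (z : ℂ) : ∃ F : Finset ℂ, ∀ y, C.Rel z y →
    ∃ y₀ ∈ F, C.Rel z y₀ ∧ ∃ n : ℤ, y = y₀ + n * C.L := by
  classical
  by_cases h : ∃ b, ∃ x : ℝ, z = C.cap b x
  · obtain ⟨b, x, rfl⟩ := h
    refine ⟨(Finset.range (C.period b x)).image fun i : ℕ => C.cap b (C.it b i x), fun y hy => ?_⟩
    obtain ⟨m, y, h, rfl⟩ := C.rel_cap.1 hy
    have hk : (0 : ℤ) < C.period b x := by exact_mod_cast C.period_pos b x
    have h1 := Int.emod_nonneg m hk.ne'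
    have h2 := Int.emod_lt_of_pos m hk
    obtain ⟨n, rfl⟩ := (C.cong_it_emod b x m).trans h
    refine ⟨C.cap b (C.it b (m % C.period b x) x), ?_, ?_, ?_⟩
    · exact Finset.mem_image.2 ⟨(m % C.period b x).toNat, by simp; omega,
        by rw [Int.toNat_of_nonneg h1]⟩
    · exact C.rel_cap.2 ⟨_, _, Cong.refl _, rfl⟩
    · cases b
      · exact ⟨n, by simp [cap]⟩
      · exact ⟨-n, by simp [cap]; ring⟩
  · refine ⟨{z}, fun y hy => ⟨z, by simp, C.rel_refl z, ?_⟩⟩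
    rcases hy with hy | ⟨b, x, _, _, hx, _⟩
    · exact hy
    · exact absurd ⟨b, x, hx⟩ h

/-! #### The glued surface -/

/-- The surface glued from the strip. -/
def setoid : Setoid C.strip where
  r z w := C.Rel z w
  iseqv := ⟨fun z => C.rel_refl z, fun h => C.rel_symm h, fun h h' => C.rel_trans h h'⟩

/-- The surface glued from the strip. -/
def Surface : Type := Quotient C.setoid

instance : TopologicalSpace C.Surface := inferInstanceAs (TopologicalSpace (Quotient C.setoid))

/-- The retraction of the plane onto the strip. -/
noncomputable def clamp (z : ℂ) : ℂ := ⟨z.re, max 0 (min z.im C.H.im)⟩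

theorem clamp_mem (z : ℂ) : C.clamp z ∈ C.strip :=
  ⟨le_max_left _ _, max_le C.H_pos.le (min_le_right _ _)⟩

theorem clamp_of_mem {z : ℂ} (hz : z ∈ C.strip) : C.clamp z = z := by
  apply Complex.ext
  · rfl
  · simp [clamp, min_eq_left hz.2, max_eq_right hz.1]

theorem continuous_clamp : Continuous C.clamp := by
  have : C.clamp = fun z => (z.re : ℂ) + (max 0 (min z.im C.H.im) : ℝ) * Complex.I := by
    funext z
    apply Complex.ext <;> simp [clamp]
  rw [this]
  fun_prop

/-- The projection of the strip to the surface, extended to the plane. -/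
noncomputable def proj (z : ℂ) : C.Surface := Quotient.mk C.setoid ⟨C.clamp z, C.clamp_mem z⟩

theorem continuous_proj : Continuous C.proj :=
  continuous_quotient_mk'.comp (C.continuous_clamp.subtype_mk _)

theorem proj_of_mem {z : ℂ} (hz : z ∈ C.strip) : C.proj z = Quotient.mk C.setoid ⟨z, hz⟩ := by
  unfold proj
  congr 2
  exact C.clamp_of_mem hz

theorem proj_surjective (p : C.Surface) : ∃ z ∈ C.strip, C.proj z = p := by
  induction p using Quotient.inductionOn with
  | h z => exact ⟨z, z.2, C.proj_of_mem z.2⟩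

theorem proj_eq_iff {z w : ℂ} (hz : z ∈ C.strip) (hw : w ∈ C.strip) :
    C.proj z = C.proj w ↔ C.Rel z w := by
  rw [C.proj_of_mem hz, C.proj_of_mem hw]
  exact Quotient.eq (r := C.setoid)

theorem rel_mem_strip {z w : ℂ} (hz : z ∈ C.strip) (h : C.Rel z w) : w ∈ C.strip := by
  rcases h with ⟨n, rfl⟩ | ⟨b, x, y, m, rfl, rfl, _⟩
  · simpa [strip] using hz
  · exact C.cap_ofReal_mem_strip b y

theorem proj_add_int (z : ℂ) (n : ℤ) : C.proj (z + n * C.L) = C.proj z := by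
  have : C.clamp (z + n * C.L) = C.clamp z + n * C.L := by
    apply Complex.ext <;> simp [clamp]
  refine Quotient.sound (s := C.setoid) (C.rel_symm (Or.inl ⟨n, ?_⟩))
  exact this

theorem isOpen_of_forall {U : Set C.Surface}
    (h : ∀ z ∈ C.strip, C.proj z ∈ U → ∃ ε > 0, ∀ w ∈ C.strip, ‖w - z‖ < ε → C.proj w ∈ U) :
    IsOpen U := by
  refine isOpen_coinduced.2 ?_
  rw [Metric.isOpen_iff]
  rintro ⟨z, hz⟩ hzU
  obtain ⟨ε, hε, h'⟩ := h z hz (by rw [C.proj_of_mem hz]; exact hzU)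
  refine ⟨ε, hε, ?_⟩
  rintro ⟨w, hw⟩ hwz
  have := h' w hw (by simpa [Subtype.dist_eq, dist_eq_norm] using hwz)
  rwa [C.proj_of_mem hw] at this

/-- The points at distance less than `r` from the points represented by `z`. -/
def disc (z : ℂ) (r : ℝ) : Set C.Surface :=
  {p | ∃ y w, C.Rel z y ∧ w ∈ C.strip ∧ ‖w - y‖ < r ∧ C.proj w = p}

/-- The disc of radius `r` around `z` is saturated. -/
def Saturated (z : ℂ) (r : ℝ) : Prop :=
  ∀ w w', w ∈ C.strip → C.Rel w w' → (∃ y, C.Rel z y ∧ ‖w - y‖ < r) →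
    ∃ y, C.Rel z y ∧ ‖w' - y‖ < r

variable {C}

theorem Saturated.mem_disc {z : ℂ} {r : ℝ} (h : C.Saturated z r) {w : ℂ} (hw : w ∈ C.strip)
    (hw' : C.proj w ∈ C.disc z r) : ∃ y, C.Rel z y ∧ ‖w - y‖ < r := by
  obtain ⟨y, w', hy, hs, hr, hp⟩ := hw'
  exact h w' w hs ((C.proj_eq_iff hs hw).1 hp) ⟨y, hy, hr⟩

theorem Saturated.isOpen_disc {z : ℂ} {r : ℝ} (h : C.Saturated z r) : IsOpen (C.disc z r) := by
  refine C.isOpen_of_forall fun w hw hw' => ?_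
  obtain ⟨y, hy, hr⟩ := h.mem_disc hw hw'
  refine ⟨r - ‖w - y‖, sub_pos.2 hr, fun v hv hvw => ⟨y, v, hy, hv, ?_, rfl⟩⟩
  have : ‖v - y‖ ≤ ‖v - w‖ + ‖w - y‖ := norm_sub_le_norm_sub_add_norm_sub v w y
  linarith

variable (C)

theorem proj_mem_disc {z : ℂ} (hz : z ∈ C.strip) {r : ℝ} (hr : 0 < r) : C.proj z ∈ C.disc z r :=
  ⟨z, z, C.rel_refl z, hz, by simpa using hr, rfl⟩

theorem exists_disc_subset {z : ℂ} (hz : z ∈ C.strip) {V : Set C.Surface}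
    (hV : V ∈ 𝓝 (C.proj z)) : ∃ r > 0, C.disc z r ⊆ V := by
  obtain ⟨F, hF⟩ := C.rel_orbit_finite z
  obtain ⟨r, hr, h⟩ := exists_pos_forall_mem F
    (fun y r => C.Rel z y → ∀ w, ‖w - y‖ < r → C.proj w ∈ V)
    (fun i r r' h h1 h2 w hw => h1 h2 w (hw.trans_le h)) (by
      intro y _
      by_cases hy : C.Rel z y
      · have h1 := C.continuous_proj.continuousAt (x := y)
        rw [ContinuousAt, ← (C.proj_eq_iff hz (C.rel_mem_strip hz hy)).2 hy] at h1
        obtain ⟨r, hr, h2⟩ := Metric.mem_nhds_iff.1 (h1 hV)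
        exact ⟨r, hr, fun _ w hw => h2 (by simpa [dist_eq_norm] using hw)⟩
      · exact ⟨1, one_pos, fun h => absurd h hy⟩)
  refine ⟨r, hr, ?_⟩
  rintro p ⟨y, w, hy, hw, hwr, rfl⟩
  obtain ⟨y₀, hy₀, hzy, n, rfl⟩ := hF y hy
  have := h y₀ hy₀ hzy (w + (-n : ℤ) * C.L) (by
    refine lt_of_eq_of_lt ?_ hwr
    congr 1
    push_cast; ring)
  rwa [C.proj_add_int] at this

/-- Radii for which the discs around a boundary point are embedded cones. -/
structure GoodRadius (b : Bool) (x : ℝ) (r : ℝ) : Prop where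
  pos : 0 < r
  le_height : r ≤ C.H.im
  left : ∀ m ρ, 0 ≤ ρ → ρ < r → C.g b (C.it b m x - ρ) = C.it b (m + 1) x + ρ
  right : ∀ m ρ, 0 < ρ → ρ < r → C.g b (C.it b m x + ρ) = C.it b (m - 1) x - ρ
  sep : ∀ (m m' n : ℤ), |C.it b m x - C.it b m' x - n * C.L| < 2 * r →
    C.it b m x - C.it b m' x = n * C.L

/-- The conditions at `m` follow from those at `m` modulo the period, because `g` turns translations
by multiples of `L` into their inverses. So finitely many radii decide; `r₂` is halved since `sep`
speaks of `2 * r`, the sum of the radii of two half-discs. -/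
theorem exists_goodRadius (b : Bool) (x : ℝ) : ∃ r, C.GoodRadius b x r := by
  set k := C.period b x with hk
  have hk0 : (0 : ℤ) < k := by exact_mod_cast C.period_pos b x
  have hred : ∀ m : ℤ, ∃ i ∈ Finset.range k, C.Cong (C.it b (i : ℕ) x) (C.it b m x) := by
    intro m
    have h1 := Int.emod_nonneg m hk0.ne'
    have h2 := Int.emod_lt_of_pos m hk0
    refine ⟨(m % k).toNat, by simp; omega, ?_⟩
    rw [Int.toNat_of_nonneg h1]
    exact C.cong_it_emod b x m
  obtain ⟨r₁, hr₁, h₁⟩ := exists_pos_forall_mem (Finset.range k)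
    (fun i r => (∀ ρ, 0 ≤ ρ → ρ < r → C.g b (C.it b (i : ℕ) x - ρ) = C.g b (C.it b i x) + ρ) ∧
      ∀ ρ, 0 < ρ → ρ < r → C.g b (C.it b i x + ρ) = (C.g b).symm (C.it b i x) - ρ)
    (fun i r r' h h' => ⟨fun ρ h1 h2 => h'.1 ρ h1 (h2.trans_le h),
      fun ρ h1 h2 => h'.2 ρ h1 (h2.trans_le h)⟩)
    (fun i _ => C.flip b _)
  obtain ⟨r₂, hr₂, h₂⟩ := exists_pos_forall_mem (Finset.range k ×ˢ Finset.range k)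
    (fun i r => ∀ n : ℤ, |C.it b (i.1 : ℕ) x - C.it b (i.2 : ℕ) x - n * C.L| < r →
      C.it b (i.1 : ℕ) x - C.it b (i.2 : ℕ) x = n * C.L)
    (fun i r r' h h' n hn => h' n (hn.trans_le h))
    (fun i _ => exists_pos_sub_int_mul_eq C.L_pos _)
  refine ⟨min (min r₁ (r₂ / 2)) C.H.im, ?_, min_le_right _ _, ?_, ?_, ?_⟩
  · exact lt_min (lt_min hr₁ (by positivity)) C.H_pos
  · intro m ρ h0 h1
    obtain ⟨i, hi, n, hn⟩ := hred m
    have h2 := (h₁ i hi).1 ρ h0 (h1.trans_le ((min_le_left _ _).trans (min_le_left _ _)))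
    rw [← g_it, hn, show C.it b i x + n * C.L - ρ = C.it b i x - ρ + n * C.L by ring, g_add_int, h2,
      g_add_int]
    ring
  · intro m ρ h0 h1
    obtain ⟨i, hi, n, hn⟩ := hred m
    have h2 := (h₁ i hi).2 ρ h0 (h1.trans_le ((min_le_left _ _).trans (min_le_left _ _)))
    rw [← g_symm_it, hn, show C.it b i x + n * C.L + ρ = C.it b i x + ρ + n * C.L by ring,
      g_add_int, h2, g_symm_add_int]
    ring
  · intro m m' n h
    obtain ⟨i, hi, l, hl⟩ := hred m
    obtain ⟨i', hi', l', hl'⟩ := hred m'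
    have h1 : |C.it b i x - C.it b i' x - ((n - l + l' : ℤ) : ℝ) * C.L| < r₂ := by
      have h2 : 2 * min (min r₁ (r₂ / 2)) C.H.im ≤ r₂ := by
        have := (min_le_left (min r₁ (r₂ / 2)) C.H.im).trans (min_le_right _ _)
        linarith
      refine lt_of_eq_of_lt ?_ (h.trans_le h2)
      rw [hl, hl']
      congr 1
      push_cast; ring
    have h3 := h₂ (i, i') (Finset.mem_product.2 ⟨hi, hi'⟩) _ h1
    rw [hl, hl']
    push_cast at h3
    linarith

variable {C}

/-- Both `g` and its inverse carry a boundary point at signed distance `δ` from an orbit point to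
one at distance `|δ|` from a neighbouring orbit point, so nearness to the orbit survives every
iterate. The inverse is handled by reading the same two flips backwards. -/
theorem GoodRadius.saturated {b : Bool} {x r ρ : ℝ} (h : C.GoodRadius b x r) (hρ : ρ ≤ r) :
    C.Saturated (C.cap b x) ρ := by
  rintro w w' hw hww' ⟨y, hy, hyw⟩
  rcases hww' with ⟨n, rfl⟩ | ⟨b', t, t', m, rfl, rfl, htt'⟩
  · refine ⟨y + n * C.L, C.rel_trans hy (Or.inl ⟨n, rfl⟩), ?_⟩
    rwa [add_sub_add_right_eq_sub]
  · obtain ⟨m₀, y, hm₀, rfl⟩ := C.rel_cap.1 hy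
    -- Points closer than the height of the strip cannot lie on opposite boundaries.
    obtain rfl : b' = b := C.cap_ofReal_bool_inj (hyw.trans_le (hρ.trans h.le_height))
    rw [norm_cap_sub, ← Complex.ofReal_sub, Complex.norm_real, Real.norm_eq_abs] at hyw
    have key : ∃ (m₁ : ℤ) (n : ℤ), |C.it b' m t - (C.it b' m₁ x + n * C.L)| < ρ := by
      refine C.it_induction b'
        (P := fun t => ∃ (m₁ : ℤ) (n : ℤ), |t - (C.it b' m₁ x + n * C.L)| < ρ) ?_ ?_ ?_ m
      · rintro t ⟨m₁, n, ht⟩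
        obtain ⟨δ, rfl⟩ : ∃ δ, t = C.it b' m₁ x + δ + n * C.L :=
          ⟨t - C.it b' m₁ x - n * C.L, by ring⟩
        rw [show C.it b' m₁ x + δ + n * C.L - (C.it b' m₁ x + n * C.L) = δ by ring] at ht
        rw [g_add_int]
        rcases le_or_gt δ 0 with h0 | h0
        · rw [abs_of_nonpos h0] at ht
          have := h.left m₁ (-δ) (by linarith) (by linarith)
          rw [sub_neg_eq_add] at this
          refine ⟨m₁ + 1, -n, ?_⟩
          rw [this, show C.it b' (m₁ + 1) x + -δ - n * C.L -
            (C.it b' (m₁ + 1) x + (-n : ℤ) * C.L) = -δ by push_cast; ring,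
            abs_of_nonneg (by linarith)]
          exact ht
        · rw [abs_of_pos h0] at ht
          refine ⟨m₁ - 1, -n, ?_⟩
          rw [h.right m₁ δ h0 (by linarith), show C.it b' (m₁ - 1) x - δ - n * C.L -
            (C.it b' (m₁ - 1) x + (-n : ℤ) * C.L) = -δ by push_cast; ring, abs_neg, abs_of_pos h0]
          exact ht
      · rintro t ⟨m₁, n, ht⟩
        obtain ⟨δ, rfl⟩ : ∃ δ, t = C.it b' m₁ x + δ + n * C.L :=
          ⟨t - C.it b' m₁ x - n * C.L, by ring⟩
        rw [show C.it b' m₁ x + δ + n * C.L - (C.it b' m₁ x + n * C.L) = δ by ring] at ht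
        rw [g_symm_add_int]
        rcases le_or_gt 0 δ with h0 | h0
        · rw [abs_of_nonneg h0] at ht
          have := h.left (m₁ - 1) δ h0 (by linarith)
          rw [sub_add_cancel] at this
          refine ⟨m₁ - 1, -n, ?_⟩
          rw [← this, Equiv.symm_apply_apply, show C.it b' (m₁ - 1) x - δ - n * C.L -
            (C.it b' (m₁ - 1) x + (-n : ℤ) * C.L) = -δ by push_cast; ring, abs_neg,
            abs_of_nonneg h0]
          exact ht
        · rw [abs_of_neg h0] at ht
          have := h.right (m₁ + 1) (-δ) (by linarith) (by linarith)
          rw [add_sub_cancel_right, sub_neg_eq_add] at this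
          refine ⟨m₁ + 1, -n, ?_⟩
          rw [← this, Equiv.symm_apply_apply, show C.it b' (m₁ + 1) x + -δ - n * C.L -
            (C.it b' (m₁ + 1) x + (-n : ℤ) * C.L) = -δ by push_cast; ring,
            abs_of_nonneg (by linarith)]
          exact ht
      · obtain ⟨n, rfl⟩ := hm₀
        exact ⟨m₀, n, hyw⟩
    obtain ⟨m₁, n, hm₁⟩ := key
    obtain ⟨l, rfl⟩ := htt'
    refine ⟨C.cap b' ((C.it b' m₁ x + ((n + l : ℤ) : ℝ) * C.L : ℝ)),
      C.rel_cap.2 ⟨m₁, _, ⟨_, rfl⟩, rfl⟩, ?_⟩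
    rw [norm_cap_sub, ← Complex.ofReal_sub, Complex.norm_real, Real.norm_eq_abs]
    refine lt_of_eq_of_lt ?_ hm₁
    congr 1
    push_cast; ring

variable (C)

theorem saturated_interior {z : ℂ} {r : ℝ} (h0 : r ≤ z.im) (h1 : r ≤ C.H.im - z.im) :
    C.Saturated z r := by
  rintro w w' hw hww' ⟨y, hy, hyw⟩
  have hr : 0 < r := (norm_nonneg _).trans_lt hyw
  obtain ⟨n, rfl⟩ := C.rel_of_interior (by linarith) (by linarith) hy
  have h2 := (Complex.abs_im_le_norm _).trans_lt hyw
  simp only [Complex.sub_im, Complex.add_im, Complex.mul_im, Complex.intCast_re, Complex.ofReal_im,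
    Complex.intCast_im, Complex.ofReal_re] at h2
  rw [abs_lt] at h2
  obtain ⟨n', rfl⟩ := C.rel_of_interior (by linarith) (by linarith) hww'
  refine ⟨z + n * C.L + n' * C.L, Or.inl ⟨n + n', by push_cast; ring⟩, ?_⟩
  rwa [add_sub_add_right_eq_sub]

theorem exists_saturated {z : ℂ} (hz : z ∈ C.strip) : ∃ r > 0, ∀ ρ ≤ r, C.Saturated z ρ := by
  by_cases h : 0 < z.im ∧ z.im < C.H.im
  · exact ⟨min z.im (C.H.im - z.im), lt_min h.1 (sub_pos.2 h.2), fun ρ hρ =>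
      C.saturated_interior (hρ.trans (min_le_left _ _)) (hρ.trans (min_le_right _ _))⟩
  · obtain ⟨b, x, rfl⟩ := C.exists_eq_cap hz h
    obtain ⟨r, hr⟩ := C.exists_goodRadius b x
    exact ⟨r, hr.pos, fun ρ hρ => hr.saturated hρ⟩

theorem disc_mem_nhds {z : ℂ} (hz : z ∈ C.strip) {r : ℝ} (hr : 0 < r) :
    C.disc z r ∈ 𝓝 (C.proj z) := by
  obtain ⟨r', hr', h⟩ := C.exists_saturated hz
  have h1 := (h (min r r') (min_le_right _ _)).isOpen_disc.mem_nhds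
    (C.proj_mem_disc hz (lt_min hr hr'))
  refine Filter.mem_of_superset h1 ?_
  rintro p ⟨y, w, h1, h2, h3, h4⟩
  exact ⟨y, w, h1, h2, h3.trans_le (min_le_left _ _), h4⟩

theorem exists_separated (z w : ℂ) : ∃ δ > 0, ∀ n : ℤ, ‖z - w - n * C.L‖ < δ →
    z - w = n * C.L := by
  by_cases h : z.im = w.im
  · obtain ⟨δ, hδ, h'⟩ := exists_pos_sub_int_mul_eq C.L_pos (z.re - w.re)
    refine ⟨δ, hδ, fun n hn => ?_⟩
    have := h' n (by simpa using (Complex.abs_re_le_norm _).trans_lt hn)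
    apply Complex.ext <;> simp [this, h]
  · refine ⟨|z.im - w.im|, abs_pos.2 (sub_ne_zero.2 h), fun n hn => ?_⟩
    have := (Complex.abs_im_le_norm _).trans_lt hn
    simp at this

/-- Two distinct classes, being finite modulo translation, have a positive distance `δ`. Saturated
discs of radius at most `δ / 2` around them have disjoint images, since a common point would bring
the classes closer than `δ`. -/
instance : T2Space C.Surface := by
  rw [t2Space_iff]
  intro p q hpq
  obtain ⟨z, hz, rfl⟩ := C.proj_surjective p
  obtain ⟨w, hw, rfl⟩ := C.proj_surjective q
  have hzw : ¬ C.Rel z w := fun h => hpq ((C.proj_eq_iff hz hw).2 h)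
  obtain ⟨F, hF⟩ := C.rel_orbit_finite z
  obtain ⟨G, hG⟩ := C.rel_orbit_finite w
  obtain ⟨δ, hδ, hFG⟩ := exists_pos_forall_mem (F ×ˢ G)
    (fun i δ => ∀ n : ℤ, ‖i.1 - i.2 - n * C.L‖ < δ → i.1 - i.2 = n * C.L)
    (fun i r r' h h' n hn => h' n (hn.trans_le h)) (fun i _ => C.exists_separated i.1 i.2)
  obtain ⟨r, hr, hsat⟩ := C.exists_saturated hz
  obtain ⟨r', hr', hsat'⟩ := C.exists_saturated hw
  set ρ := min (δ / 2) (min r r') with hρ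
  have hρ0 : 0 < ρ := lt_min (by positivity) (lt_min hr hr')
  have s1 := hsat ρ ((min_le_right _ _).trans (min_le_left _ _))
  have s2 := hsat' ρ ((min_le_right _ _).trans (min_le_right _ _))
  refine ⟨C.disc z ρ, C.disc w ρ, s1.isOpen_disc, s2.isOpen_disc, C.proj_mem_disc hz hρ0,
    C.proj_mem_disc hw hρ0, ?_⟩
  rw [Set.disjoint_left]
  rintro p hp hp'
  obtain ⟨v, hv, rfl⟩ := C.proj_surjective p
  obtain ⟨y, hy, hvy⟩ := s1.mem_disc hv hp
  obtain ⟨y', hy', hvy'⟩ := s2.mem_disc hv hp'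
  obtain ⟨y₀, hy₀, hzy₀, n, rfl⟩ := hF y hy
  obtain ⟨y₁, hy₁, hzy₁, n', rfl⟩ := hG y' hy'
  have h1 : ‖y₀ - y₁ - ((n' - n : ℤ) : ℂ) * C.L‖ < δ := by
    have h2 : ‖(y₀ + n * C.L) - (y₁ + n' * C.L)‖ ≤ ‖y₀ + n * C.L - v‖ + ‖v - (y₁ + n' * C.L)‖ :=
      norm_sub_le_norm_sub_add_norm_sub _ v _
    rw [norm_sub_rev _ v] at h2
    have h3 : ρ ≤ δ / 2 := min_le_left _ _
    refine lt_of_eq_of_lt ?_ (h2.trans_lt (by linarith))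
    congr 1
    push_cast; ring
  have h2 := hFG (y₀, y₁) (Finset.mem_product.2 ⟨hy₀, hy₁⟩) _ h1
  refine hzw (C.rel_trans hzy₀ (C.rel_trans (Or.inl ⟨n - n', ?_⟩) (C.rel_symm hzy₁)))
  push_cast at h2 ⊢
  linear_combination -h2

end FlatCylinder

/-! ### Developing the cone around a boundary point by a logarithm. -/

namespace FlatCylinder

variable (C : FlatCylinder)

section Cone

open Complex

/-- The number of the half-disc containing the point of logarithm `s`. -/
noncomputable def sector (s : ℂ) : ℤ := ⌊s.im / Real.pi⌋

/-- The coordinate, in its half-disc, of the point of logarithm `s`. -/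
noncomputable def sectorPoint (s : ℂ) : ℂ := exp (s - sector s * Real.pi * I)

theorem sector_add (s : ℂ) (j : ℤ) : sector (s + j * Real.pi * I) = sector s + j := by
  have : (s + j * Real.pi * I).im / Real.pi = s.im / Real.pi + j := by
    simp
    field_simp
  rw [sector, this, Int.floor_add_intCast]
  rfl

theorem sectorPoint_add (s : ℂ) (j : ℤ) : sectorPoint (s + j * Real.pi * I) = sectorPoint s := by
  rw [sectorPoint, sector_add, sectorPoint]
  congr 1
  push_cast; ring

theorem sector_eq {s : ℂ} {m : ℤ} (h0 : m * Real.pi ≤ s.im) (h1 : s.im < (m + 1) * Real.pi) :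
    sector s = m := by
  rw [sector, Int.floor_eq_iff, le_div_iff₀ Real.pi_pos, div_lt_iff₀ Real.pi_pos]
  exact ⟨h0, h1⟩

theorem sector_le (s : ℂ) : sector s * Real.pi ≤ s.im := by
  rw [← le_div_iff₀ Real.pi_pos]
  exact Int.floor_le _

theorem lt_sector_add_one (s : ℂ) : s.im < (sector s + 1) * Real.pi := by
  rw [← div_lt_iff₀ Real.pi_pos]
  exact Int.lt_floor_add_one _

theorem norm_sectorPoint (s : ℂ) : ‖sectorPoint s‖ = ‖exp s‖ := by
  rw [sectorPoint, norm_exp, norm_exp]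
  simp

theorem sectorPoint_im (s : ℂ) :
    (sectorPoint s).im = Real.exp s.re * Real.sin (s.im - sector s * Real.pi) := by
  rw [sectorPoint, exp_im]
  simp

theorem sectorPoint_im_nonneg (s : ℂ) : 0 ≤ (sectorPoint s).im := by
  rw [sectorPoint_im]
  refine mul_nonneg (Real.exp_pos _).le (Real.sin_nonneg_of_nonneg_of_le_pi ?_ ?_)
  · linarith [sector_le s]
  · linarith [lt_sector_add_one s]

theorem sector_lt_of_im_pos {s : ℂ} (h : 0 < (sectorPoint s).im) : sector s * Real.pi < s.im := by
  refine (sector_le s).lt_of_ne fun h' => ?_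
  rw [sectorPoint_im, ← h'] at h
  simp at h

theorem im_eq_of_sectorPoint_im_eq_zero {s : ℂ} (h : (sectorPoint s).im = 0) :
    s.im = sector s * Real.pi := by
  by_contra hne
  have h1 := (sector_le s).lt_of_ne (Ne.symm hne)
  rw [sectorPoint_im] at h
  have := Real.sin_pos_of_pos_of_lt_pi (x := s.im - sector s * Real.pi) (by linarith)
    (by linarith [lt_sector_add_one s])
  have := mul_pos (Real.exp_pos s.re) this
  linarith

theorem sectorPoint_of_im_eq {s : ℂ} (h : s.im = sector s * Real.pi) :
    sectorPoint s = (Real.exp s.re : ℝ) := by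
  rw [sectorPoint, ofReal_exp]
  congr 1
  apply Complex.ext <;> simp [h]

/-- The sign relating the natural coordinate of a half-disc to the exponential. -/
noncomputable def sectorSign (m : ℤ) : ℂ := exp (-(m * Real.pi * I))

theorem sectorSign_sq (m : ℤ) : sectorSign m ^ 2 = 1 := by
  rw [sectorSign, ← exp_nat_mul, exp_eq_one_iff]
  exact ⟨-m, by push_cast; ring⟩

theorem sectorSign_sub_one (m : ℤ) : sectorSign (m - 1) = -sectorSign m := by
  rw [sectorSign, sectorSign, show -(((m - 1 : ℤ) : ℂ) * Real.pi * I) =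
    -(m * Real.pi * I) + Real.pi * I by push_cast; ring, exp_add, exp_pi_mul_I]
  ring

theorem sectorPoint_eq (s : ℂ) : sectorPoint s = sectorSign (sector s) * exp s := by
  rw [sectorPoint, sectorSign, ← exp_add]
  congr 1
  ring

/-- A half-disc keeps its positive ray and leaves the negative one to the next half-disc, so that `0
≤ arg u < π` puts `log u` in sector 0; adding `m π i` reaches sector `m`. -/
theorem exists_sectorPoint_eq {u : ℂ} (hu : u ≠ 0) (h0 : 0 ≤ u.im) (h1 : u.im = 0 → 0 < u.re)
    (m : ℤ) : ∃ s, sector s = m ∧ sectorPoint s = u := by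
  have ha : 0 ≤ u.arg := arg_nonneg_iff.2 h0
  have hb : u.arg < Real.pi := by
    refine (arg_le_pi u).lt_of_ne fun h => ?_
    obtain ⟨h2, h3⟩ := arg_eq_pi_iff.1 h
    linarith [h1 h3]
  have h2 : sector (log u) = 0 := sector_eq (by rw [log_im]; simpa using ha) (by rw [log_im]; simpa using hb)
  refine ⟨log u + m * Real.pi * I, by rw [sector_add, h2, zero_add], ?_⟩
  rw [sectorPoint_add, sectorPoint, h2]
  simp [exp_log hu]

/-- The point of the surface in the half-disc chain starting at the boundary point `x`. -/
noncomputable def spiral (b : Bool) (x : ℝ) (s : ℂ) : C.Surface :=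
  C.proj (C.cap b (C.it b (sector s) x + sectorPoint s))

variable {C}

theorem proj_cap_congr {b : Bool} {x y : ℝ} (h : C.Cong x y) (u : ℂ) :
    C.proj (C.cap b (y + u)) = C.proj (C.cap b (x + u)) := by
  obtain ⟨n, rfl⟩ := h
  obtain ⟨n', h⟩ := C.cap_add_int b (x + u) n
  cases b
  · rw [← C.proj_add_int (C.cap false (x + u)) n]
    congr 1
    simp [cap]; ring
  · rw [← C.proj_add_int (C.cap true (x + u)) (-n)]
    congr 1
    simp [cap]; ring

theorem proj_cap_eq_iff {b b' : Bool} {x y : ℝ} :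
    C.proj (C.cap b x) = C.proj (C.cap b' y) ↔ b = b' ∧ ∃ m, C.Cong (C.it b m x) y := by
  rw [C.proj_eq_iff (C.cap_ofReal_mem_strip b x) (C.cap_ofReal_mem_strip b' y), rel_cap_cap]

theorem proj_cap_it (b : Bool) (x : ℝ) (m : ℤ) :
    C.proj (C.cap b (C.it b m x)) = C.proj (C.cap b x) :=
  (proj_cap_eq_iff.2 ⟨rfl, m, Cong.refl _⟩).symm

theorem spiral_congr {b : Bool} {x y : ℝ} (h : C.Cong x y) (s : ℂ) :
    C.spiral b y s = C.spiral b x s := proj_cap_congr (h.it b _) _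

variable (C)

theorem spiral_it (b : Bool) (x : ℝ) (j : ℤ) (s : ℂ) :
    C.spiral b (C.it b j x) s = C.spiral b x (s + j * Real.pi * I) := by
  rw [spiral, spiral, sector_add, sectorPoint_add, it_it]

/-- The chain of half-discs closes up after `period` half-turns: the total angle is `period * π`. -/
theorem spiral_add_period (b : Bool) (x : ℝ) (s : ℂ) (j : ℤ) :
    C.spiral b x (s + j * C.period b x * Real.pi * I) = C.spiral b x s := by
  have := C.spiral_it b x (j * C.period b x) s
  push_cast at this
  rw [← this]
  exact spiral_congr (C.cong_it_mul_period b x j) s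

theorem cap_add_sectorPoint_mem_strip (b : Bool) (x : ℝ) {s : ℂ} (h : ‖exp s‖ ≤ C.H.im) :
    C.cap b (x + sectorPoint s) ∈ C.strip := by
  refine C.cap_mem_strip (by simpa using sectorPoint_im_nonneg s) ?_
  rw [← norm_sectorPoint] at h
  simpa using (le_abs_self _).trans ((abs_im_le_norm _).trans h)

theorem spiral_mem_disc (b : Bool) (x : ℝ) {s : ℂ} {ρ : ℝ} (hρ : ρ ≤ C.H.im) (hs : ‖exp s‖ < ρ) :
    C.spiral b x s ∈ C.disc (C.cap b x) ρ := by
  refine ⟨C.cap b (C.it b (sector s) x), _, C.rel_cap.2 ⟨_, _, Cong.refl _, rfl⟩,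
    C.cap_add_sectorPoint_mem_strip b _ (hs.le.trans hρ), ?_, rfl⟩
  rw [norm_cap_sub, add_sub_cancel_left, norm_sectorPoint]
  exact hs

variable {C}

theorem GoodRadius.proj_left {b : Bool} {x r : ℝ} (h : C.GoodRadius b x r) (m : ℤ) {ρ : ℝ}
    (h0 : 0 ≤ ρ) (h1 : ρ < r) : C.proj (C.cap b (C.it b m x - ρ)) =
      C.proj (C.cap b (C.it b (m + 1) x + ρ)) := by
  have h2 := proj_cap_it (C := C) b (C.it b m x - ρ) 1
  rw [it_one, h.left m ρ h0 h1] at h2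
  push_cast at h2
  exact h2.symm

theorem GoodRadius.exists_spiral_eq {b : Bool} {x r ρ : ℝ} (h : C.GoodRadius b x r) (hρ : ρ ≤ r)
    {p : C.Surface} (hp : p ∈ C.disc (C.cap b x) ρ) (hne : p ≠ C.proj (C.cap b x)) :
    ∃ s, ‖exp s‖ < ρ ∧ C.spiral b x s = p := by
  obtain ⟨y, w, hy, hw, hwy, rfl⟩ := hp
  obtain ⟨m, y, hm, rfl⟩ := C.rel_cap.1 hy
  obtain ⟨u, rfl⟩ : ∃ u, w = C.cap b (y + u) := by
    refine ⟨capSign b * (w - C.cap b y), ?_⟩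
    rw [cap_add, ← mul_assoc, ← sq, capSign_sq]
    ring
  rw [norm_cap_sub, add_sub_cancel_left] at hwy
  have hu0 : 0 ≤ u.im := by
    have h1 := hw.1
    have h2 := hw.2
    cases b <;> simp [cap] at h1 h2 <;> exact by assumption
  rw [proj_cap_congr hm] at hne ⊢
  have hu : u ≠ 0 := by
    rintro rfl
    rw [add_zero, proj_cap_it] at hne
    exact hne rfl
  by_cases h1 : u.im = 0 → 0 < u.re
  · obtain ⟨s, hs, hsu⟩ := exists_sectorPoint_eq hu hu0 h1 m
    exact ⟨s, by rwa [← norm_sectorPoint, hsu], by rw [spiral, hs, hsu]⟩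
  -- The negative ray of half-disc `m` is the positive ray of half-disc `m + 1`, by the left flip.
  · push Not at h1
    obtain ⟨h2, h3⟩ := h1
    obtain ⟨ρ', rfl⟩ : ∃ ρ' : ℝ, u = -(ρ' : ℂ) := ⟨-u.re, Complex.ext (by simp) (by simp [h2])⟩
    have h4 : 0 < ρ' := by
      rcases (show 0 ≤ ρ' by simpa using h3).eq_or_lt with h5 | h5
      · exact absurd (by simp [← h5]) hu
      · exact h5
    rw [norm_neg, norm_real, Real.norm_eq_abs, abs_of_pos h4] at hwy
    obtain ⟨s, hs, hsu⟩ := exists_sectorPoint_eq (u := (ρ' : ℂ)) (by exact_mod_cast h4.ne')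
      (by simp) (by simpa using h4) (m + 1)
    refine ⟨s, by rwa [← norm_sectorPoint, hsu, norm_real, Real.norm_eq_abs, abs_of_pos h4], ?_⟩
    rw [spiral, hs, hsu, ← sub_eq_add_neg, h.proj_left m h4.le (by linarith)]

theorem GoodRadius.it_edge_one {b : Bool} {x r : ℝ} (h : C.GoodRadius b x r) (m : ℤ) {ρ : ℝ}
    (h0 : 0 < ρ) (h1 : ρ < r) : C.it b 1 (C.it b m x + ρ) = C.it b (m - 1) x - ρ := by
  rw [it_one, h.right m ρ h0 h1]

theorem GoodRadius.it_edge_two {b : Bool} {x r : ℝ} (h : C.GoodRadius b x r) (m : ℤ) {ρ : ℝ}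
    (h0 : 0 < ρ) (h1 : ρ < r) : C.it b 2 (C.it b m x + ρ) = C.it b m x + ρ := by
  rw [show (2 : ℤ) = 1 + 1 from rfl, ← it_it, h.it_edge_one m h0 h1, it_one,
    h.left (m - 1) ρ h0.le h1, sub_add_cancel]

/-- Flipping right and then left returns to the start, and a single flip does not, because `sep`
keeps `it (m - 1) x - ρ` away from the translates of `it m x + ρ`. So boundary points near a cone
point are regular. -/
theorem GoodRadius.period_edge {b : Bool} {x r : ℝ} (h : C.GoodRadius b x r) (m : ℤ) {ρ : ℝ}
    (h0 : 0 < ρ) (h1 : ρ < r) : C.period b (C.it b m x + ρ) = 2 := by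
  refine C.period_eq two_pos ?_ ?_
  · exact ⟨0, by simpa using h.it_edge_two m h0 h1⟩
  · intro i hi hi2
    obtain rfl : i = 1 := by omega
    rintro ⟨n, hn⟩
    rw [Nat.cast_one, h.it_edge_one m h0 h1] at hn
    have h2 := h.sep (m - 1) m n (by
      rw [show C.it b (m - 1) x - C.it b m x - n * C.L = 2 * ρ by linarith, abs_of_pos (by linarith)]
      linarith)
    linarith

/-- Inside a half-disc only translations identify points, and `sep` forces the two centres to be
congruent. On a ray the point has period 2: even iterates are again translates, while odd ones fall
on the negative side of an orbit point, where no `sectorPoint` lies. -/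
theorem GoodRadius.spiral_inj {b : Bool} {x r : ℝ} (h : C.GoodRadius b x r) {s s' : ℂ}
    (hs : ‖exp s‖ < r) (hs' : ‖exp s'‖ < r) (heq : C.spiral b x s = C.spiral b x s') :
    ∃ j : ℤ, s' = s + j * C.period b x * Real.pi * I := by
  have hin := C.cap_add_sectorPoint_mem_strip b (C.it b (sector s) x) (hs.le.trans h.le_height)
  have hin' := C.cap_add_sectorPoint_mem_strip b (C.it b (sector s') x) (hs'.le.trans h.le_height)
  have hrel := (C.proj_eq_iff hin hin').1 heq
  rw [← norm_sectorPoint] at hs hs'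
  have final : (∃ n : ℤ, (C.it b (sector s') x : ℂ) + sectorPoint s' =
      C.it b (sector s) x + sectorPoint s + n * C.L) →
      ∃ j : ℤ, s' = s + j * C.period b x * Real.pi * I := by
    rintro ⟨n, hn⟩
    have h1 : C.it b (sector s') x - C.it b (sector s) x = n * C.L := by
      refine h.sep _ _ _ ?_
      have : ((C.it b (sector s') x - C.it b (sector s) x - n * C.L : ℝ) : ℂ) =
          sectorPoint s - sectorPoint s' := by
        push_cast
        linear_combination hn
      rw [← Real.norm_eq_abs, ← norm_real, this]
      exact (norm_sub_le _ _).trans_lt (by linarith)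
    have h2 : sectorPoint s' = sectorPoint s := by
      have : ((C.it b (sector s') x - C.it b (sector s) x : ℝ) : ℂ) = ((n * C.L : ℝ) : ℂ) := by
        rw [h1]
      push_cast at this
      linear_combination hn - this
    obtain ⟨j, hj⟩ := C.cong_it_iff.1 (⟨n, by linarith⟩ : C.Cong (C.it b (sector s) x) (C.it b (sector s') x))
    obtain ⟨l, hl⟩ := exp_eq_exp_iff_exists_int.1 h2
    have h3 : s' = s + (sector s' - sector s + 2 * l : ℤ) * Real.pi * I := by
      push_cast
      linear_combination hl
    have h4 := sector_add s (sector s' - sector s + 2 * l)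
    rw [← h3] at h4
    -- Equality of exponentials allows `2 π i l`, but the sector of `s'`, computed through
    -- `sector_add`, leaves no room for it.
    obtain rfl : l = 0 := by omega
    refine ⟨j, ?_⟩
    rw [h3, show sector s' - sector s + 2 * 0 = j * C.period b x by linarith]
    push_cast; ring
  by_cases him : 0 < (sectorPoint s).im
  · have h1 : (sectorPoint s).im < C.H.im :=
      (le_abs_self _).trans_lt ((abs_im_le_norm _).trans_lt (hs.trans_le h.le_height))
    obtain ⟨n, hn⟩ := C.rel_of_interior (by rw [cap_im]; cases b <;> simp <;> linarith)
      (by rw [cap_im]; cases b <;> simp <;> linarith) hrel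
    obtain ⟨n', hn'⟩ := C.cap_add_int b (C.it b (sector s) x + sectorPoint s) n
    rw [hn'] at hn
    exact final ⟨n', C.cap_injective b hn⟩
  · have him0 : (sectorPoint s).im = 0 := le_antisymm (not_lt.1 him) (sectorPoint_im_nonneg s)
    have hr := sectorPoint_of_im_eq (im_eq_of_sectorPoint_im_eq_zero him0)
    set ρ := Real.exp s.re with hρ
    have hρ0 : 0 < ρ := Real.exp_pos _
    rw [hr, norm_real, Real.norm_eq_abs, abs_of_pos hρ0] at hs
    rw [hr, ← ofReal_add, rel_cap] at hrel
    obtain ⟨m, y, hm, hy⟩ := hrel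
    have hy := C.cap_injective b hy
    rcases Int.even_or_odd' m with ⟨l, rfl | rfl⟩
    · have h1 := (C.cong_it_mul_period b (C.it b (sector s) x + ρ) l).trans
        (by rw [h.period_edge _ hρ0 hs, mul_comm]; exact_mod_cast hm)
      obtain ⟨n, rfl⟩ := h1
      refine final ⟨n, ?_⟩
      rw [hy, hr]; push_cast; ring
    -- An odd iterate lies at distance `ρ` to the left of an orbit point; being also at distance
    -- less than `r` to the right of one, it would put two orbit points at a positive distance below
    -- `2 * r` modulo `L`.
    · exfalso
      have h1 : C.Cong (C.it b (sector s - 1) x - ρ) y := by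
        have h2 := C.cong_it_add_mul_period b (C.it b (sector s) x + ρ) 1 l
        rw [h.period_edge _ hρ0 hs, h.it_edge_one _ hρ0 hs] at h2
        refine h2.trans ?_
        rwa [show 1 + l * ((2 : ℕ) : ℤ) = 2 * l + 1 by push_cast; ring]
      obtain ⟨n, rfl⟩ := h1
      have him' : (sectorPoint s').im = 0 := by
        have := congrArg Complex.im hy
        simpa using this
      have hr' := sectorPoint_of_im_eq (im_eq_of_sectorPoint_im_eq_zero him')
      have hρ0' : 0 < Real.exp s'.re := Real.exp_pos _
      rw [hr', norm_real, Real.norm_eq_abs, abs_of_pos hρ0'] at hs'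
      rw [hr'] at hy
      have hy : C.it b (sector s') x + Real.exp s'.re = C.it b (sector s - 1) x - ρ + n * C.L := by
        exact_mod_cast hy
      have := h.sep (sector s - 1) (sector s') (-n) (by
        rw [show C.it b (sector s - 1) x - C.it b (sector s') x - ((-n : ℤ) : ℝ) * C.L =
          Real.exp s'.re + ρ by push_cast; linarith, abs_of_pos (by linarith)]
        linarith)
      push_cast at this
      linarith

/-! #### Cone parametrizations -/

variable (C)

/-- The parametrization of a neighbourhood of the boundary point `x`. -/
noncomputable def cone (b : Bool) (x : ℝ) (w : ℂ) : C.Surface :=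
  if w = 0 then C.proj (C.cap b x) else C.spiral b x (C.period b x / 2 * log w)

theorem cone_zero (b : Bool) (x : ℝ) : C.cone b x 0 = C.proj (C.cap b x) := if_pos rfl

/-- Any logarithm may replace the principal one: changing `l` by `2 π i n` changes `k / 2 * l` by `n
k π i`, a period of the spiral. -/
theorem cone_exp (b : Bool) (x : ℝ) (l : ℂ) :
    C.cone b x (exp l) = C.spiral b x (C.period b x / 2 * l) := by
  rw [cone, if_neg (exp_ne_zero l)]
  obtain ⟨n, hn⟩ := exp_eq_exp_iff_exists_int.1 (exp_log (exp_ne_zero l))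
  rw [hn, ← C.spiral_add_period b x (C.period b x / 2 * l) n]
  congr 1
  ring

/-- With `z = w^(k/2)` this is `|z|² = |w|^k`, squared to avoid half-integral exponents. -/
theorem norm_exp_half_mul_sq (k : ℕ) (l : ℂ) : ‖exp (k / 2 * l)‖ ^ 2 = ‖exp l‖ ^ k := by
  rw [← norm_pow, ← norm_pow, ← exp_nat_mul, ← exp_nat_mul]
  congr 2
  push_cast; ring

variable {C}

theorem exists_exp_eq_of_ne_zero {w : ℂ} (hw : w ≠ 0) : ∃ l, w = exp l := ⟨log w, (exp_log hw).symm⟩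

/-- This explains the radius `min 1 (r ^ 2)`: if `|w| ≤ 1` then `|z|² = |w|^k ≤ |w| < r²`, whatever
`k ≥ 1` is. -/
theorem norm_exp_half_mul_lt {k : ℕ} (hk : 0 < k) {l : ℂ} {r : ℝ} (hr : 0 < r)
    (h : ‖exp l‖ < min 1 (r ^ 2)) : ‖exp (k / 2 * l)‖ < r := by
  have h1 := norm_exp_half_mul_sq k l
  have h2 : ‖exp l‖ ^ k ≤ ‖exp l‖ :=
    pow_le_of_le_one (norm_nonneg _) (h.le.trans (min_le_left _ _)) hk.ne'
  exact lt_of_pow_lt_pow_left₀ 2 hr.le (by rw [h1]; exact h2.trans_lt (h.trans_le (min_le_right _ _)))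

theorem proj_ne_spiral {b : Bool} {x r : ℝ} (h : C.GoodRadius b x r) {s : ℂ}
    (hs : ‖exp s‖ < r) : C.spiral b x s ≠ C.proj (C.cap b x) := by
  intro heq
  have hin := C.cap_add_sectorPoint_mem_strip b (C.it b (sector s) x) (hs.le.trans h.le_height)
  have hrel := (C.proj_eq_iff (C.cap_ofReal_mem_strip b x) hin).1 heq.symm
  obtain ⟨m, y, ⟨n, rfl⟩, hy⟩ := C.rel_cap.1 hrel
  have hy := C.cap_injective b hy
  rw [← norm_sectorPoint] at hs
  have him : (sectorPoint s).im = 0 := by simpa using congrArg Complex.im hy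
  have hr := sectorPoint_of_im_eq (im_eq_of_sectorPoint_im_eq_zero him)
  have hρ0 : 0 < Real.exp s.re := Real.exp_pos _
  rw [hr, norm_real, Real.norm_eq_abs, abs_of_pos hρ0] at hs
  rw [hr] at hy
  have hy : C.it b (sector s) x + Real.exp s.re = C.it b m x + n * C.L := by exact_mod_cast hy
  have := h.sep m (sector s) (-n) (by
    rw [show C.it b m x - C.it b (sector s) x - ((-n : ℤ) : ℝ) * C.L = Real.exp s.re by
      push_cast; linarith, abs_of_pos hρ0]
    linarith)
  push_cast at this
  linarith

theorem GoodRadius.injOn_cone {b : Bool} {x r : ℝ} (h : C.GoodRadius b x r) :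
    Set.InjOn (C.cone b x) (Metric.ball 0 (min 1 (r ^ 2))) := by
  have hk := C.period_pos b x
  intro w hw w' hw' heq
  rw [mem_ball_zero_iff] at hw hw'
  by_cases h0 : w = 0
  · by_cases h0' : w' = 0
    · rw [h0, h0']
    · obtain ⟨l, rfl⟩ := exists_exp_eq_of_ne_zero h0'
      rw [h0, cone_zero, cone_exp] at heq
      exact absurd heq.symm (proj_ne_spiral h (norm_exp_half_mul_lt hk h.pos hw'))
  · obtain ⟨l, rfl⟩ := exists_exp_eq_of_ne_zero h0
    by_cases h0' : w' = 0
    · rw [h0', cone_zero, cone_exp] at heq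
      exact absurd heq (proj_ne_spiral h (norm_exp_half_mul_lt hk h.pos hw))
    · obtain ⟨l', rfl⟩ := exists_exp_eq_of_ne_zero h0'
      rw [cone_exp, cone_exp] at heq
      obtain ⟨j, hj⟩ := h.spiral_inj (norm_exp_half_mul_lt hk h.pos hw)
        (norm_exp_half_mul_lt hk h.pos hw') heq
      rw [exp_eq_exp_iff_exists_int]
      refine ⟨-j, ?_⟩
      have hk' : (C.period b x : ℂ) ≠ 0 := by exact_mod_cast hk.ne'
      have := mul_left_cancel₀ hk' (show (C.period b x : ℂ) * l' =
        C.period b x * (l + j * (2 * Real.pi * I)) by linear_combination 2 * hj)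
      rw [this]; push_cast; ring

theorem map_cone (b : Bool) (x : ℝ) :
    Filter.map (C.cone b x) (𝓝 0) = 𝓝 (C.proj (C.cap b x)) := by
  have hk := C.period_pos b x
  have hz := C.cap_ofReal_mem_strip b x
  obtain ⟨r, h⟩ := C.exists_goodRadius b x
  apply le_antisymm
  · intro V hV
    obtain ⟨ρ, hρ, hV'⟩ := C.exists_disc_subset hz hV
    have hρ' : 0 < min ρ r := lt_min hρ h.pos
    rw [Filter.mem_map]
    refine Filter.mem_of_superset (Metric.ball_mem_nhds 0 (ε := min 1 ((min ρ r) ^ 2))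
      (by positivity)) fun w hw => ?_
    rw [mem_ball_zero_iff] at hw
    by_cases h0 : w = 0
    · rw [Set.mem_preimage, h0, cone_zero]
      exact mem_of_mem_nhds hV
    · obtain ⟨l, rfl⟩ := exists_exp_eq_of_ne_zero h0
      rw [Set.mem_preimage, cone_exp]
      obtain ⟨y, v, h1, h2, h3, h4⟩ := C.spiral_mem_disc b x (ρ := min ρ r)
        ((min_le_right _ _).trans h.le_height) (norm_exp_half_mul_lt hk hρ' hw)
      exact hV' ⟨y, v, h1, h2, h3.trans_le (min_le_left _ _), h4⟩
  · intro V hV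
    rw [Filter.mem_map] at hV
    obtain ⟨ε, hε, hV'⟩ := Metric.mem_nhds_iff.1 hV
    -- Then `|z| < ρ` gives `|w|^k = |z|² < ε^k`, that is `|w| < ε`.
    obtain ⟨ρ, hρ, hρr, hρε⟩ : ∃ ρ > 0, ρ ≤ r ∧ ρ ^ 2 ≤ ε ^ C.period b x := by
      refine ⟨min r (min 1 (ε ^ C.period b x)), by have := h.pos; positivity, min_le_left _ _, ?_⟩
      have h1 : min r (min 1 (ε ^ C.period b x)) ≤ 1 := (min_le_right _ _).trans (min_le_left _ _)
      have h2 : 0 ≤ min r (min 1 (ε ^ C.period b x)) := by have := h.pos; positivity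
      exact (pow_le_of_le_one h2 h1 two_ne_zero).trans
        ((min_le_right _ _).trans (min_le_right _ _))
    refine Filter.mem_of_superset (C.disc_mem_nhds hz hρ) fun p hp => ?_
    by_cases hpz : p = C.proj (C.cap b x)
    · have := hV' (Metric.mem_ball_self hε)
      rwa [Set.mem_preimage, cone_zero, ← hpz] at this
    · obtain ⟨s, hs, rfl⟩ := h.exists_spiral_eq hρr hp hpz
      have hk' : (C.period b x : ℂ) ≠ 0 := by exact_mod_cast hk.ne'
      have h1 : C.period b x / 2 * (2 / C.period b x * s) = s := by field_simp
      have h2 := norm_exp_half_mul_sq (C.period b x) (2 / C.period b x * s)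
      have h3 := C.cone_exp b x (2 / C.period b x * s)
      rw [h1] at h2 h3
      rw [← h3]
      refine hV' ?_
      rw [mem_ball_zero_iff]
      refine lt_of_pow_lt_pow_left₀ (C.period b x) hε.le ?_
      rw [← h2]
      exact (pow_lt_pow_left₀ hs (norm_nonneg _) two_ne_zero).trans_le hρε

theorem GoodRadius.cone_of_im_nonneg {b : Bool} {x r : ℝ} (h : C.GoodRadius b x r)
    (hp : C.period b x = 2) {w : ℂ} (hw : ‖w‖ < r) (hw0 : 0 ≤ w.im) :
    C.cone b x w = C.proj (C.cap b (x + w)) := by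
  by_cases h0 : w = 0
  · rw [h0, cone_zero, add_zero]
  · rw [cone, if_neg h0, hp, Nat.cast_two, div_self two_ne_zero, one_mul, spiral]
    by_cases h1 : w.im = 0 → 0 < w.re
    · have ha : 0 ≤ w.arg := arg_nonneg_iff.2 hw0
      have hb : w.arg < Real.pi := by
        refine (arg_le_pi w).lt_of_ne fun h => ?_
        obtain ⟨h2, h3⟩ := arg_eq_pi_iff.1 h
        linarith [h1 h3]
      have h2 : sector (log w) = 0 := sector_eq (by rw [log_im]; simpa using ha) (by rw [log_im]; simpa using hb)
      rw [sectorPoint, h2]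
      simp [exp_log h0]
    -- On the negative ray the argument is `π`, which belongs to sector 1; the left flip brings the
    -- point back to the half-disc at `x`.
    · push Not at h1
      obtain ⟨h2, h3⟩ := h1
      obtain ⟨ρ, rfl⟩ : ∃ ρ : ℝ, w = -(ρ : ℂ) := ⟨-w.re, Complex.ext (by simp) (by simp [h2])⟩
      have h4 : 0 < ρ := by
        rcases (show 0 ≤ ρ by simpa using h3).eq_or_lt with h5 | h5
        · exact absurd (by simp [← h5]) h0
        · exact h5
      have harg : (-(ρ : ℂ)).arg = Real.pi := by
        rw [arg_eq_pi_iff]; simpa using h4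
      have h5 : sector (log (-(ρ : ℂ))) = 1 :=
        sector_eq (by simp [log_im, harg]) (by rw [log_im, harg]; have := Real.pi_pos; push_cast; linarith)
      rw [norm_neg, norm_real, Real.norm_eq_abs, abs_of_pos h4] at hw
      have h6 := h.proj_left 0 h4.le hw
      rw [it_zero, zero_add] at h6
      rw [sectorPoint_eq, h5, exp_log h0, ← sub_eq_add_neg, h6]
      congr 3
      simp [sectorSign, exp_neg, exp_pi_mul_I]

/-- With two half-discs, a half-turn exchanges the cones at `x` and at `g x`: from `-exp l = exp (l
+ π i)` the total shift is `2 π i`, one period. So the lower half-disc at `x` is the upper one at `g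
x`, rotated. -/
theorem GoodRadius.cone_of_im_nonpos {b : Bool} {x r : ℝ} (h : C.GoodRadius b x r)
    (hp : C.period b x = 2) {w : ℂ} (hw : ‖w‖ < r) (hw0 : w.im ≤ 0) :
    C.cone b x w = C.proj (C.cap b (C.g b x - w)) := by
  have hper : C.period b (C.g b x) = 2 := by rw [← it_one, period_it, hp]
  have hgood : C.GoodRadius b (C.g b x) r := by
    refine ⟨h.pos, h.le_height, fun m ρ h0 h1 => ?_, fun m ρ h0 h1 => ?_, fun m m' n => ?_⟩
    · rw [← C.it_one b x, it_it, it_it, h.left _ _ h0 h1]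
    · rw [← C.it_one b x, it_it, it_it, h.right _ _ h0 h1]
      congr 2; ring
    · rw [← it_one, it_it, it_it]
      exact h.sep _ _ _
  have key : C.cone b (C.g b x) (-w) = C.cone b x w := by
    by_cases h0 : w = 0
    · rw [h0, neg_zero, cone_zero, cone_zero, ← it_one, proj_cap_it]
    · obtain ⟨l, rfl⟩ := exists_exp_eq_of_ne_zero h0
      have h1 : -exp l = exp (l + Real.pi * I) := by rw [exp_add, exp_pi_mul_I]; ring
      rw [h1, cone_exp, cone_exp, hper, hp, ← it_one, spiral_it,
        ← C.spiral_add_period b x ((2 : ℕ) / 2 * l) 1, hp]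
      congr 1
      push_cast; ring
  rw [← key, hgood.cone_of_im_nonneg hper (by rwa [norm_neg]) (by simpa using hw0), sub_eq_add_neg]

end Cone

end FlatCylinder

/-! ### The flat structure of the glued surface. -/

namespace FlatCylinder

variable (C : FlatCylinder)

/-- The natural parametrizations around the points of cone angle `2π`. -/
def natural : Set (ℂ → C.Surface) :=
  {N | (∃ z : ℂ, 0 < z.im ∧ z.im < C.H.im ∧ N = fun w => C.proj (z + w)) ∨
    ∃ b, ∃ x : ℝ, C.period b x = 2 ∧ N = C.cone b x}

variable {C}

theorem mem_strip_of_interior {z : ℂ} (h0 : 0 < z.im) (h1 : z.im < C.H.im) : z ∈ C.strip :=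
  ⟨h0.le, h1.le⟩

theorem not_rel_cap_interior {z : ℂ} (h0 : 0 < z.im) (h1 : z.im < C.H.im) (b : Bool) (x : ℝ) :
    C.proj (C.cap b x) ≠ C.proj z := by
  intro h
  have h2 := (C.proj_eq_iff (C.cap_ofReal_mem_strip b x) (mem_strip_of_interior h0 h1)).1 h
  obtain ⟨m, y, _, rfl⟩ := C.rel_cap.1 h2
  cases b <;> simp [cap] at h0 h1

theorem map_proj_interior {z : ℂ} (h0 : 0 < z.im) (h1 : z.im < C.H.im) :
    Filter.map (fun w => C.proj (z + w)) (𝓝 0) = 𝓝 (C.proj z) := by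
  have hz := mem_strip_of_interior h0 h1
  apply le_antisymm
  · have : ContinuousAt (fun w => C.proj (z + w)) 0 :=
      (C.continuous_proj.comp (continuous_const.add continuous_id)).continuousAt
    simpa [ContinuousAt, Filter.Tendsto] using this
  · intro V hV
    rw [Filter.mem_map] at hV
    obtain ⟨ε, hε, hV'⟩ := Metric.mem_nhds_iff.1 hV
    refine Filter.mem_of_superset (C.disc_mem_nhds hz hε) ?_
    rintro p ⟨y, w, hy, hw, hwy, rfl⟩
    obtain ⟨n, rfl⟩ := C.rel_of_interior h0 h1 hy
    have := hV' (a := w - (z + n * C.L)) (by simpa using hwy)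
    rw [Set.mem_preimage, ← C.proj_add_int _ n] at this
    rwa [show z + (w - (z + n * C.L)) + n * C.L = w by ring] at this

theorem injOn_proj_interior {z : ℂ} {r : ℝ} (h0 : r ≤ z.im) (h1 : r ≤ C.H.im - z.im)
    (h2 : 2 * r ≤ C.L) : Set.InjOn (fun w => C.proj (z + w)) (Metric.ball 0 r) := by
  intro w hw w' hw' h
  rw [mem_ball_zero_iff] at hw hw'
  have e1 := abs_lt.1 ((Complex.abs_im_le_norm _).trans_lt hw)
  have e2 := abs_lt.1 ((Complex.abs_im_le_norm _).trans_lt hw')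
  have i0 : 0 < (z + w).im := by rw [Complex.add_im]; linarith [e1.1]
  have i1 : (z + w).im < C.H.im := by rw [Complex.add_im]; linarith [e1.2]
  have j0 : 0 < (z + w').im := by rw [Complex.add_im]; linarith [e2.1]
  have j1 : (z + w').im < C.H.im := by rw [Complex.add_im]; linarith [e2.2]
  obtain ⟨n, hn⟩ := C.rel_of_interior i0 i1
    ((C.proj_eq_iff (mem_strip_of_interior i0 i1) (mem_strip_of_interior j0 j1)).1 h)
  have h3 : ‖(n : ℂ) * C.L‖ < C.L := by
    rw [show (n : ℂ) * C.L = w' - w by linear_combination -hn]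
    exact (norm_sub_le _ _).trans_lt (by linarith)
  rw [norm_mul, Complex.norm_real, Real.norm_eq_abs, abs_of_pos C.L_pos, Complex.norm_intCast] at h3
  have h4 : |(n : ℝ)| < 1 := by
    by_contra h5
    nlinarith [C.L_pos]
  have h5 : n = 0 := Int.abs_lt_one_iff.1 (by exact_mod_cast h4)
  rw [h5] at hn
  simpa using hn.symm

theorem exists_radius_interior {z : ℂ} (h0 : 0 < z.im) (h1 : z.im < C.H.im) :
    ∃ r > 0, r ≤ z.im ∧ r ≤ C.H.im - z.im ∧ 2 * r ≤ C.L := by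
  have h2 := C.L_pos
  refine ⟨min (min z.im (C.H.im - z.im)) (C.L / 2),
    lt_min (lt_min h0 (sub_pos.2 h1)) (by positivity), (min_le_left _ _).trans (min_le_left _ _),
    (min_le_left _ _).trans (min_le_right _ _), ?_⟩
  linarith [min_le_right (min z.im (C.H.im - z.im)) (C.L / 2)]

theorem flatAt_proj {z w : ℂ} (h0 : 0 < (z + w).im) (h1 : (z + w).im < C.H.im) :
    FlatAt C.natural (fun _ => 1) (fun w => C.proj (z + w)) w := by
  refine ⟨_, Or.inl ⟨z + w, h0, h1, rfl⟩, fun v => v - w, 1, by simp,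
    (hasStrictDerivAt_id w).sub_const w, by simp, Filter.Eventually.of_forall fun v => ?_⟩
  simp

open Complex in
-- Away from the apex the natural coordinate is `±(z - z₀)` with `z = exp s`. In the open half-disc
-- it is the coordinate of the strip. On the ray between sectors `m - 1` and `m` it is the cone at
-- the edge point `it m x + ρ`, whose two half-discs lie in these two sectors.
theorem GoodRadius.exists_natural_spiral {b : Bool} {x r : ℝ} (h : C.GoodRadius b x r) {s₀ : ℂ}
    (hs₀ : ‖exp s₀‖ < r) : ∃ N ∈ C.natural, ∃ ε : ℂ, ε ^ 2 = 1 ∧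
      ∀ᶠ s in 𝓝 s₀, C.spiral b x s = N (ε * (exp s - exp s₀)) := by
  set m := sector s₀ with hm
  have hpi := Real.pi_pos
  have hup : ∀ᶠ s : ℂ in 𝓝 s₀, s.im < (m + 1) * Real.pi :=
    continuous_im.continuousAt.eventually_lt_const (lt_sector_add_one s₀)
  by_cases him : 0 < (sectorPoint s₀).im
  · have h1 : (sectorPoint s₀).im < C.H.im := by
      rw [← norm_sectorPoint] at hs₀
      exact (le_abs_self _).trans_lt ((abs_im_le_norm _).trans_lt (hs₀.trans_le h.le_height))
    refine ⟨_, Or.inl ⟨C.cap b (C.it b m x + sectorPoint s₀), ?_, ?_, rfl⟩,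
      capSign b * sectorSign m, by rw [mul_pow, capSign_sq, sectorSign_sq, one_mul], ?_⟩
    · rw [cap_im]; cases b <;> simp <;> linarith
    · rw [cap_im]; cases b <;> simp <;> linarith
    · have hlo : ∀ᶠ s : ℂ in 𝓝 s₀, m * Real.pi < s.im :=
        continuous_im.continuousAt.eventually_const_lt (sector_lt_of_im_pos him)
      filter_upwards [hup, hlo] with s hs1 hs2
      have hs := sector_eq hs2.le hs1
      rw [spiral, sectorPoint_eq, sectorPoint_eq, hs, ← hm, mul_assoc, ← cap_add]
      congr 2
      ring
  · have him0 : (sectorPoint s₀).im = 0 := le_antisymm (not_lt.1 him) (sectorPoint_im_nonneg s₀)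
    have hr := sectorPoint_of_im_eq (im_eq_of_sectorPoint_im_eq_zero him0)
    set ρ := Real.exp s₀.re with hρ
    have hρ0 : 0 < ρ := Real.exp_pos _
    rw [← norm_sectorPoint, hr, norm_real, Real.norm_eq_abs, abs_of_pos hρ0] at hs₀
    have hper := h.period_edge m hρ0 hs₀
    obtain ⟨r', hr'⟩ := C.exists_goodRadius b (C.it b m x + ρ)
    refine ⟨_, Or.inr ⟨b, C.it b m x + ρ, hper, rfl⟩, sectorSign m, sectorSign_sq m, ?_⟩
    have hlo : ∀ᶠ s : ℂ in 𝓝 s₀, (m - 1) * Real.pi < s.im :=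
      continuous_im.continuousAt.eventually_const_lt (by
        rw [im_eq_of_sectorPoint_im_eq_zero him0, ← hm]; linarith)
    have hsmall : ∀ᶠ s : ℂ in 𝓝 s₀, ‖sectorSign m * (exp s - exp s₀)‖ < r' := by
      have : ContinuousAt (fun s => ‖sectorSign m * (exp s - exp s₀)‖) s₀ := by fun_prop
      exact this.eventually_lt_const (by simpa using hr'.pos)
    have hρm : sectorSign m * exp s₀ = ρ := by rw [hm, ← sectorPoint_eq, hr]
    filter_upwards [hup, hlo, hsmall] with s hs1 hs2 hs3
    rcases le_or_gt (m * Real.pi) s.im with hs4 | hs4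
    · have hs := sector_eq hs4 hs1
      have hu : sectorPoint s = ρ + sectorSign m * (exp s - exp s₀) := by
        rw [sectorPoint_eq, hs, ← hρm]; ring
      have hu0 := sectorPoint_im_nonneg s
      rw [hr'.cone_of_im_nonneg hper hs3 (by rw [hu] at hu0; simpa using hu0), spiral, hs, hu]
      congr 2
      push_cast; ring
    -- Below the ray the point is seen from `it (m - 1) x`, next to the flipped edge point `it (m -
    -- 1) x - ρ`.
    · have hs : sector s = m - 1 := sector_eq (by push_cast; linarith) (by push_cast; linarith)
      have hu : sectorPoint s = -ρ - sectorSign m * (exp s - exp s₀) := by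
        rw [sectorPoint_eq, hs, sectorSign_sub_one, ← hρm]; ring
      have hu0 := sectorPoint_im_nonneg s
      rw [hr'.cone_of_im_nonpos hper hs3 (by
        rw [hu] at hu0; simp only [sub_im, neg_im, ofReal_im] at hu0; linarith), ← it_one,
        h.it_edge_one m hρ0 hs₀, spiral, hs, hu]
      congr 2
      push_cast; ring

open Complex in
-- For `z = w^(k/2)` one has `(dz/dw)² = (k/2)² w^(k-2)`, the cone density.
theorem GoodRadius.flatAt_cone {b : Bool} {x r : ℝ} (h : C.GoodRadius b x r) {w : ℂ}
    (hw : w ∈ Metric.ball 0 (min 1 (r ^ 2))) (hw0 : w ≠ 0) :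
    FlatAt C.natural (coneDensity (C.period b x)) (C.cone b x) w := by
  rw [mem_ball_zero_iff] at hw
  obtain ⟨l, rfl⟩ := exists_exp_eq_of_ne_zero hw0
  set k := C.period b x with hk
  obtain ⟨N, hN, ε, hε, hloc⟩ :=
    h.exists_natural_spiral (norm_exp_half_mul_lt (C.period_pos b x) h.pos hw)
  rw [← hk] at hloc
  -- A branch of the logarithm centred at `exp l`, holomorphic there even if `exp l` lies on the cut
  -- of `log`.
  set lg : ℂ → ℂ := fun w => log (w / exp l) + l with hlg
  have hlg0 : lg (exp l) = l := by simp [hlg]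
  have hlge : ∀ᶠ w in 𝓝 (exp l), exp (lg w) = w := by
    filter_upwards [continuousAt_id.eventually_ne (exp_ne_zero l)] with w hw
    have hw : w ≠ 0 := hw
    rw [hlg, exp_add, exp_log (div_ne_zero hw (exp_ne_zero l)), div_mul_cancel₀ _ (exp_ne_zero l)]
  have hlgd : HasStrictDerivAt lg (exp l)⁻¹ (exp l) := by
    have h1 : HasStrictDerivAt (fun w : ℂ => w / exp l) (1 / exp l) (exp l) :=
      (hasStrictDerivAt_id _).div_const _
    have h2 := h1.clog (by rw [div_self (exp_ne_zero l)]; exact one_mem_slitPlane)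
    rw [div_self (exp_ne_zero l)] at h2
    rw [one_div, div_one] at h2
    exact h2.add_const l
  have hs : HasStrictDerivAt (fun w => (k : ℂ) / 2 * lg w) (k / 2 * (exp l)⁻¹) (exp l) :=
    hlgd.const_mul _
  have hA : HasStrictDerivAt (fun w => ε * (exp ((k : ℂ) / 2 * lg w) - exp (k / 2 * l)))
      (ε * (exp (k / 2 * lg (exp l)) * (k / 2 * (exp l)⁻¹))) (exp l) :=
    HasStrictDerivAt.const_mul ε (hs.cexp.sub_const (exp (k / 2 * l)))
  refine ⟨N, hN, _, _, by simp [hlg0], hA, ?_, ?_⟩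
  · rw [hlg0, coneDensity, mul_pow, hε, mul_pow, mul_pow, ← exp_nat_mul,
      show ((2 : ℕ) : ℂ) * (k / 2 * l) = k * l by push_cast; ring, exp_nat_mul,
      zpow_sub₀ (exp_ne_zero l), zpow_natCast]
    rw [show ((2 : ℤ)) = ((2 : ℕ) : ℤ) from rfl, zpow_natCast]
    field_simp
  · have hc : Filter.Tendsto (fun w => (k : ℂ) / 2 * lg w) (𝓝 (exp l)) (𝓝 (k / 2 * l)) := by
      have := hs.hasDerivAt.continuousAt.tendsto
      rwa [hlg0] at this
    filter_upwards [hlge, hc.eventually hloc] with w h1 h2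
    rw [Function.comp_apply, ← h2, hk, ← cone_exp, h1]

open Complex in
-- Moving the base point by `m` steps turns the cone by `m π`; at a point of period 2 this is
-- multiplication by `(-1)^m`.
theorem cone_unique {b b' : Bool} {x x' : ℝ} (h : C.proj (C.cap b x) = C.proj (C.cap b' x'))
    (hp : C.period b x = 2) : ∃ σ : ℂ, σ ^ 2 = 1 ∧ ∀ z, C.cone b' x' z = C.cone b x (σ * z) := by
  obtain ⟨rfl, m, hm⟩ := proj_cap_eq_iff.1 h
  have hp' : C.period b x' = 2 := by rw [C.period_congr hm, period_it, hp]
  refine ⟨sectorSign (-m), sectorSign_sq _, fun z => ?_⟩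
  by_cases h0 : z = 0
  · rw [h0, mul_zero, cone_zero, cone_zero, h]
  · obtain ⟨l, rfl⟩ := exists_exp_eq_of_ne_zero h0
    rw [sectorSign, ← exp_add, cone_exp, cone_exp, hp, hp', spiral_congr hm, spiral_it]
    congr 1
    push_cast; ring

/-- The fields of the flat atlas are chosen from this existential, so it must itself pin down `k`:
the last two clauses do so for every representative of `p`. -/
theorem exists_param (p : C.Surface) : ∃ (k : ℕ) (ψ : ℂ → C.Surface) (r : ℝ), 0 < k ∧ 0 < r ∧
    ψ 0 = p ∧ Set.InjOn ψ (Metric.ball 0 r) ∧ Filter.map ψ (𝓝 0) = 𝓝 p ∧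
    (∀ w ∈ Metric.ball 0 r, w ≠ 0 → FlatAt C.natural (coneDensity k) ψ w) ∧
    (∀ b, ∀ x : ℝ, p = C.proj (C.cap b x) → k = C.period b x) ∧
    ∀ z : ℂ, 0 < z.im → z.im < C.H.im → p = C.proj z → k = 2 := by
  obtain ⟨z, hz, rfl⟩ := C.proj_surjective p
  by_cases h : 0 < z.im ∧ z.im < C.H.im
  · obtain ⟨r, hr, h0, h1, h2⟩ := exists_radius_interior h.1 h.2
    refine ⟨2, fun w => C.proj (z + w), r, two_pos, hr, by simp, injOn_proj_interior h0 h1 h2,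
      map_proj_interior h.1 h.2, ?_, ?_, fun _ _ _ _ => rfl⟩
    · intro w hw _
      rw [mem_ball_zero_iff] at hw
      have e1 := abs_lt.1 ((Complex.abs_im_le_norm _).trans_lt hw)
      have : coneDensity 2 = fun _ => 1 := by funext w; simp [coneDensity]
      rw [this]
      exact flatAt_proj (by rw [Complex.add_im]; linarith [e1.1])
        (by rw [Complex.add_im]; linarith [e1.2])
    · intro b x hx
      exact absurd hx.symm (not_rel_cap_interior h.1 h.2 b x)
  · obtain ⟨b, x, rfl⟩ := C.exists_eq_cap hz h
    obtain ⟨r, hr⟩ := C.exists_goodRadius b x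
    refine ⟨C.period b x, C.cone b x, min 1 (r ^ 2), C.period_pos b x,
      lt_min one_pos (pow_pos hr.pos 2), C.cone_zero b x, hr.injOn_cone, map_cone b x,
      fun w hw hw0 => hr.flatAt_cone hw hw0, ?_, ?_⟩
    · intro b' x' h'
      obtain ⟨rfl, m, hm⟩ := proj_cap_eq_iff.1 h'
      rw [C.period_congr hm, period_it]
    · intro z h0 h1 h2
      exact absurd h2 (not_rel_cap_interior h0 h1 b x)

variable (C)

/-- The flat structure of the glued surface. -/
noncomputable def flatAtlas : FlatAtlas C.Surface where
  nat := C.natural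
  nat_inj := by
    rintro N (⟨z, h0, h1, rfl⟩ | ⟨b, x, _, rfl⟩)
    · obtain ⟨r, hr, h2, h3, h4⟩ := exists_radius_interior h0 h1
      exact ⟨_, Metric.ball_mem_nhds 0 hr, injOn_proj_interior h2 h3 h4⟩
    · obtain ⟨r, hr⟩ := C.exists_goodRadius b x
      exact ⟨_, Metric.ball_mem_nhds 0 (lt_min one_pos (pow_pos hr.pos 2)), hr.injOn_cone⟩
  nat_map := by
    rintro N (⟨z, h0, h1, rfl⟩ | ⟨b, x, _, rfl⟩)
    · simpa using map_proj_interior h0 h1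
    · rw [cone_zero]
      exact map_cone b x
  nat_unique := by
    rintro N (⟨z, h0, h1, rfl⟩ | ⟨b, x, hp, rfl⟩) N' (⟨z', h0', h1', rfl⟩ | ⟨b', x', hp', rfl⟩) h
    · simp only [add_zero] at h
      obtain ⟨n, rfl⟩ := C.rel_of_interior h0 h1
        ((C.proj_eq_iff (mem_strip_of_interior h0 h1) (mem_strip_of_interior h0' h1')).1 h)
      refine ⟨1, one_pow 2, Filter.Eventually.of_forall fun w => ?_⟩
      change C.proj (z + n * C.L + w) = C.proj (z + 1 * w)
      rw [one_mul, add_right_comm, proj_add_int]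
    · simp only [add_zero, cone_zero] at h
      exact absurd h.symm (not_rel_cap_interior h0 h1 b' x')
    · simp only [add_zero, cone_zero] at h
      exact absurd h (not_rel_cap_interior h0' h1' b x)
    · rw [cone_zero, cone_zero] at h
      obtain ⟨σ, hσ, h'⟩ := cone_unique h hp
      exact ⟨σ, hσ, Filter.Eventually.of_forall h'⟩
  order p := (exists_param p).choose
  order_pos p := (exists_param p).choose_spec.choose_spec.choose_spec.1
  param p := (exists_param p).choose_spec.choose
  radius p := (exists_param p).choose_spec.choose_spec.choose
  radius_pos p := (exists_param p).choose_spec.choose_spec.choose_spec.2.1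
  param_zero p := (exists_param p).choose_spec.choose_spec.choose_spec.2.2.1
  param_inj p := (exists_param p).choose_spec.choose_spec.choose_spec.2.2.2.1
  param_map p := (exists_param p).choose_spec.choose_spec.choose_spec.2.2.2.2.1
  param_flat p := (exists_param p).choose_spec.choose_spec.choose_spec.2.2.2.2.2.1

theorem order_cap (b : Bool) (x : ℝ) :
    C.flatAtlas.order (C.proj (C.cap b x)) = C.period b x :=
  (exists_param (C.proj (C.cap b x))).choose_spec.choose_spec.choose_spec.2.2.2.2.2.2.1 b x rfl

theorem order_interior {z : ℂ} (h0 : 0 < z.im) (h1 : z.im < C.H.im) :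
    C.flatAtlas.order (C.proj z) = 2 :=
  (exists_param (C.proj z)).choose_spec.choose_spec.choose_spec.2.2.2.2.2.2.2 z h0 h1 rfl

theorem proj_pullback {z : ℂ} (h0 : 0 < z.im) (h1 : z.im < C.H.im) (q : C.Surface)
    (hq : C.proj z ∈ (C.flatAtlas.chart q).source) :
    DifferentiableAt ℂ (C.flatAtlas.chart q ∘ C.proj) z ∧ ∀ᶠ w in 𝓝[≠] z,
      coneDensity (C.flatAtlas.order q) (C.flatAtlas.chart q (C.proj w)) *
        deriv (C.flatAtlas.chart q ∘ C.proj) w ^ 2 = 1 := by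
  refine C.flatAtlas.natural_pullback ?_ ?_ q hq
  · have e0 : ∀ᶠ w : ℂ in 𝓝 z, 0 < w.im :=
      Complex.continuous_im.continuousAt.eventually_const_lt h0
    have e1 : ∀ᶠ w : ℂ in 𝓝 z, w.im < C.H.im :=
      Complex.continuous_im.continuousAt.eventually_lt_const h1
    filter_upwards [e0, e1] with w hw0 hw1
    have := flatAt_proj (C := C) (z := 0) (w := w) (by simpa using hw0) (by simpa using hw1)
    simp only [zero_add] at this
    exact this
  · obtain ⟨r, hr, h2, h3, h4⟩ := exists_radius_interior h0 h1
    have hinj := injOn_proj_interior h2 h3 h4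
    filter_upwards [self_mem_nhdsWithin, nhdsWithin_le_nhds (Metric.ball_mem_nhds z hr)]
      with w hw hwr heq
    have := hinj (x₁ := w - z) (by simpa [dist_eq_norm] using hwr)
      (x₂ := 0) (by simpa using hr) (by simpa using heq)
    exact hw (by simpa [sub_eq_zero] using this)

instance : ConnectedSpace C.Surface := by
  have h : Function.Surjective C.proj := fun p => by
    obtain ⟨z, _, h⟩ := C.proj_surjective p
    exact ⟨z, h⟩
  exact h.connectedSpace C.continuous_proj

instance : CompactSpace C.Surface := by
  have hc : IsCompact (Set.Icc (0 : ℝ) C.L ×ℂ Set.Icc 0 C.H.im) :=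
    isCompact_Icc.reProdIm isCompact_Icc
  have := hc.image C.continuous_proj
  refine ⟨?_⟩
  convert this
  refine (Set.eq_univ_of_forall fun p => ?_).symm
  obtain ⟨z, hz, rfl⟩ := C.proj_surjective p
  obtain ⟨n, hn, -⟩ := existsUnique_add_zsmul_mem_Ico C.L_pos z.re 0
  refine ⟨z + n * C.L, ⟨?_, ?_⟩, C.proj_add_int z n⟩
  · simp at hn ⊢
    exact ⟨hn.1, hn.2.le⟩
  · simpa [strip] using hz

end FlatCylinder

/-! ### Pairings of the edges of a subdivided circle -/

/-- A subdivision of the circle of length `x n` into `n` edges, and a fixed point free involution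
of the edges which preserves lengths. -/
structure EdgePairing where
  n : ℕ
  n_pos : 0 < n
  x : ℕ → ℝ
  x_zero : x 0 = 0
  x_lt : ∀ i < n, x i < x (i + 1)
  ι : ℕ → ℕ
  ι_lt : ∀ i < n, ι i < n
  ι_ι : ∀ i < n, ι (ι i) = i
  ι_ne : ∀ i < n, ι i ≠ i
  length_eq : ∀ i < n, x (ι i + 1) - x (ι i) = x (i + 1) - x i

namespace EdgePairing

variable (E : EdgePairing)

theorem x_le {i j : ℕ} (hij : i ≤ j) (hj : j ≤ E.n) : E.x i ≤ E.x j := by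
  induction j, hij using Nat.le_induction with
  | base => exact le_rfl
  | succ k hk ih => exact (ih (by omega)).trans (E.x_lt k (by omega)).le

theorem x_lt_of_lt {i j : ℕ} (hij : i < j) (hj : j ≤ E.n) : E.x i < E.x j :=
  (E.x_lt i (by omega)).trans_le (E.x_le hij hj)

theorem length_pos : 0 < E.x E.n := by
  rw [← E.x_zero]
  exact E.x_lt_of_lt E.n_pos le_rfl

/-- `t` lies in the edge `j`, translated by `q` turns, the left endpoint being excluded. -/
def InLeft (j : ℕ) (q : ℤ) (t : ℝ) : Prop :=
  j < E.n ∧ E.x j + q * E.x E.n < t ∧ t ≤ E.x (j + 1) + q * E.x E.n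

/-- `t` lies in the edge `j`, translated by `q` turns, the right endpoint being excluded. -/
def InRight (j : ℕ) (q : ℤ) (t : ℝ) : Prop :=
  j < E.n ∧ E.x j + q * E.x E.n ≤ t ∧ t < E.x (j + 1) + q * E.x E.n

theorem exists_inLeft (t : ℝ) : ∃ j q, E.InLeft j q t := by
  obtain ⟨q, hq, -⟩ := existsUnique_add_zsmul_mem_Ioc E.length_pos t 0
  simp only [zero_add, zsmul_eq_mul] at hq
  have key : ∀ m ≤ E.n, t + q * E.x E.n ≤ E.x m →
      ∃ j < m, E.x j < t + q * E.x E.n ∧ t + q * E.x E.n ≤ E.x (j + 1) := by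
    intro m
    induction m with
    | zero => intro _ h; rw [E.x_zero] at h; exact absurd hq.1 (not_lt.2 h)
    | succ m ih =>
      intro hm h
      rcases le_or_gt (t + q * E.x E.n) (E.x m) with h1 | h1
      · obtain ⟨j, hj, h2⟩ := ih (by omega) h1
        exact ⟨j, by omega, h2⟩
      · exact ⟨m, by omega, h1, h⟩
  obtain ⟨j, hj, h1, h2⟩ := key E.n le_rfl hq.2
  exact ⟨j, -q, hj, by push_cast; linarith, by push_cast; linarith⟩

theorem exists_inRight (t : ℝ) : ∃ j q, E.InRight j q t := by
  obtain ⟨q, hq, -⟩ := existsUnique_add_zsmul_mem_Ico E.length_pos t 0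
  simp only [zero_add, zsmul_eq_mul] at hq
  have key : ∀ m ≤ E.n, t + q * E.x E.n < E.x m →
      ∃ j < m, E.x j ≤ t + q * E.x E.n ∧ t + q * E.x E.n < E.x (j + 1) := by
    intro m
    induction m with
    | zero => intro _ h; rw [E.x_zero] at h; exact absurd hq.1 (not_le.2 h)
    | succ m ih =>
      intro hm h
      rcases lt_or_ge (t + q * E.x E.n) (E.x m) with h1 | h1
      · obtain ⟨j, hj, h2⟩ := ih (by omega) h1
        exact ⟨j, by omega, h2⟩
      · exact ⟨m, by omega, h1, h⟩
  obtain ⟨j, hj, h1, h2⟩ := key E.n le_rfl hq.2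
  exact ⟨j, -q, hj, by push_cast; linarith, by push_cast; linarith⟩

variable {E}

theorem InLeft.unique {j j' : ℕ} {q q' : ℤ} {t : ℝ} (h : E.InLeft j q t) (h' : E.InLeft j' q' t) :
    j = j' ∧ q = q' := by
  obtain ⟨hj, h1, h2⟩ := h
  obtain ⟨hj', h1', h2'⟩ := h'
  have a1 := E.x_le (Nat.zero_le j) hj.le
  have a2 := E.x_le (Nat.succ_le_of_lt hj) le_rfl
  have a1' := E.x_le (Nat.zero_le j') hj'.le
  have a2' := E.x_le (Nat.succ_le_of_lt hj') le_rfl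
  rw [E.x_zero] at a1 a1'
  have hL := E.length_pos
  have e1 : (q : ℝ) < q' + 1 := by
    by_contra h; push Not at h; nlinarith
  have e2 : (q' : ℝ) < q + 1 := by
    by_contra h; push Not at h; nlinarith
  have e1' : q < q' + 1 := by exact_mod_cast e1
  have e2' : q' < q + 1 := by exact_mod_cast e2
  obtain rfl : q = q' := by omega
  refine ⟨?_, rfl⟩
  rcases lt_trichotomy j j' with h | h | h
  · linarith [E.x_le (Nat.succ_le_of_lt h) hj'.le]
  · exact h
  · linarith [E.x_le (Nat.succ_le_of_lt h) hj.le]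

theorem InRight.unique {j j' : ℕ} {q q' : ℤ} {t : ℝ} (h : E.InRight j q t)
    (h' : E.InRight j' q' t) : j = j' ∧ q = q' := by
  obtain ⟨hj, h1, h2⟩ := h
  obtain ⟨hj', h1', h2'⟩ := h'
  have a1 := E.x_le (Nat.zero_le j) hj.le
  have a2 := E.x_le (Nat.succ_le_of_lt hj) le_rfl
  have a1' := E.x_le (Nat.zero_le j') hj'.le
  have a2' := E.x_le (Nat.succ_le_of_lt hj') le_rfl
  rw [E.x_zero] at a1 a1'
  have hL := E.length_pos
  have e1 : (q : ℝ) < q' + 1 := by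
    by_contra h; push Not at h; nlinarith
  have e2 : (q' : ℝ) < q + 1 := by
    by_contra h; push Not at h; nlinarith
  have e1' : q < q' + 1 := by exact_mod_cast e1
  have e2' : q' < q + 1 := by exact_mod_cast e2
  obtain rfl : q = q' := by omega
  refine ⟨?_, rfl⟩
  rcases lt_trichotomy j j' with h | h | h
  · linarith [E.x_le (Nat.succ_le_of_lt h) hj'.le]
  · exact h
  · linarith [E.x_le (Nat.succ_le_of_lt h) hj.le]

theorem InLeft.add {j : ℕ} {q : ℤ} {t : ℝ} (h : E.InLeft j q t) (m : ℤ) :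
    E.InLeft j (q + m) (t + m * E.x E.n) :=
  ⟨h.1, by push_cast; linarith [h.2.1], by push_cast; linarith [h.2.2]⟩

theorem InRight.add {j : ℕ} {q : ℤ} {t : ℝ} (h : E.InRight j q t) (m : ℤ) :
    E.InRight j (q + m) (t + m * E.x E.n) :=
  ⟨h.1, by push_cast; linarith [h.2.1], by push_cast; linarith [h.2.2]⟩

variable (E)

/-- The central symmetry exchanging the edge `j` and its partner is `t ↦ center j - t`. -/
def center (j : ℕ) : ℝ := E.x j + E.x (E.ι j + 1)

theorem center_ι {j : ℕ} (hj : j < E.n) : E.center (E.ι j) = E.center j := by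
  have := E.length_eq j hj
  rw [center, center, E.ι_ι j hj]
  linarith

/-- The gluing map, continuous on the left. -/
noncomputable def fold (t : ℝ) : ℝ := E.center (E.exists_inLeft t).choose - t

/-- The gluing map, continuous on the right. -/
noncomputable def unfold (t : ℝ) : ℝ := E.center (E.exists_inRight t).choose - t

variable {E}

theorem InLeft.fold_eq {j : ℕ} {q : ℤ} {t : ℝ} (h : E.InLeft j q t) :
    E.fold t = E.center j - t := by
  rw [fold, (E.exists_inLeft t).choose_spec.choose_spec.unique h |>.1]

theorem InRight.unfold_eq {j : ℕ} {q : ℤ} {t : ℝ} (h : E.InRight j q t) :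
    E.unfold t = E.center j - t := by
  rw [unfold, (E.exists_inRight t).choose_spec.choose_spec.unique h |>.1]

/-- A central symmetry exchanges the two kinds of half-open edges. Therefore `unfold` inverts
`fold`, and the gluing, two-valued at the vertices, becomes a permutation of the line. -/
theorem InLeft.inRight_fold {j : ℕ} {q : ℤ} {t : ℝ} (h : E.InLeft j q t) :
    E.InRight (E.ι j) (-q) (E.fold t) := by
  have := E.length_eq j h.1
  rw [h.fold_eq, center]
  exact ⟨E.ι_lt j h.1, by push_cast; linarith [h.2.2], by push_cast; linarith [h.2.1]⟩

theorem InRight.inLeft_unfold {j : ℕ} {q : ℤ} {t : ℝ} (h : E.InRight j q t) :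
    E.InLeft (E.ι j) (-q) (E.unfold t) := by
  have := E.length_eq j h.1
  rw [h.unfold_eq, center]
  exact ⟨E.ι_lt j h.1, by push_cast; linarith [h.2.2], by push_cast; linarith [h.2.1]⟩

variable (E)

/-- The gluing map, as a permutation. -/
noncomputable def foldPerm : Equiv.Perm ℝ where
  toFun := E.fold
  invFun := E.unfold
  left_inv t := by
    obtain ⟨j, q, h⟩ := E.exists_inLeft t
    rw [h.inRight_fold.unfold_eq, E.center_ι h.1, h.fold_eq, sub_sub_cancel]
  right_inv t := by
    obtain ⟨j, q, h⟩ := E.exists_inRight t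
    rw [h.inLeft_unfold.fold_eq, E.center_ι h.1, h.unfold_eq, sub_sub_cancel]

theorem foldPerm_apply (t : ℝ) : E.foldPerm t = E.fold t := rfl

theorem fold_add_int (t : ℝ) (m : ℤ) : E.fold (t + m * E.x E.n) = E.fold t - m * E.x E.n := by
  obtain ⟨j, q, h⟩ := E.exists_inLeft t
  rw [(h.add m).fold_eq, h.fold_eq]
  ring

theorem fold_flip (t : ℝ) : ∃ r > 0, (∀ ρ, 0 ≤ ρ → ρ < r → E.fold (t - ρ) = E.fold t + ρ) ∧
    ∀ ρ, 0 < ρ → ρ < r → E.fold (t + ρ) = E.unfold t - ρ := by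
  obtain ⟨j, q, h⟩ := E.exists_inLeft t
  obtain ⟨j', q', h'⟩ := E.exists_inRight t
  refine ⟨min (t - (E.x j + q * E.x E.n)) (E.x (j' + 1) + q' * E.x E.n - t),
    lt_min (sub_pos.2 h.2.1) (sub_pos.2 h'.2.2), fun ρ h0 h1 => ?_, fun ρ h0 h1 => ?_⟩
  · have h2 := h1.trans_le (min_le_left _ _)
    have h3 : E.InLeft j q (t - ρ) := ⟨h.1, by linarith, by linarith [h.2.2]⟩
    rw [h3.fold_eq, h.fold_eq]
    ring
  · have h2 := h1.trans_le (min_le_right _ _)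
    have h3 : E.InLeft j' q' (t + ρ) := ⟨h'.1, by linarith [h'.2.1], by linarith⟩
    rw [h3.fold_eq, h'.unfold_eq]
    ring

/-- The vertex to which the vertex `j` is sent by the gluing map. -/
def next (j : ℕ) : ℕ := E.ι (if j = 0 then E.n - 1 else j - 1)

theorem next_lt {j : ℕ} (hj : j < E.n) : E.next j < E.n :=
  E.ι_lt _ (by split_ifs <;> omega)

theorem next_iterate_lt {j : ℕ} (hj : j < E.n) (i : ℕ) : E.next^[i] j < E.n := by
  induction i with
  | zero => exact hj
  | succ i ih => rw [Function.iterate_succ_apply']; exact E.next_lt ih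

theorem next_injOn {j j' : ℕ} (hj : j < E.n) (hj' : j' < E.n) (h : E.next j = E.next j') :
    j = j' := by
  have h1 := congrArg E.ι h
  rw [next, next, E.ι_ι _ (by split_ifs <;> omega), E.ι_ι _ (by split_ifs <;> omega)] at h1
  split_ifs at h1 <;> omega

theorem fold_x {j : ℕ} (hj : j < E.n) (q : ℤ) :
    ∃ q' : ℤ, E.fold (E.x j + q * E.x E.n) = E.x (E.next j) + q' * E.x E.n := by
  rw [fold_add_int]
  have hn := E.n_pos
  by_cases h0 : j = 0
  · subst h0
    -- The edge ending at the vertex 0 is the last one, seen one turn earlier.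
    have h : E.InLeft (E.n - 1) (-1) (E.x 0) := by
      have h1 := E.x_lt (E.n - 1) (by omega)
      rw [Nat.sub_add_cancel hn] at h1
      refine ⟨by omega, ?_, ?_⟩
      · rw [E.x_zero]; push_cast; linarith
      · rw [E.x_zero, Nat.sub_add_cancel hn]; push_cast; linarith
    refine ⟨1 - q, ?_⟩
    have h2 := E.length_eq (E.n - 1) (by omega)
    rw [Nat.sub_add_cancel hn] at h2
    rw [h.fold_eq, next, if_pos rfl, center, E.x_zero]
    push_cast; linarith
  · have h : E.InLeft (j - 1) 0 (E.x j) := by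
      have h1 := E.x_lt (j - 1) (by omega)
      rw [Nat.sub_add_cancel (by omega)] at h1
      refine ⟨by omega, by simpa using h1, ?_⟩
      rw [Nat.sub_add_cancel (by omega)]; simp
    refine ⟨-q, ?_⟩
    have h2 := E.length_eq (j - 1) (by omega)
    rw [Nat.sub_add_cancel (by omega)] at h2
    rw [h.fold_eq, next, if_neg h0, center]
    push_cast; linarith

theorem foldPerm_pow_x {j : ℕ} (hj : j < E.n) (q : ℤ) (i : ℕ) : ∃ q' : ℤ,
    (E.foldPerm ^ i) (E.x j + q * E.x E.n) = E.x (E.next^[i] j) + q' * E.x E.n := by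
  induction i with
  | zero => exact ⟨q, rfl⟩
  | succ i ih =>
    obtain ⟨q', h⟩ := ih
    rw [pow_succ', Equiv.Perm.mul_apply, h, Function.iterate_succ_apply']
    exact E.fold_x (E.next_iterate_lt hj i) q'

theorem exists_next_iterate_eq {j : ℕ} (hj : j < E.n) : ∃ k, 0 < k ∧ E.next^[k] j = j := by
  set f : Fin E.n → Fin E.n := fun i => ⟨E.next i, E.next_lt i.2⟩ with hf
  have hinj : Function.Injective f := fun a b h =>
    Fin.ext (E.next_injOn a.2 b.2 (congrArg Fin.val h))
  obtain ⟨k, hk, h⟩ := hinj.mem_periodicPts ⟨j, hj⟩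
  refine ⟨k, hk, ?_⟩
  have h2 : ∀ i, ((f^[i] ⟨j, hj⟩ : Fin E.n) : ℕ) = E.next^[i] j := by
    intro i
    induction i with
    | zero => rfl
    | succ i ih => rw [Function.iterate_succ_apply', Function.iterate_succ_apply', ← ih]
  rw [← h2, h]

theorem eq_x_or_interior (t : ℝ) : (∃ j < E.n, ∃ q : ℤ, t = E.x j + q * E.x E.n) ∨
    ∃ j q, E.InLeft j q t ∧ E.InRight j q t := by
  obtain ⟨j, q, h⟩ := E.exists_inRight t
  rcases h.2.1.eq_or_lt with h1 | h1
  · exact Or.inl ⟨j, h.1, q, h1.symm⟩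
  · exact Or.inr ⟨j, q, ⟨h.1, h1, h.2.2.le⟩, h⟩

theorem fold_fold_interior {j : ℕ} {q : ℤ} {t : ℝ} (h : E.InLeft j q t) (h' : E.InRight j q t) :
    E.fold (E.fold t) = t := by
  have h1 : E.InLeft (E.ι j) (-q) (E.fold t) := by
    have := h'.inLeft_unfold
    rwa [h'.unfold_eq, ← h.fold_eq] at this
  rw [h1.fold_eq, E.center_ι h.1, h.fold_eq, sub_sub_cancel]

theorem foldPerm_finite_orbit (t : ℝ) :
    ∃ k, 0 < k ∧ ∃ m : ℤ, (E.foldPerm ^ k) t = t + m * E.x E.n := by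
  rcases E.eq_x_or_interior t with ⟨j, hj, q, rfl⟩ | ⟨j, q, h, h'⟩
  · obtain ⟨k, hk, hk'⟩ := E.exists_next_iterate_eq hj
    obtain ⟨q', hq'⟩ := E.foldPerm_pow_x hj q k
    refine ⟨k, hk, q' - q, ?_⟩
    rw [hq', hk']
    push_cast; ring
  · refine ⟨2, two_pos, 0, ?_⟩
    rw [pow_two, Equiv.Perm.mul_apply, foldPerm_apply, foldPerm_apply, E.fold_fold_interior h h']
    simp

/-- The sphere-like surface obtained from a cylinder by gluing the lower boundary according to a
pairing of edges, and by folding the upper boundary in two. -/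
noncomputable def cylinder (H : ℂ) (hH : 0 < H.im) : FlatCylinder where
  L := E.x E.n
  L_pos := E.length_pos
  H := H
  H_pos := hH
  g b := bif b then Equiv.neg ℝ else E.foldPerm
  g_add b t := by
    cases b
    · simpa [foldPerm_apply] using E.fold_add_int t 1
    · simp; ring
  flip b t := by
    cases b
    · exact E.fold_flip t
    · exact ⟨1, one_pos, fun ρ _ _ => by simp; ring, fun ρ _ _ => by simp; ring⟩
  finite_orbit b t := by
    cases b
    · exact E.foldPerm_finite_orbit t
    · exact ⟨2, two_pos, 0, by simp [pow_two]⟩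

section Cylinder

variable (H : ℂ) (hH : 0 < H.im)

theorem cylinder_L : (E.cylinder H hH).L = E.x E.n := rfl

theorem cylinder_g_false (t : ℝ) : (E.cylinder H hH).g false t = E.fold t := rfl

theorem cylinder_g_true (t : ℝ) : (E.cylinder H hH).g true t = -t := rfl

theorem cong_it_x {j : ℕ} (hj : j < E.n) (i : ℕ) :
    (E.cylinder H hH).Cong (E.x (E.next^[i] j)) ((E.cylinder H hH).it false i (E.x j)) := by
  obtain ⟨q, h⟩ := E.foldPerm_pow_x hj 0 i
  refine ⟨q, ?_⟩
  simpa [FlatCylinder.it, cylinder] using h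

theorem cong_x_iff {j j' : ℕ} (hj : j < E.n) (hj' : j' < E.n) :
    (E.cylinder H hH).Cong (E.x j) (E.x j') ↔ j = j' := by
  constructor
  · rintro ⟨m, h⟩
    rw [cylinder_L] at h
    have h1 : E.InRight j 0 (E.x j) := ⟨hj, by simp, by simpa using E.x_lt j hj⟩
    have h2 : E.InRight j' 0 (E.x j') := ⟨hj', by simp, by simpa using E.x_lt j' hj'⟩
    have h3 := h1.add m
    rw [← h] at h3
    exact (h3.unique h2).1
  · rintro rfl
    exact FlatCylinder.Cong.refl _

theorem period_x {j : ℕ} (hj : j < E.n) {k : ℕ} (hk : 0 < k) (h : E.next^[k] j = j)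
    (h' : ∀ i, 0 < i → i < k → E.next^[i] j ≠ j) :
    (E.cylinder H hH).period false (E.x j) = k := by
  refine FlatCylinder.period_eq _ hk ?_ ?_
  · have := E.cong_it_x H hH hj k
    rwa [h] at this
  · intro i h0 hik hc
    have h1 := hc.trans (E.cong_it_x H hH hj i).symm
    exact h' i h0 hik ((E.cong_x_iff H hH hj (E.next_iterate_lt hj i)).1 h1).symm

/-- The fold is an involution on open edges, and it fixes no point modulo the circumference because
no edge is its own partner. -/
theorem period_interior {j : ℕ} {q : ℤ} {t : ℝ} (h : E.InLeft j q t) (h' : E.InRight j q t) :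
    (E.cylinder H hH).period false t = 2 := by
  refine FlatCylinder.period_eq _ two_pos ⟨0, ?_⟩ ?_
  · rw [Nat.cast_two, show (2 : ℤ) = 1 + 1 from rfl, ← FlatCylinder.it_it, FlatCylinder.it_one,
      FlatCylinder.it_one, cylinder_g_false, cylinder_g_false, E.fold_fold_interior h h']
    simp
  · intro i h0 hi
    obtain rfl : i = 1 := by omega
    rintro ⟨m, hm⟩
    rw [Nat.cast_one, FlatCylinder.it_one, cylinder_g_false, cylinder_L] at hm
    have h1 := h.inRight_fold
    rw [hm] at h1
    exact E.ι_ne j h.1 (h1.unique (h'.add m)).1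

theorem it_true (m : ℤ) (t : ℝ) : (E.cylinder H hH).it true m t = t ∨
    (E.cylinder H hH).it true m t = -t := by
  refine FlatCylinder.it_induction _ true (P := fun s => s = t ∨ s = -t) ?_ ?_ (Or.inl rfl) m
  · rintro s (rfl | rfl)
    · exact Or.inr rfl
    · exact Or.inl (by rw [cylinder_g_true, neg_neg])
  · rintro s (rfl | rfl)
    · exact Or.inr rfl
    · exact Or.inl (neg_neg t)

theorem period_true_of_cong {t : ℝ} (h : (E.cylinder H hH).Cong t (-t)) :
    (E.cylinder H hH).period true t = 1 := by
  refine FlatCylinder.period_eq _ one_pos ?_ (fun i h0 h1 => by omega)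
  rwa [Nat.cast_one, FlatCylinder.it_one, cylinder_g_true]

theorem period_true_of_not_cong {t : ℝ} (h : ¬ (E.cylinder H hH).Cong t (-t)) :
    (E.cylinder H hH).period true t = 2 := by
  refine FlatCylinder.period_eq _ two_pos ⟨0, ?_⟩ ?_
  · rw [Nat.cast_two, show (2 : ℤ) = 1 + 1 from rfl, ← FlatCylinder.it_it, FlatCylinder.it_one,
      FlatCylinder.it_one, cylinder_g_true, cylinder_g_true]
    simp
  · intro i h0 hi
    obtain rfl : i = 1 := by omega
    rwa [Nat.cast_one, FlatCylinder.it_one, cylinder_g_true]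

end Cylinder

end EdgePairing

/-! ### Suspensions with one cylinder, folded in two on the top -/

namespace List

theorem count_eq_card_filter_range {α : Type*} [DecidableEq α] (w : List α) (s : α) :
    w.count s = ((Finset.range w.length).filter fun i => w[i]? = some s).card := by
  induction w using List.reverseRecOn with
  | nil => simp
  | append_singleton w b ih =>
    have h1 : ((Finset.range w.length).filter fun i => (w ++ [b])[i]? = some s) =
        (Finset.range w.length).filter fun i => w[i]? = some s := by
      refine Finset.filter_congr fun i hi => ?_
      rw [List.getElem?_append_left (Finset.mem_range.1 hi)]
    rw [List.count_append, ih, List.length_append, List.length_singleton, Finset.range_add_one,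
      Finset.filter_insert, h1]
    by_cases hb : b = s <;> simp [hb]

/-- The position of the other occurrence of the `i`-th symbol of the word. -/
noncomputable def partner {α : Type*} (w : List α) (i : ℕ) : ℕ :=
  open Classical in if h : ∃ j < w.length, j ≠ i ∧ w[j]? = w[i]? then h.choose else 0

variable {α : Type*} [DecidableEq α] {w : List α} (hw : ∀ s ∈ w, w.count s = 2)
include hw

theorem exists_pair {i : ℕ} (hi : i < w.length) : ∃ j < w.length, j ≠ i ∧ w[j]? = w[i]? ∧
    ∀ k < w.length, w[k]? = w[i]? → k = i ∨ k = j := by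
  have h := hw w[i] (List.getElem_mem hi)
  rw [count_eq_card_filter_range, Finset.card_eq_two] at h
  obtain ⟨p, q, hpq, h⟩ := h
  have hmem : ∀ k, (k < w.length ∧ w[k]? = w[i]?) ↔ k = p ∨ k = q := fun k => by
    have := Finset.ext_iff.1 h k
    simpa [List.getElem?_eq_getElem hi] using this
  rcases (hmem i).1 ⟨hi, rfl⟩ with rfl | rfl
  · obtain ⟨h1, h2⟩ := (hmem q).2 (Or.inr rfl)
    exact ⟨q, h1, hpq.symm, h2, fun k hk hk' => (hmem k).1 ⟨hk, hk'⟩⟩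
  · obtain ⟨h1, h2⟩ := (hmem p).2 (Or.inl rfl)
    exact ⟨p, h1, hpq, h2, fun k hk hk' => ((hmem k).1 ⟨hk, hk'⟩).symm⟩

theorem partner_spec {i : ℕ} (hi : i < w.length) :
    w.partner i < w.length ∧ w.partner i ≠ i ∧ w[w.partner i]? = w[i]? := by
  obtain ⟨j, h1, h2, h3, -⟩ := exists_pair hw hi
  have h : ∃ j < w.length, j ≠ i ∧ w[j]? = w[i]? := ⟨j, h1, h2, h3⟩
  rw [partner, dif_pos h]
  exact h.choose_spec

theorem partner_eq {i j : ℕ} (hi : i < w.length) (hj : j < w.length) (hij : j ≠ i)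
    (h : w[j]? = w[i]?) : w.partner i = j := by
  obtain ⟨k, -, -, -, hk⟩ := exists_pair hw hi
  obtain ⟨h1, h2, h3⟩ := partner_spec hw hi
  rcases hk j hj h with rfl | rfl
  · exact absurd rfl hij
  · exact (hk _ h1 h3).resolve_left h2

end List

/-! ### The parallelogram, its cylinder, and compatibility with the side gluing. -/

namespace TwoLines

/-- The pairing of the edges of a circle, the `i`-th one having length `Re (ζ s)` where `s` is the
`i`-th symbol of the word `w`. -/
noncomputable def edgePairing (w : List ℕ) (ζ : ℕ → ℂ) (hne : w ≠ [])
    (hw : ∀ s ∈ w, w.count s = 2) (hζ : ∀ s ∈ w, 0 < (ζ s).re) : EdgePairing :=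
  have hx : ∀ i (hi : i < w.length), ((w.take (i + 1)).map fun s => (ζ s).re).sum =
      ((w.take i).map fun s => (ζ s).re).sum + (ζ w[i]).re := fun i hi => by
    rw [List.take_add_one, List.getElem?_eq_getElem hi]
    simp only [Option.toList_some, List.map_append, List.sum_append, List.map_cons, List.map_nil,
      List.sum_cons, List.sum_nil, add_zero]
  { n := w.length
    n_pos := List.length_pos_iff.2 hne
    x := fun i => ((w.take i).map fun s => (ζ s).re).sum
    x_zero := by simp
    x_lt := fun i hi => by
      rw [hx i hi]
      linarith [hζ _ (List.getElem_mem hi)]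
    ι := w.partner
    ι_lt := fun i hi => (List.partner_spec hw hi).1
    ι_ι := fun i hi => by
      obtain ⟨h1, h2, h3⟩ := List.partner_spec hw hi
      exact List.partner_eq hw h1 hi h2.symm h3.symm
    ι_ne := fun i hi => (List.partner_spec hw hi).2.1
    length_eq := fun i hi => by
      obtain ⟨h1, h2, h3⟩ := List.partner_spec hw hi
      rw [List.getElem?_eq_getElem h1, List.getElem?_eq_getElem hi, Option.some_inj] at h3
      rw [hx i hi, hx _ h1, h3]
      ring }

/-- The generalized permutation whose top line is `a c c` and whose bottom line is `w a`. -/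
def folded (a c : ℕ) (w : List ℕ) : TwoLines := ⟨[a, c, c], w ++ [a]⟩

/-- The conditions making `folded a c w` a generalized permutation. -/
structure IsFoldable (a c : ℕ) (w : List ℕ) : Prop where
  ne : c ≠ a
  notMem : a ∉ w
  notMem' : c ∉ w
  ne_nil : w ≠ []
  count : ∀ s ∈ w, w.count s = 2

variable {a c : ℕ} {w : List ℕ} (hw : IsFoldable a c w)
include hw

theorem IsFoldable.isCylindrical : (folded a c w).IsCylindrical := by
  have h1 := hw.ne
  have h2 := hw.notMem
  have h3 := hw.notMem'
  refine ⟨⟨by simp [folded], by simp [folded], ?_⟩, Or.inl (by simp [folded]), ?_, ?_⟩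
  · intro s hs
    simp only [folded, List.mem_append, List.mem_cons, List.not_mem_nil, or_false] at hs
    by_cases ha : s = a
    · subst ha
      simp [folded, List.count_eq_zero_of_not_mem h2, h1]
    · by_cases hc : s = c
      · subst hc
        simp [folded, List.count_eq_zero_of_not_mem h3, h1.symm]
      · have h4 : s ∈ w := by tauto
        simp [folded, Ne.symm ha, Ne.symm hc, hw.count s h4]
  · intro h
    have : c ∈ (w ++ [a]).toFinset := h.1 (by simp [folded])
    simp [h1, h3] at this
  · intro h
    obtain ⟨s, hs⟩ := List.exists_mem_of_ne_nil w hw.ne_nil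
    have : s ∈ ([a, c, c] : List ℕ).toFinset := h.1 (by simp [folded, hs])
    simp at this
    rcases this with rfl | rfl
    · exact h2 hs
    · exact h3 hs

/-- The other possible cut would be `c`, the last symbol of the top line; opening the bottom line,
it would have to occur in `w`. -/
theorem IsFoldable.cut_eq {a' : ℕ} {ζ : ℕ → ℂ} (h : (folded a c w).IsSuspensionDatum a' ζ) :
    a' = a ∧ 0 < (ζ a).im := by
  rcases h.cut with ⟨h1, h2, h3⟩ | ⟨h1, h2, h3⟩
  · obtain rfl : a = a' := by simpa [folded] using h1
    exact ⟨rfl, h3⟩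
  · exfalso
    obtain rfl : c = a' := by simpa [folded] using h2
    obtain ⟨s, t, rfl⟩ := List.exists_cons_of_ne_nil hw.ne_nil
    obtain rfl : s = c := by simpa [folded] using h1
    exact hw.notMem' (by simp)

/-- Every word admits a suspension. -/
theorem IsFoldable.exists_suspension :
    ∃ a' ζ, (folded a c w).IsSuspensionDatum a' ζ := by
  have h1 := hw.ne
  have hlen := List.length_pos_iff.2 hw.ne_nil
  -- Bottom edges of length 1; the two top edges share their total length equally.
  refine ⟨a, fun s => if s = a then Complex.I else if s = c then (w.length / 2 : ℝ) else 1, ?_, ?_, ?_⟩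
  · exact Or.inl ⟨rfl, by simp [folded], by simp⟩
  · intro b _ hb
    by_cases hbc : b = c
    · simp only [hbc, h1, if_false, if_true, Complex.ofReal_re, Complex.ofReal_im, and_true]
      positivity
    · simp [hb, hbc]
  · have h2 : w.map (fun s => if s = a then Complex.I else
        if s = c then ((w.length / 2 : ℝ) : ℂ) else 1) = w.map fun _ => 1 := by
      refine List.map_congr_left fun s hs => ?_
      have h3 : s ≠ a := by rintro rfl; exact hw.notMem hs
      have h4 : s ≠ c := by rintro rfl; exact hw.notMem' hs
      simp [h3, h4]
    simp only [folded, List.map_append, h2]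
    simp [h1]
    ring

variable {ζ : ℕ → ℂ} (hζ : (folded a c w).IsSuspensionDatum a ζ)
include hζ

theorem IsFoldable.re_pos {s : ℕ} (hs : s ∈ w) : 0 < (ζ s).re ∧ (ζ s).im = 0 :=
  hζ.horizontal s (by simp [folded, hs]) (by rintro rfl; exact hw.notMem hs)

theorem IsFoldable.im_pos : 0 < (ζ a).im := (hw.cut_eq hζ).2

/-- The pairing of the bottom edges of the polygon. -/
noncomputable def IsFoldable.pairing : EdgePairing :=
  edgePairing w ζ hw.ne_nil hw.count fun _ hs => (hw.re_pos hζ hs).1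

theorem IsFoldable.pairing_n : (hw.pairing hζ).n = w.length := rfl

theorem IsFoldable.pairing_ι : (hw.pairing hζ).ι = w.partner := rfl

theorem IsFoldable.x_succ {i : ℕ} (hi : i < w.length) :
    (hw.pairing hζ).x (i + 1) = (hw.pairing hζ).x i + (ζ w[i]).re := by
  change ((w.take (i + 1)).map fun s => (ζ s).re).sum =
    ((w.take i).map fun s => (ζ s).re).sum + _
  rw [List.take_add_one, List.getElem?_eq_getElem hi]
  simp only [Option.toList_some, List.map_append, List.sum_append, List.map_cons, List.map_nil,
    List.sum_cons, List.sum_nil, add_zero]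

theorem IsFoldable.sum_take (i : ℕ) : ((w.take i).map ζ).sum = ((hw.pairing hζ).x i : ℂ) := by
  have h : ∀ l : List ℕ, (∀ s ∈ l, s ∈ w) →
      (l.map ζ).sum = ((l.map fun s => (ζ s).re).sum : ℝ) := by
    intro l
    induction l with
    | nil => simp
    | cons s l ih =>
      intro hl
      rw [List.map_cons, List.map_cons, List.sum_cons, List.sum_cons,
        ih fun t ht => hl t (List.mem_cons_of_mem _ ht)]
      push_cast
      congr 1
      exact Complex.ext rfl (by simpa using (hw.re_pos hζ (hl s (by simp))).2)
  exact h _ fun s hs => List.mem_of_mem_take hs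

/-- The circumference of the cylinder. -/
noncomputable def IsFoldable.circ : ℝ := (hw.pairing hζ).x w.length

theorem IsFoldable.circ_pos : 0 < hw.circ hζ := (hw.pairing hζ).length_pos

theorem IsFoldable.vertex_bot {i : ℕ} (hi : i ≤ w.length) :
    vertex ζ (w ++ [a]) i = ((hw.pairing hζ).x i : ℂ) := by
  rw [vertex, List.take_append_of_le_length hi, hw.sum_take hζ]

theorem IsFoldable.vertex_bot_last {i : ℕ} (hi : w.length < i) :
    vertex ζ (w ++ [a]) i = (hw.circ hζ : ℂ) + ζ a := by
  have := hw.sum_take hζ w.length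
  rw [List.take_length] at this
  rw [vertex, List.take_of_length_le (by simp; omega), List.map_append, List.sum_append, this]
  simp [IsFoldable.circ]

theorem IsFoldable.two_mul_top : 2 * ζ c = (hw.circ hζ : ℂ) := by
  have h := hζ.closes
  have := hw.sum_take hζ w.length
  rw [List.take_length] at this
  simp only [folded, List.map_append, List.sum_append, this, List.map_cons, List.sum_cons,
    List.map_nil, List.sum_nil] at h
  rw [IsFoldable.circ]
  linear_combination h

theorem IsFoldable.top_eq : ζ c = ((hw.circ hζ / 2 : ℝ) : ℂ) := by
  have := hw.two_mul_top hζ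
  push_cast
  linear_combination this / 2

/-- The parallelogram bounded by the two broken lines. -/
theorem IsFoldable.mem_polygon {z : ℂ} : z ∈ (folded a c w).polygon ζ ↔
    ∃ t s : ℝ, 0 ≤ t ∧ t ≤ 1 ∧ 0 ≤ s ∧ s ≤ hw.circ hζ ∧ z = t * ζ a + s := by
  set L := hw.circ hζ with hL
  have hL0 : 0 < L := hw.circ_pos hζ
  constructor
  · intro hz
    have hconv : Convex ℝ {z : ℂ | ∃ t s : ℝ, 0 ≤ t ∧ t ≤ 1 ∧ 0 ≤ s ∧ s ≤ L ∧ z = t * ζ a + s} := by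
      rintro _ ⟨t, s, h1, h2, h3, h4, rfl⟩ _ ⟨t', s', h1', h2', h3', h4', rfl⟩ u v hu hv huv
      refine ⟨u * t + v * t', u * s + v * s', by positivity, ?_, by positivity, ?_, ?_⟩
      · nlinarith
      · nlinarith
      · simp only [Complex.real_smul]
        push_cast; ring
    refine convexHull_min ?_ hconv hz
    rintro _ (⟨i, rfl⟩ | ⟨i, rfl⟩)
    · have ht := hw.top_eq hζ
      rw [← hL] at ht
      rcases i with _ | _ | _ | i
      · exact ⟨0, 0, le_rfl, zero_le_one, le_rfl, hL0.le, by simp [vertex]⟩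
      · exact ⟨1, 0, zero_le_one, le_rfl, le_rfl, hL0.le, by simp [vertex, folded]⟩
      · exact ⟨1, L / 2, zero_le_one, le_rfl, by positivity, by linarith, by
          simp [vertex, folded, ht]⟩
      · exact ⟨1, L, zero_le_one, le_rfl, hL0.le, le_rfl, by
          simp [vertex, folded, ht]⟩
    · rcases le_or_gt i w.length with hi | hi
      · refine ⟨0, (hw.pairing hζ).x i, le_rfl, zero_le_one, ?_, (hw.pairing hζ).x_le hi le_rfl, ?_⟩
        · rw [← (hw.pairing hζ).x_zero]
          exact (hw.pairing hζ).x_le (Nat.zero_le i) hi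
        · rw [folded, hw.vertex_bot hζ hi]; simp
      · refine ⟨1, L, zero_le_one, le_rfl, hL0.le, le_rfl, ?_⟩
        rw [folded, hw.vertex_bot_last hζ hi]
        push_cast; ring
  · rintro ⟨t, s, h1, h2, h3, h4, rfl⟩
    have hc : Convex ℝ ((folded a c w).polygon ζ) := convex_convexHull ℝ _
    have hb : ∀ i, vertex ζ (w ++ [a]) i ∈ (folded a c w).polygon ζ := fun i =>
      subset_convexHull ℝ _ (Or.inr ⟨i, rfl⟩)
    have ht : ∀ i, vertex ζ [a, c, c] i ∈ (folded a c w).polygon ζ := fun i =>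
      subset_convexHull ℝ _ (Or.inl ⟨i, rfl⟩)
    have p0 : (0 : ℂ) ∈ (folded a c w).polygon ζ := by simpa [vertex] using ht 0
    have p1 : ζ a ∈ (folded a c w).polygon ζ := by simpa [vertex] using ht 1
    have p2 : (L : ℂ) ∈ (folded a c w).polygon ζ := by
      have := hb w.length
      rwa [hw.vertex_bot hζ le_rfl] at this
    have p3 : (L : ℂ) + ζ a ∈ (folded a c w).polygon ζ := by
      have := hb (w.length + 1)
      rwa [hw.vertex_bot_last hζ (Nat.lt_succ_self _)] at this
    have hs : 0 ≤ s / L := by positivity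
    have hs' : s / L ≤ 1 := by rw [div_le_one hL0]; exact h4
    have hLc : (L : ℂ) ≠ 0 := by exact_mod_cast hL0.ne'
    have q0 := hc p0 p2 (sub_nonneg.2 hs') hs (by ring)
    have q1 := hc p1 p3 (sub_nonneg.2 hs') hs (by ring)
    have q2 := hc q0 q1 (sub_nonneg.2 h2) h1 (by ring)
    convert q2 using 1
    simp only [Complex.real_smul]
    push_cast
    field_simp
    ring

/-- The cylinder with glued boundary. -/
noncomputable def IsFoldable.surface : FlatCylinder :=
  (hw.pairing hζ).cylinder (ζ a + hw.circ hζ) (by simpa using hw.im_pos hζ)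

theorem IsFoldable.surface_L : (hw.surface hζ).L = hw.circ hζ := rfl

theorem IsFoldable.surface_H : (hw.surface hζ).H = ζ a + hw.circ hζ := rfl

theorem IsFoldable.surface_H_im : (hw.surface hζ).H.im = (ζ a).im := by
  rw [hw.surface_H hζ]; simp

theorem IsFoldable.cap_true (u : ℂ) :
    (hw.surface hζ).cap true u = ζ a + hw.circ hζ - u := rfl

omit hw hζ in
theorem cap_false (C : FlatCylinder) (u : ℂ) : C.cap false u = u := rfl

theorem IsFoldable.polygon_subset_strip : (folded a c w).polygon ζ ⊆ (hw.surface hζ).strip := by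
  intro z hz
  obtain ⟨t, s, h1, h2, h3, h4, rfl⟩ := (hw.mem_polygon hζ).1 hz
  have := hw.im_pos hζ
  constructor
  · simp; positivity
  · rw [hw.surface_H_im hζ]
    simp
    nlinarith

theorem IsFoldable.interior_polygon {z : ℂ} (hz : z ∈ interior ((folded a c w).polygon ζ)) :
    0 < z.im ∧ z.im < (hw.surface hζ).H.im := by
  have h := interior_mono (hw.polygon_subset_strip hζ) hz
  rw [show (hw.surface hζ).strip = Complex.im ⁻¹' Set.Icc 0 (hw.surface hζ).H.im from rfl,
    Complex.interior_preimage_im, interior_Icc] at h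
  exact h

theorem IsFoldable.exists_mem_polygon (p : (hw.surface hζ).Surface) :
    ∃ z ∈ (folded a c w).polygon ζ, (hw.surface hζ).proj z = p := by
  obtain ⟨z, hz, rfl⟩ := (hw.surface hζ).proj_surjective p
  have him := hw.im_pos hζ
  have hz1 := hz.1
  have hz2 := hz.2
  rw [hw.surface_H_im hζ] at hz2
  -- The height fixes the coefficient of `ζ a`; a translation then brings the remaining real
  -- coordinate into `[0, L)`.
  set t := z.im / (ζ a).im with ht
  obtain ⟨n, hn, -⟩ := existsUnique_add_zsmul_mem_Ico (hw.circ_pos hζ) (z.re - t * (ζ a).re) 0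
  simp only [zero_add, zsmul_eq_mul] at hn
  refine ⟨z + n * (hw.surface hζ).L, (hw.mem_polygon hζ).2 ⟨t, z.re - t * (ζ a).re + n * hw.circ hζ,
    by positivity, by rw [ht, div_le_one him]; exact hz2, hn.1, hn.2.le, ?_⟩,
    (hw.surface hζ).proj_add_int z n⟩
  rw [hw.surface_L hζ]
  apply Complex.ext
  · simp; ring
  · simp [ht, him.ne']

theorem IsFoldable.proj_eq_of_sideGluing {z v : ℂ} (h : (folded a c w).SideGluing ζ z v) :
    (hw.surface hζ).proj z = (hw.surface hζ).proj v := by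
  have hca := hw.ne
  have htop := hw.top_eq hζ
  -- The two top edges `c` are exchanged by the symmetry about the midpoint of the top side, `u ↦ L
  -- - u`, which is `g true = neg` up to one turn.
  have flip : ∀ u v : ℝ, u + v = hw.circ hζ →
      (hw.surface hζ).proj (ζ a + u) = (hw.surface hζ).proj (ζ a + v) := by
    intro u v huv
    have h1 : ζ a + u = (hw.surface hζ).cap true v := by
      rw [hw.cap_true hζ, ← huv]; push_cast; ring
    have h2 : ζ a + v = (hw.surface hζ).cap true u := by
      rw [hw.cap_true hζ, ← huv]; push_cast; ring
    rw [h1, h2, FlatCylinder.proj_cap_eq_iff]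
    refine ⟨rfl, 1, 1, ?_⟩
    rw [FlatCylinder.it_one, hw.surface_L hζ, ← huv]
    change u = -v + _
    push_cast; ring
  cases h with
  | translation i j s hi hj t ht =>
    have hsa : s = a := by
      rcases i with _ | _ | _ | i <;> simp [folded] at hi
      · exact hi.symm
      all_goals
        subst hi
        have := List.mem_of_getElem? hj
        simp [folded, hca, hw.notMem'] at this
    subst hsa
    obtain rfl : i = 0 := by
      rcases i with _ | _ | _ | i <;> simp [folded, hca] at hi ⊢
    obtain rfl : j = w.length := by
      rcases lt_trichotomy j w.length with h | h | h
      · rw [folded, List.getElem?_append_left h] at hj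
        exact absurd (List.mem_of_getElem? hj) hw.notMem
      · exact h
      · rw [folded, List.getElem?_eq_none (by simp; omega)] at hj
        simp at hj
    rw [folded, hw.vertex_bot hζ le_rfl]
    rw [← (hw.surface hζ).proj_add_int _ 1]
    congr 1
    rw [hw.surface_L hζ, IsFoldable.circ]
    simp [vertex]; ring
  | symmetryTop i j s hij hi hj t ht =>
    have hij' : (i = 1 ∧ j = 2 ∨ i = 2 ∧ j = 1) ∧ s = c := by
      rcases i with _ | _ | _ | i <;> rcases j with _ | _ | _ | j <;>
        simp [folded] at hi hj hij ⊢
      all_goals first | exact hi.symm | (subst hi; exact absurd hj hca) | (subst hj; exact absurd hi hca)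
    obtain ⟨⟨rfl, rfl⟩ | ⟨rfl, rfl⟩, rfl⟩ := hij'
    · have := flip (t * (hw.circ hζ / 2)) (hw.circ hζ / 2 + (1 - t) * (hw.circ hζ / 2)) (by ring)
      simp only [vertex, folded, htop, List.take, List.map, List.sum_cons, List.sum_nil]
      push_cast at this ⊢
      convert this using 2 <;> ring
    · have := flip (hw.circ hζ / 2 + t * (hw.circ hζ / 2)) ((1 - t) * (hw.circ hζ / 2)) (by ring)
      simp only [vertex, folded, htop, List.take, List.map, List.sum_cons, List.sum_nil]
      push_cast at this ⊢
      convert this using 2 <;> ring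
  | symmetryBot i j s hij hi hj t ht =>
    have hlt : ∀ k k', k ≠ k' → (w ++ [a])[k]? = some s → (w ++ [a])[k']? = some s →
        k < w.length := by
      intro k k' hkk hk hk'
      by_contra hkw
      obtain ⟨h1, -⟩ := List.getElem?_eq_some_iff.1 hk
      obtain ⟨h2, -⟩ := List.getElem?_eq_some_iff.1 hk'
      rw [List.length_append, List.length_singleton] at h1 h2
      obtain rfl : k = w.length := by omega
      rw [List.getElem?_concat_length, Option.some_inj] at hk
      rw [← hk, List.getElem?_append_left (by omega)] at hk'
      exact hw.notMem (List.mem_of_getElem? hk')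
    have hiw := hlt i j hij hi hj
    have hjw := hlt j i hij.symm hj hi
    rw [folded, List.getElem?_append_left hiw] at hi
    rw [folded, List.getElem?_append_left hjw] at hj
    have hpi := List.partner_eq hw.count hiw hjw hij.symm (hj.trans hi.symm)
    have hpj := List.partner_eq hw.count hjw hiw hij (hi.trans hj.symm)
    have his : w[i] = s := by simpa [List.getElem?_eq_getElem hiw] using hi
    have hjs : w[j] = s := by simpa [List.getElem?_eq_getElem hjw] using hj
    have hxi := hw.x_succ hζ hiw
    have hxj := hw.x_succ hζ hjw
    rw [his] at hxi
    rw [hjs] at hxj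
    have hs : ζ s = ((ζ s).re : ℂ) := by
      refine Complex.ext rfl (by simpa using (hw.re_pos hζ (List.mem_of_getElem? hi)).2)
    have hspos := (hw.re_pos hζ (List.mem_of_getElem? hi)).1
    rw [folded, hw.vertex_bot hζ hiw.le, hw.vertex_bot hζ hjw.le, hs]
    set E := hw.pairing hζ with hE
    have e1 : (E.x i : ℂ) + t * ((ζ s).re : ℂ) = (hw.surface hζ).cap false
        ((E.x i + t * (ζ s).re : ℝ) : ℂ) := by rw [cap_false]; push_cast; ring
    have e2 : (E.x j : ℂ) + (1 - t) * ((ζ s).re : ℂ) = (hw.surface hζ).cap false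
        ((E.x j + (1 - t) * (ζ s).re : ℝ) : ℂ) := by rw [cap_false]; push_cast; ring
    rw [e1, e2, FlatCylinder.proj_cap_eq_iff]
    refine ⟨rfl, ?_⟩
    -- The left endpoint of edge `i` is excluded from it by the convention of `fold`. It is the
    -- image under `fold` of the right endpoint of edge `j`, hence the iterate `-1` for `t = 0` and
    -- `1` otherwise.
    rcases ht.1.eq_or_lt with h0 | h0
    · refine ⟨-1, 0, ?_⟩
      have hl : E.InLeft j 0 (E.x (j + 1)) := ⟨hjw, by simpa using E.x_lt j hjw, by simp⟩
      have h1 : E.fold (E.x (j + 1)) = E.x i := by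
        rw [hl.fold_eq, EdgePairing.center, hw.pairing_ι hζ, hpj]
        linarith
      have h2 : (hw.surface hζ).it false (-1) (E.x i) = E.x (j + 1) := by
        rw [← h1]
        change (hw.surface hζ).it false (-1) ((hw.surface hζ).g false (E.x (j + 1))) = _
        rw [← FlatCylinder.it_one, FlatCylinder.it_it]; simp
      rw [← h0, zero_mul, add_zero, h2, hxj]
      push_cast; ring
    · refine ⟨1, 0, ?_⟩
      have hl : E.InLeft i 0 (E.x i + t * (ζ s).re) :=
        ⟨hiw, by simp; positivity, by
          rw [hxi, Int.cast_zero, zero_mul, add_zero]; nlinarith [ht.2]⟩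
      rw [FlatCylinder.it_one]
      change _ = E.fold _ + _
      rw [hl.fold_eq, EdgePairing.center, hw.pairing_ι hζ, hpi, hxj]
      push_cast; ring

end TwoLines

/-! ### The fibres of the projection are the classes of the side gluing. -/

namespace TwoLines

variable {a c : ℕ} {w : List ℕ} (hw : IsFoldable a c w)
  {ζ : ℕ → ℂ} (hζ : (folded a c w).IsSuspensionDatum a ζ)

open Relation

theorem eqvGen_of_sideGluing {π : TwoLines} {ζ : ℕ → ℂ} {z v z' v' : ℂ} (h : π.SideGluing ζ z v)
    (hz : z = z') (hv : v = v') : EqvGen (π.SideGluing ζ) z' v' := by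
  subst hz hv
  exact EqvGen.rel _ _ h

/-- The parallelogram has width `L`, so distinct points differing by a multiple of `L` face each
other on its two sides `a`. -/
theorem IsFoldable.eqvGen_of_translate {z v : ℂ} (hz : z ∈ (folded a c w).polygon ζ)
    (hv : v ∈ (folded a c w).polygon ζ) {n : ℤ} (h : v = z + n * hw.circ hζ) :
    EqvGen ((folded a c w).SideGluing ζ) z v := by
  have hL := hw.circ_pos hζ
  have him := hw.im_pos hζ
  have gen : ∀ t : ℝ, 0 ≤ t → t ≤ 1 →
      EqvGen ((folded a c w).SideGluing ζ) (t * ζ a) (t * ζ a + hw.circ hζ) := by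
    intro t h0 h1
    have h2 := SideGluing.translation (π := folded a c w) (ζ := ζ) 0 w.length a (by simp [folded])
      (by simp [folded]) t ⟨h0, h1⟩
    refine eqvGen_of_sideGluing h2 (by simp [vertex]) ?_
    change vertex ζ (w ++ [a]) w.length + _ = _
    rw [hw.vertex_bot hζ le_rfl, add_comm]
    rfl
  obtain ⟨t, s, h1, h2, h3, h4, rfl⟩ := (hw.mem_polygon hζ).1 hz
  obtain ⟨t', s', h1', h2', h3', h4', rfl⟩ := (hw.mem_polygon hζ).1 hv
  have e1 : t' = t := by
    have := congrArg Complex.im h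
    simp at this
    exact this.resolve_right him.ne'
  subst e1
  have e2 : s' = s + n * hw.circ hζ := by
    have := congrArg Complex.re h
    simp at this
    linarith
  have n1 : (n : ℝ) < 2 := by by_contra h; push Not at h; nlinarith
  have n2 : (-2 : ℝ) < n := by by_contra h; push Not at h; nlinarith
  have n1' : n < 2 := by exact_mod_cast n1
  have n2' : -2 < n := by exact_mod_cast n2
  obtain rfl | rfl | rfl : n = 0 ∨ n = 1 ∨ n = -1 := by omega
  · rw [e2]; simpa using EqvGen.refl _
  · push_cast at e2
    obtain rfl : s = 0 := by linarith
    obtain rfl : s' = hw.circ hζ := by linarith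
    simpa using gen t' h1 h2
  · push_cast at e2
    obtain rfl : s' = 0 := by linarith
    obtain rfl : s = hw.circ hζ := by linarith
    simpa using (gen t' h1 h2).symm

theorem IsFoldable.cap_mem_polygon (b : Bool) {u : ℝ} :
    (hw.surface hζ).cap b u ∈ (folded a c w).polygon ζ ↔ 0 ≤ u ∧ u ≤ hw.circ hζ := by
  have him := hw.im_pos hζ
  rw [hw.mem_polygon hζ]
  cases b
  · rw [cap_false]
    constructor
    · rintro ⟨t, s, h1, h2, h3, h4, h⟩
      have := congrArg Complex.im h
      simp [him.ne'] at this
      subst this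
      obtain rfl : u = s := by simpa using h
      exact ⟨h3, h4⟩
    · rintro ⟨h3, h4⟩
      exact ⟨0, u, le_rfl, zero_le_one, h3, h4, by simp⟩
  · rw [hw.cap_true hζ]
    constructor
    · rintro ⟨t, s, h1, h2, h3, h4, h⟩
      have := congrArg Complex.im h
      simp at this
      obtain rfl : t = 1 := by
        have h5 : (t - 1) * (ζ a).im = 0 := by linarith
        have := (mul_eq_zero.1 h5).resolve_right him.ne'
        linarith
      have h6 := congrArg Complex.re h
      simp at h6
      constructor <;> linarith
    · rintro ⟨h3, h4⟩
      exact ⟨1, hw.circ hζ - u, zero_le_one, le_rfl, by linarith, by linarith, by push_cast; ring⟩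

theorem IsFoldable.eqvGen_fold (b : Bool) {u : ℝ} (h0 : 0 < u) (h1 : u ≤ hw.circ hζ) :
    ∃ v, 0 ≤ v ∧ v ≤ hw.circ hζ ∧ (hw.surface hζ).Cong ((hw.surface hζ).g b u) v ∧
      EqvGen ((folded a c w).SideGluing ζ) ((hw.surface hζ).cap b u) ((hw.surface hζ).cap b v) := by
  have hL := hw.circ_pos hζ
  cases b
  · set E := hw.pairing hζ with hE
    obtain ⟨j, q, h⟩ := E.exists_inLeft u
    have a1 := E.x_le (Nat.zero_le j) h.1.le
    have a2 := E.x_le (Nat.succ_le_of_lt h.1) le_rfl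
    rw [E.x_zero] at a1
    have hLE : E.x E.n = hw.circ hζ := rfl
    obtain rfl : q = 0 := by
      have h2 := h.2.1
      have h3 := h.2.2
      rw [hLE] at a2 h2 h3
      have n1 : (q : ℝ) < 1 := by by_contra h; push Not at h; nlinarith
      have n2 : (-1 : ℝ) < q := by by_contra h; push Not at h; nlinarith
      have n1' : q < 1 := by exact_mod_cast n1
      have n2' : -1 < q := by exact_mod_cast n2
      omega
    obtain ⟨hj, h2, h3⟩ := h
    have hl : E.InLeft j 0 u := ⟨hj, h2, h3⟩
    simp only [Int.cast_zero, zero_mul, add_zero] at h2 h3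
    obtain ⟨p1, p2, p3⟩ := List.partner_spec hw.count hj
    set i := w.partner j with hi
    have hs3 : w[j]? = some w[j] := List.getElem?_eq_getElem hj
    rw [hs3] at p3
    set s := w[j] with hs
    have hsw : s ∈ w := List.getElem_mem hj
    have hsi : w[i] = s := by simpa [List.getElem?_eq_getElem p1] using p3
    have hxj := hw.x_succ hζ hj
    have hxi := hw.x_succ hζ p1
    rw [← hs] at hxj
    rw [hsi] at hxi
    have hspos := (hw.re_pos hζ hsw).1
    have hsc : ζ s = ((ζ s).re : ℂ) := Complex.ext rfl (by simpa using (hw.re_pos hζ hsw).2)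
    have hb1 := E.x_le (Nat.zero_le i) p1.le
    have hb2 := E.x_le (Nat.succ_le_of_lt p1) le_rfl
    rw [E.x_zero] at hb1
    have hfold : E.fold u = E.x i + E.x (j + 1) - u := by
      rw [hl.fold_eq, EdgePairing.center, hw.pairing_ι hζ, ← hi]
      linarith
    refine ⟨E.fold u, by rw [hfold]; linarith, ?_, ⟨0, by simp; rfl⟩, ?_⟩
    · rw [← hE] at hxj hxi
      rw [hfold, ← hLE]
      change _ ≤ E.x w.length
      change E.x (i + 1) ≤ _ at hb2
      linarith
    · have ht : (u - E.x j) / (ζ s).re ∈ Set.Icc (0 : ℝ) 1 := by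
        refine ⟨div_nonneg (by linarith) hspos.le, ?_⟩
        rw [div_le_one hspos]
        rw [← hE] at hxj; linarith
      have hg := SideGluing.symmetryBot (π := folded a c w) (ζ := ζ) j i s p2.symm
        (by rw [folded, List.getElem?_append_left hj]; exact hs3)
        (by rw [folded, List.getElem?_append_left p1]; exact p3) _ ht
      have hne : ((ζ s).re : ℂ) ≠ 0 := by exact_mod_cast hspos.ne'
      refine eqvGen_of_sideGluing hg ?_ ?_
      · change vertex ζ (w ++ [a]) j + _ = _
        rw [hw.vertex_bot hζ hj.le, cap_false]
        nth_rewrite 2 [hsc]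
        push_cast; field_simp; ring
      · change vertex ζ (w ++ [a]) i + _ = _
        rw [hw.vertex_bot hζ p1.le, cap_false, hfold, hxj]
        nth_rewrite 2 [hsc]
        push_cast; field_simp; ring
  · refine ⟨hw.circ hζ - u, by linarith, by linarith, ⟨1, ?_⟩, ?_⟩
    · rw [hw.surface_L hζ]
      change _ = -u + _
      push_cast; ring
    · have htop := hw.top_eq hζ
      have gen : ∀ v : ℝ, 0 ≤ v → v ≤ hw.circ hζ / 2 → EqvGen ((folded a c w).SideGluing ζ)
          (ζ a + v) (ζ a + (hw.circ hζ - v)) := by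
        intro v h2 h3
        have ht : v / (hw.circ hζ / 2) ∈ Set.Icc (0 : ℝ) 1 :=
          ⟨by positivity, by rw [div_le_one (by positivity)]; exact h3⟩
        have hg := SideGluing.symmetryTop (π := folded a c w) (ζ := ζ) 1 2 c (by norm_num)
          (by simp [folded]) (by simp [folded]) _ ht
        have hne : (hw.circ hζ : ℂ) ≠ 0 := by exact_mod_cast hL.ne'
        refine eqvGen_of_sideGluing hg ?_ ?_
        · simp only [vertex, folded, htop, List.take, List.map, List.sum_cons, List.sum_nil]
          push_cast; field_simp; ring
        · simp only [vertex, folded, htop, List.take, List.map, List.sum_cons, List.sum_nil]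
          push_cast; field_simp; ring
      rw [hw.cap_true hζ, hw.cap_true hζ]
      rcases le_total u (hw.circ hζ / 2) with h2 | h2
      · have := (gen u h0.le h2).symm
        convert this using 1
        · ring
        · push_cast; ring
      · have := gen (hw.circ hζ - u) (by linarith) (by linarith)
        convert this using 1
        · push_cast; ring
        · push_cast; ring

theorem IsFoldable.eqvGen_of_cong (b : Bool) {u v : ℝ} (hu : 0 ≤ u ∧ u ≤ hw.circ hζ)
    (hv : 0 ≤ v ∧ v ≤ hw.circ hζ) (h : (hw.surface hζ).Cong u v) :
    EqvGen ((folded a c w).SideGluing ζ) ((hw.surface hζ).cap b u) ((hw.surface hζ).cap b v) := by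
  obtain ⟨n, rfl⟩ := h
  obtain ⟨n', h'⟩ : ∃ n' : ℤ, (hw.surface hζ).cap b ((u + n * (hw.surface hζ).L : ℝ) : ℂ) =
      (hw.surface hζ).cap b u + n' * hw.circ hζ := by
    rw [hw.surface_L hζ]
    cases b
    · exact ⟨n, by rw [cap_false, cap_false]; push_cast; ring⟩
    · exact ⟨-n, by rw [hw.cap_true hζ, hw.cap_true hζ]; push_cast; ring⟩
  exact hw.eqvGen_of_translate hζ ((hw.cap_mem_polygon hζ b).2 hu)
    ((hw.cap_mem_polygon hζ b).2 hv) h'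

/-- Reducing `m` modulo the period leaves only forward steps. Before each step a point at 0 is moved
to `L`, so that the step stays inside the polygon. -/
theorem IsFoldable.eqvGen_it (b : Bool) {u v : ℝ} (hu : 0 ≤ u ∧ u ≤ hw.circ hζ)
    (hv : 0 ≤ v ∧ v ≤ hw.circ hζ) {m : ℤ}
    (h : (hw.surface hζ).Cong ((hw.surface hζ).it b m u) v) :
    EqvGen ((folded a c w).SideGluing ζ) ((hw.surface hζ).cap b u) ((hw.surface hζ).cap b v) := by
  have hL := hw.circ_pos hζ
  have key : ∀ i : ℕ, ∃ u', (0 ≤ u' ∧ u' ≤ hw.circ hζ) ∧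
      (hw.surface hζ).Cong ((hw.surface hζ).it b i u) u' ∧
      EqvGen ((folded a c w).SideGluing ζ) ((hw.surface hζ).cap b u) ((hw.surface hζ).cap b u') := by
    intro i
    induction i with
    | zero => exact ⟨u, hu, FlatCylinder.Cong.refl _, EqvGen.refl _⟩
    | succ i ih =>
      obtain ⟨u', hu', hc, he⟩ := ih
      obtain ⟨u'', h0, h1, hc', he'⟩ : ∃ u'', 0 < u'' ∧ u'' ≤ hw.circ hζ ∧
          (hw.surface hζ).Cong u' u'' ∧ EqvGen ((folded a c w).SideGluing ζ)
            ((hw.surface hζ).cap b u') ((hw.surface hζ).cap b u'') := by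
        rcases hu'.1.eq_or_lt with h | h
        · have hc : (hw.surface hζ).Cong u' (hw.circ hζ) :=
            ⟨1, by rw [← h, hw.surface_L hζ]; simp⟩
          exact ⟨hw.circ hζ, hL, le_rfl, hc,
            hw.eqvGen_of_cong hζ b hu' ⟨hL.le, le_rfl⟩ hc⟩
        · exact ⟨u', h, hu'.2, FlatCylinder.Cong.refl _, EqvGen.refl _⟩
      obtain ⟨v', h2, h3, h4, h5⟩ := hw.eqvGen_fold hζ b h0 h1
      refine ⟨v', ⟨h2, h3⟩, ?_, (he.trans _ _ _ he').trans _ _ _ h5⟩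
      have h6 := (hc.trans hc').it b 1
      rw [FlatCylinder.it_it, FlatCylinder.it_one] at h6
      push_cast
      rw [add_comm]
      exact h6.trans h4
  have hk : (0 : ℤ) < (hw.surface hζ).period b u := by
    exact_mod_cast (hw.surface hζ).period_pos b u
  have h1 := Int.emod_nonneg m hk.ne'
  obtain ⟨u', hu', hc, he⟩ := key (m % (hw.surface hζ).period b u).toNat
  rw [Int.toNat_of_nonneg h1] at hc
  refine he.trans _ _ _ (hw.eqvGen_of_cong hζ b hu' hv ?_)
  exact hc.symm.trans (((hw.surface hζ).cong_it_emod b u m).trans h)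

theorem IsFoldable.proj_eq_iff {z v : ℂ} (hz : z ∈ (folded a c w).polygon ζ)
    (hv : v ∈ (folded a c w).polygon ζ) : (hw.surface hζ).proj z = (hw.surface hζ).proj v ↔
      EqvGen ((folded a c w).SideGluing ζ) z v := by
  constructor
  · intro h
    rcases ((hw.surface hζ).proj_eq_iff (hw.polygon_subset_strip hζ hz)
      (hw.polygon_subset_strip hζ hv)).1 h with ⟨n, hn⟩ | ⟨b, x, y, m, rfl, rfl, hc⟩
    · exact hw.eqvGen_of_translate hζ hz hv hn
    · exact hw.eqvGen_it hζ b ((hw.cap_mem_polygon hζ b).1 hz) ((hw.cap_mem_polygon hζ b).1 hv) hc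
  · intro h
    clear hz hv
    induction h with
    | rel _ _ h => exact hw.proj_eq_of_sideGluing hζ h
    | refl _ => rfl
    | symm _ _ _ ih => exact ih.symm
    | trans _ _ _ _ _ ih1 ih2 => exact ih1.trans ih2

theorem IsFoldable.isGluedFromPolygon :
    @IsGluedFromPolygon (folded a c w) ζ (hw.surface hζ).Surface _
      (hw.surface hζ).flatAtlas.chartedSpace (hw.surface hζ).flatAtlas.quadraticDifferential
      (hw.surface hζ).proj := by
  let _ := (hw.surface hζ).flatAtlas.chartedSpace
  refine ⟨(hw.surface hζ).continuous_proj.continuousOn, fun p _ => hw.exists_mem_polygon hζ p,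
    fun z hz v hv => hw.proj_eq_iff hζ hz hv, ?_, ?_⟩
  · rintro z hz e ⟨q, rfl⟩ he
    obtain ⟨h0, h1⟩ := hw.interior_polygon hζ hz
    exact ((hw.surface hζ).proj_pullback h0 h1 q he).1
  · rintro z hz e ⟨q, rfl⟩ he
    obtain ⟨h0, h1⟩ := hw.interior_polygon hζ hz
    have h2 := ((hw.surface hζ).proj_pullback h0 h1 q he).2
    change ∀ᶠ v in 𝓝[≠] z, coneDensity ((hw.surface hζ).flatAtlas.order
      (((hw.surface hζ).flatAtlas.chart q).symm 0)) _ * _ = _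
    rw [FlatAtlas.chart_symm, FlatAtlas.param_zero]
    exact h2

end TwoLines

/-! ### Nested cycles -/

/-- A map `f` which permutes the integers of `[o, e]` as the corners of a caterpillar tree are
permuted around its vertices; `l` lists the number of leaves at the vertices of the spine. -/
def IsNest (f : ℕ → ℕ) : List ℕ → ℕ → ℕ → Prop
  | [], o, e => e = o ∧ f o = o
  | x :: l, o, e => o + 2 * x + 1 < e ∧ f o = e ∧ f e = o + 2 * x ∧
      (∀ i < x, f (o + 2 * i + 1) = o + 2 * i + 1 ∧ f (o + 2 * i + 2) = o + 2 * i) ∧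
      IsNest f l (o + 2 * x + 1) (e - 1)

/-- The first corners at the vertices of the spine. -/
def spineCorners : List ℕ → ℕ → List ℕ
  | [], _ => []
  | x :: l, o => o :: spineCorners l (o + 2 * x + 1)

/-- The corners at the leaves. -/
def leafCorners : List ℕ → ℕ → List ℕ
  | [], o => [o]
  | x :: l, o => (List.range x).map (fun i => o + 2 * i + 1) ++ leafCorners l (o + 2 * x + 1)

/-- `m` is the least element of a cycle of length `k`. -/
def IsCycleMin (f : ℕ → ℕ) (m k : ℕ) : Prop :=
  0 < k ∧ f^[k] m = m ∧ ∀ j, 0 < j → j < k → m < f^[j] m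

theorem IsCycleMin.le {f : ℕ → ℕ} {m k : ℕ} (h : IsCycleMin f m k) (j : ℕ) : m ≤ f^[j] m := by
  obtain ⟨h0, h1, h2⟩ := h
  have h3 : f^[j] m = f^[j % k] m := (Function.IsPeriodicPt.iterate_mod_apply (f := f) h1 j).symm
  rw [h3]
  rcases Nat.eq_zero_or_pos (j % k) with h4 | h4
  · rw [h4]; exact le_rfl
  · exact (h2 _ h4 (Nat.mod_lt _ h0)).le

theorem isCycleMin_one {f : ℕ → ℕ} {m : ℕ} (h : f m = m) : IsCycleMin f m 1 :=
  ⟨one_pos, h, fun j h0 h1 => by omega⟩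

theorem le_of_mem_leafCorners {l : List ℕ} {o m : ℕ} (h : m ∈ leafCorners l o) : o ≤ m := by
  induction l generalizing o with
  | nil => simp [leafCorners] at h; omega
  | cons x l ih =>
    simp only [leafCorners, List.mem_append, List.mem_map, List.mem_range] at h
    rcases h with ⟨i, _, rfl⟩ | h
    · omega
    · have := ih h; omega

theorem le_of_mem_spineCorners {l : List ℕ} {o m : ℕ} (h : m ∈ spineCorners l o) : o ≤ m := by
  induction l generalizing o with
  | nil => simp [spineCorners] at h
  | cons x l ih =>
    simp only [spineCorners, List.mem_cons] at h
    rcases h with rfl | h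
    · exact le_rfl
    · have := ih h; omega

theorem nodup_corners (l : List ℕ) (o : ℕ) : (spineCorners l o ++ leafCorners l o).Nodup := by
  induction l generalizing o with
  | nil => simp [spineCorners, leafCorners]
  | cons x l ih =>
    have h := ih (o + 2 * x + 1)
    rw [List.nodup_append] at h
    obtain ⟨h1, h2, h3⟩ := h
    have hs : ∀ m ∈ spineCorners l (o + 2 * x + 1), o + 2 * x + 1 ≤ m :=
      fun m hm => le_of_mem_spineCorners hm
    have hl : ∀ m ∈ leafCorners l (o + 2 * x + 1), o + 2 * x + 1 ≤ m :=
      fun m hm => le_of_mem_leafCorners hm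
    rw [spineCorners, leafCorners, List.nodup_append, List.nodup_cons, List.nodup_append]
    refine ⟨⟨fun hm => by have := hs _ hm; omega, h1⟩, ⟨?_, h2, ?_⟩, ?_⟩
    · exact List.nodup_range.map fun i j h => by simp at h; omega
    · intro a ha b hb
      simp only [List.mem_map, List.mem_range] at ha
      obtain ⟨i, hi, rfl⟩ := ha
      have := hl _ hb
      omega
    · intro a ha b hb
      simp only [List.mem_cons, List.mem_append, List.mem_map, List.mem_range] at ha hb
      rcases ha with rfl | ha
      · rcases hb with ⟨i, _, rfl⟩ | hb
        · omega
        · have := hl _ hb; omega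
      · rcases hb with ⟨i, _, rfl⟩ | hb
        · have := hs _ ha; omega
        · exact h3 a ha b hb

/-- The extra leaf is the far end of the spine. -/
theorem length_leafCorners (l : List ℕ) (o : ℕ) : (leafCorners l o).length = l.sum + 1 := by
  induction l generalizing o with
  | nil => rfl
  | cons x l ih => simp [leafCorners, ih]; ring

namespace IsNest

variable {f : ℕ → ℕ}

/-- Turning around a spine vertex: from the first corner `o` to the last corner `e`, across the next
spine edge to `o + 2x`, then back over one leaf edge at a time. This gives `x + 2` corners. -/
theorem iterate {x : ℕ} {l : List ℕ} {o e : ℕ} (h : IsNest f (x :: l) o e) {i : ℕ} (hi : i ≤ x) :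
    f^[i + 2] o = o + 2 * (x - i) := by
  obtain ⟨h0, h1, h2, h3, _⟩ := h
  induction i with
  | zero => simp [h1, h2]
  | succ i ih =>
    rw [Nat.add_right_comm, Function.iterate_succ_apply', ih (by omega)]
    have := (h3 (x - (i + 1)) (by omega)).2
    rw [← this]
    congr 1
    omega

theorem isCycleMin_first {x : ℕ} {l : List ℕ} {o e : ℕ} (h : IsNest f (x :: l) o e) :
    IsCycleMin f o (x + 2) := by
  refine ⟨by omega, by rw [h.iterate le_rfl]; omega, fun j h0 h1 => ?_⟩
  rcases Nat.lt_or_ge j 2 with h2 | h2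
  · obtain rfl : j = 1 := by omega
    have := h.1
    rw [Function.iterate_one, h.2.1]
    omega
  · obtain ⟨i, rfl⟩ : ∃ i, j = i + 2 := ⟨j - 2, by omega⟩
    rw [h.iterate (by omega)]
    omega

theorem isCycleMin_spine {l : List ℕ} {o e : ℕ} (h : IsNest f l o e) :
    List.Forall₂ (fun m x => IsCycleMin f m (x + 2)) (spineCorners l o) l := by
  induction l generalizing o e with
  | nil => exact List.Forall₂.nil
  | cons x l ih => exact List.Forall₂.cons h.isCycleMin_first (ih h.2.2.2.2)

theorem isCycleMin_leaf {l : List ℕ} {o e : ℕ} (h : IsNest f l o e) :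
    ∀ m ∈ leafCorners l o, IsCycleMin f m 1 := by
  induction l generalizing o e with
  | nil =>
    intro m hm
    obtain rfl : m = o := by simpa [leafCorners] using hm
    exact isCycleMin_one h.2
  | cons x l ih =>
    intro m hm
    simp only [leafCorners, List.mem_append, List.mem_map, List.mem_range] at hm
    rcases hm with ⟨i, hi, rfl⟩ | hm
    · exact isCycleMin_one (h.2.2.2.1 i hi).1
    · exact ih h.2.2.2.2 m hm

/-- It shows that the listed cycles exhaust the corners. Up to `o + 2x`, even offsets belong to the
spine vertex and odd ones are leaves; beyond that, all but `e` lie in the inner nest. -/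
theorem exists_iterate_eq {l : List ℕ} {o e : ℕ} (h : IsNest f l o e) {j : ℕ} (h0 : o ≤ j)
    (h1 : j ≤ e) : ∃ m ∈ spineCorners l o ++ leafCorners l o, ∃ i, f^[i] m = j := by
  induction l generalizing o e with
  | nil =>
    obtain rfl : e = o := h.1
    exact ⟨e, by simp [spineCorners, leafCorners], 0, by simp; omega⟩
  | cons x l ih =>
    rcases Nat.lt_or_ge (o + 2 * x) j with h2 | h2
    · rcases h1.eq_or_lt with rfl | h3
      · exact ⟨o, by simp [spineCorners], 1, h.2.1⟩
      · obtain ⟨m, hm, i, hi⟩ := ih h.2.2.2.2 (by omega) (by omega)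
        refine ⟨m, ?_, i, hi⟩
        simp only [spineCorners, leafCorners, List.mem_append, List.mem_cons] at hm ⊢
        tauto
    · obtain ⟨i, hi | hi⟩ := Nat.even_or_odd' (j - o)
      · refine ⟨o, by simp [spineCorners], x - i + 2, ?_⟩
        rw [h.iterate (by omega)]
        omega
      · refine ⟨j, ?_, 0, rfl⟩
        simp only [spineCorners, leafCorners, List.mem_append, List.mem_map, List.mem_range]
        exact Or.inr (Or.inl ⟨i, by omega, by omega⟩)

end IsNest

/-! ### The bottom word -/

/-- The symbols `2s+2, 2s+2, …, 2(s+x), 2(s+x)`. -/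
def leafWord (s x : ℕ) : List ℕ := (List.range x).flatMap fun j => [2 * (s + j) + 2, 2 * (s + j) + 2]

/-- The bottom word, without its last three symbols. -/
def nestWord : ℕ → List ℕ → List ℕ
  | _, [] => []
  | s, x :: l => leafWord s x ++ (2 * (s + x) + 1) :: (nestWord (s + x) l ++ [2 * (s + x) + 1])

theorem leafWord_succ (s x : ℕ) :
    leafWord s (x + 1) = leafWord s x ++ [2 * (s + x) + 2, 2 * (s + x) + 2] := by
  simp [leafWord, List.range_succ]

theorem length_leafWord (s x : ℕ) : (leafWord s x).length = 2 * x := by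
  induction x with
  | zero => rfl
  | succ x ih => rw [leafWord_succ, List.length_append, ih]; simp; ring

theorem getElem?_leafWord (s x : ℕ) {i : ℕ} (hi : i < x) :
    (leafWord s x)[2 * i]? = (leafWord s x)[2 * i + 1]? := by
  induction x with
  | zero => omega
  | succ x ih =>
    rw [leafWord_succ]
    rcases Nat.lt_succ_iff_lt_or_eq.1 hi with h | rfl
    · rw [List.getElem?_append_left (by rw [length_leafWord]; omega),
        List.getElem?_append_left (by rw [length_leafWord]; omega), ih h]
    · rw [List.getElem?_append_right (by rw [length_leafWord]),
        List.getElem?_append_right (by rw [length_leafWord]; omega), length_leafWord]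
      simp

theorem mem_leafWord {s x a : ℕ} : a ∈ leafWord s x ↔ ∃ j < x, a = 2 * (s + j) + 2 := by
  simp [leafWord]

theorem count_leafWord {s x a : ℕ} (h : a ∈ leafWord s x) : (leafWord s x).count a = 2 := by
  induction x with
  | zero => simp [leafWord] at h
  | succ x ih =>
    rw [leafWord_succ, List.count_append]
    by_cases ha : a ∈ leafWord s x
    · obtain ⟨j, hj, rfl⟩ := mem_leafWord.1 ha
      rw [ih ha, List.count_eq_zero_of_not_mem]
      simp; omega
    · rw [List.count_eq_zero_of_not_mem ha]
      obtain ⟨j, hj, rfl⟩ := mem_leafWord.1 h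
      obtain rfl : j = x := by
        by_contra hne
        exact ha (mem_leafWord.2 ⟨j, by omega, rfl⟩)
      simp

theorem mem_nestWord {s : ℕ} {l : List ℕ} (hl : ∀ x ∈ l, 0 < x) {a : ℕ} (h : a ∈ nestWord s l) :
    2 * s + 2 ≤ a ∧ a ≤ 2 * (s + l.sum) + 1 := by
  induction l generalizing s with
  | nil => simp [nestWord] at h
  | cons x l ih =>
    have hx := hl x (by simp)
    simp only [nestWord, List.mem_append, List.mem_cons, List.not_mem_nil, or_false] at h
    rw [List.sum_cons]
    rcases h with h | rfl | h | rfl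
    · obtain ⟨j, hj, rfl⟩ := mem_leafWord.1 h
      omega
    · omega
    · have := ih (fun y hy => hl y (List.mem_cons_of_mem _ hy)) h; omega
    · omega

theorem count_nestWord {s : ℕ} {l : List ℕ} (hl : ∀ x ∈ l, 0 < x) {a : ℕ} (h : a ∈ nestWord s l) :
    (nestWord s l).count a = 2 := by
  induction l generalizing s with
  | nil => simp [nestWord] at h
  | cons x l ih =>
    have hl' : ∀ y ∈ l, 0 < y := fun y hy => hl y (List.mem_cons_of_mem _ hy)
    have hin : ∀ b ∈ nestWord (s + x) l, 2 * (s + x) + 2 ≤ b := fun b hb => (mem_nestWord hl' hb).1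
    simp only [nestWord, List.mem_append, List.mem_cons, List.not_mem_nil, or_false] at h
    simp only [nestWord, List.count_append, List.count_cons, List.count_nil]
    by_cases h1 : a ∈ leafWord s x
    · obtain ⟨j, hj, ha⟩ := mem_leafWord.1 h1
      rw [count_leafWord h1, List.count_eq_zero_of_not_mem fun h2 => by have := hin a h2; omega]
      have : ¬ 2 * (s + x) + 1 = a := by omega
      simp [this]
    · rw [List.count_eq_zero_of_not_mem h1]
      by_cases h2 : a ∈ nestWord (s + x) l
      · have := hin a h2
        have : ¬ 2 * (s + x) + 1 = a := by omega
        simp [this, ih hl' h2]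
      · rw [List.count_eq_zero_of_not_mem h2]
        obtain rfl : a = 2 * (s + x) + 1 := by tauto
        simp

theorem length_nestWord_cons (s x : ℕ) (l : List ℕ) :
    (nestWord s (x :: l)).length = 2 * x + 2 + (nestWord (s + x) l).length := by
  simp [nestWord, length_leafWord]; ring

/-- By `hf`, the right end of an edge goes to the left end of its partner. The value at the first
corner depends on the edge before the block, hence the hypothesis `h`; in the induction it comes
from the odd symbol enclosing the inner block. -/
theorem isNest_of_word {w : List ℕ} {f : ℕ → ℕ}
    (hf : ∀ i j, i < w.length → j < w.length → i ≠ j → w[i]? = w[j]? → f (i + 1) = j)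
    (s : ℕ) (l : List ℕ) (u v : List ℕ) (hw : w = u ++ nestWord s l ++ v)
    (h : f u.length = u.length + (nestWord s l).length) :
    IsNest f l u.length (u.length + (nestWord s l).length) := by
  induction l generalizing s u v with
  | nil => exact ⟨rfl, h⟩
  | cons x l ih =>
    have hlen := length_nestWord_cons s x l
    set o := u.length with ho
    set e := o + (nestWord s (x :: l)).length with he
    have hwlen : w.length = e + v.length := by rw [hw, List.length_append, List.length_append]
    have hleaf : ∀ i < 2 * x, w[o + i]? = (leafWord s x)[i]? := by
      intro i hi
      rw [hw, List.append_assoc, List.getElem?_append_right (by omega), nestWord, List.append_assoc,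
        List.getElem?_append_left (by rw [length_leafWord]; omega)]
      congr 1
      omega
    have hfst : w[o + 2 * x]? = some (2 * (s + x) + 1) := by
      rw [hw, List.append_assoc, List.getElem?_append_right (by omega), nestWord, List.append_assoc,
        List.getElem?_append_right (by rw [length_leafWord]; omega), length_leafWord]
      rw [show o + 2 * x - u.length - 2 * x = 0 by omega]
      rfl
    have hlst : w[e - 1]? = some (2 * (s + x) + 1) := by
      rw [hw, List.append_assoc, List.getElem?_append_right (by omega), nestWord, List.append_assoc,
        List.getElem?_append_right (by rw [length_leafWord]; omega), length_leafWord,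
        show e - 1 - u.length - 2 * x = (nestWord (s + x) l).length + 1 by omega, List.cons_append,
        List.getElem?_cons_succ, List.append_assoc, List.getElem?_append_right le_rfl]
      simp
    have hfx : f (o + 2 * x + 1) = e - 1 :=
      hf _ _ (by omega) (by omega) (by omega) (hfst.trans hlst.symm)
    have hfe : f e = o + 2 * x := by
      have := hf (e - 1) (o + 2 * x) (by omega) (by omega) (by omega) (hlst.trans hfst.symm)
      rwa [Nat.sub_add_cancel (by omega)] at this
    refine ⟨by omega, h, hfe, fun i hi => ?_, ?_⟩
    · have heq : w[o + 2 * i]? = w[o + 2 * i + 1]? := by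
        rw [hleaf _ (by omega), add_assoc, hleaf _ (by omega), getElem?_leafWord s x hi]
      exact ⟨hf _ _ (by omega) (by omega) (by omega) heq,
        hf _ _ (by omega) (by omega) (by omega) heq.symm⟩
    · have hu : (u ++ leafWord s x ++ [2 * (s + x) + 1]).length = o + 2 * x + 1 := by
        simp [length_leafWord, ho]; ring
      have := ih (s + x) (u ++ leafWord s x ++ [2 * (s + x) + 1]) ([2 * (s + x) + 1] ++ v)
        (by rw [hw, nestWord]; simp)
        (by rw [hu, hfx]; omega)
      rw [hu] at this
      convert this using 1
      omega

/-! ### Erasing symbols -/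

theorem mem_erasedSymbolsFrom {s : ℕ} {l : List ℕ} {a : ℕ} (h : a ∈ erasedSymbolsFrom s l) :
    a % 2 = 1 ∧ 2 * s + 3 ≤ a := by
  induction l generalizing s with
  | nil => simp [erasedSymbolsFrom] at h
  | cons x l ih =>
    simp only [erasedSymbolsFrom, List.mem_append, List.mem_map, List.mem_range] at h
    rcases h with ⟨j, _, rfl⟩ | h
    · omega
    · have := ih h; omega

/-- The part of the bottom line of the genus zero permutation read away from the left endpoint. -/
def outWord (s n : ℕ) : List ℕ :=
  (List.range n).flatMap fun k => [2 * (s + k) + 2, 2 * (s + k) + 2, 2 * (s + k) + 3]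

/-- The part of the bottom line of the genus zero permutation read back to the left endpoint. -/
def backWord (s n : ℕ) : List ℕ := (List.range n).reverse.map fun k => 2 * (s + k) + 3

theorem outWord_succ (s n : ℕ) : outWord s (n + 1) =
    outWord s n ++ [2 * (s + n) + 2, 2 * (s + n) + 2, 2 * (s + n) + 3] := by
  simp [outWord, List.range_succ]

theorem backWord_succ (s n : ℕ) : backWord s (n + 1) = (2 * (s + n) + 3) :: backWord s n := by
  simp [backWord, List.range_succ]

theorem outWord_add (s m n : ℕ) : outWord s (m + n) = outWord s m ++ outWord (s + m) n := by
  induction n with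
  | zero => simp [outWord]
  | succ n ih => rw [← add_assoc, outWord_succ, ih, outWord_succ, List.append_assoc, add_assoc]

theorem backWord_add (s m n : ℕ) : backWord s (m + n) = backWord (s + m) n ++ backWord s m := by
  induction n with
  | zero => simp [backWord]
  | succ n ih => rw [← add_assoc, backWord_succ, ih, backWord_succ, List.cons_append, add_assoc]

theorem le_of_mem_outWord {s n a : ℕ} (h : a ∈ outWord s n) : 2 * s + 2 ≤ a := by
  simp only [outWord, List.mem_flatMap, List.mem_range, List.mem_cons, List.not_mem_nil,
    or_false] at h
  omega

theorem le_of_mem_backWord {s n a : ℕ} (h : a ∈ backWord s n) : 2 * s + 3 ≤ a := by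
  simp only [backWord, List.mem_map, List.mem_reverse, List.mem_range] at h
  omega

theorem filter_outWord {s y : ℕ} {E : List ℕ} (hE : ∀ a ∈ E, a % 2 = 1)
    (h : ∀ j < y, 2 * (s + j) + 3 ∈ E) :
    (outWord s y).filter (fun a => a ∉ E) = leafWord s y := by
  induction y with
  | zero => rfl
  | succ y ih =>
    have h1 : 2 * (s + y) + 2 ∉ E := fun hm => by have := hE _ hm; omega
    rw [outWord_succ, leafWord_succ, List.filter_append, ih fun j hj => h j (by omega)]
    simp [h1, h y (by omega)]

theorem filter_backWord {s y : ℕ} {E : List ℕ} (h : ∀ j < y, 2 * (s + j) + 3 ∈ E) :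
    (backWord s y).filter (fun a => a ∉ E) = [] := by
  rw [List.filter_eq_nil_iff]
  intro a ha
  simp only [backWord, List.mem_map, List.mem_reverse, List.mem_range] at ha
  obtain ⟨j, hj, rfl⟩ := ha
  simpa using h j hj

/-- An entry `x` of `l` governs a block of `x` triples on the way out and the matching odd symbols
on the way back. Only the last odd symbol of the block survives, which leaves `x` adjacent pairs
followed by one spine edge. -/
theorem filter_out_append_back (s : ℕ) (l : List ℕ) (hl : ∀ x ∈ l, 0 < x) :
    (outWord s l.sum ++ backWord s l.sum).filter (fun a => a ∉ erasedSymbolsFrom s l) =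
      nestWord s l := by
  induction l generalizing s with
  | nil => rfl
  | cons x l ih =>
    obtain ⟨y, rfl⟩ : ∃ y, x = y + 1 := ⟨x - 1, by have := hl x (by simp); omega⟩
    have hl' : ∀ x ∈ l, 0 < x := fun y hy => hl y (List.mem_cons_of_mem _ hy)
    set E := erasedSymbolsFrom s ((y + 1) :: l) with hE
    have hmem : ∀ a, a ∈ E ↔ (∃ j < y, a = 2 * (s + j) + 3) ∨
        a ∈ erasedSymbolsFrom (s + (y + 1)) l := by
      intro a
      simp [hE, erasedSymbolsFrom, eq_comm]
    have hodd : ∀ a ∈ E, a % 2 = 1 := fun a ha => (mem_erasedSymbolsFrom ha).1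
    have hin : ∀ j < y, 2 * (s + j) + 3 ∈ E := fun j hj => (hmem _).2 (Or.inl ⟨j, hj, rfl⟩)
    have hnot : 2 * (s + y) + 3 ∉ E := by
      rw [hmem]
      rintro (⟨j, hj, h⟩ | h)
      · omega
      · have := (mem_erasedSymbolsFrom h).2; omega
    have heven : 2 * (s + y) + 2 ∉ E := fun hm => by have := hodd _ hm; omega
    have hbig : ∀ a, 2 * (s + (y + 1)) + 2 ≤ a →
        (a ∈ E ↔ a ∈ erasedSymbolsFrom (s + (y + 1)) l) := by
      intro a ha
      rw [hmem, or_iff_right]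
      rintro ⟨j, hj, rfl⟩
      omega
    have hmid := ih (s + (y + 1)) hl'
    rw [List.filter_append] at hmid
    rw [List.sum_cons, outWord_add, backWord_add, outWord_succ, backWord_succ, nestWord,
      leafWord_succ, ← hmid]
    simp only [List.filter_append, List.filter_cons, filter_outWord hodd hin, filter_backWord hin]
    rw [List.filter_congr (l := outWord (s + (y + 1)) l.sum)
      (q := fun a => a ∉ erasedSymbolsFrom (s + (y + 1)) l)
      fun a ha => by simpa using hbig a (le_of_mem_outWord ha),
      List.filter_congr (l := backWord (s + (y + 1)) l.sum)
      (q := fun a => a ∉ erasedSymbolsFrom (s + (y + 1)) l)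
      fun a ha => by simpa using hbig a ((le_of_mem_backWord ha).trans' (by omega))]
    simp [hnot, heven, show 2 * (s + (y + 1)) + 1 = 2 * (s + y) + 3 by ring]

theorem eraseSymbols_genusZeroPermutation (d : List ℕ) (hd : ∀ x ∈ d, 0 < x) :
    (genusZeroPermutation (d.sum + 4)).eraseSymbols (erasedSymbols d) =
      TwoLines.folded 0 (2 * d.sum + 2) (nestWord 0 d ++ [1, 1]) := by
  have h0 : 0 ∉ erasedSymbols d := fun h => by have := (mem_erasedSymbolsFrom h).1; omega
  have h1 : 1 ∉ erasedSymbols d := fun h => by have := (mem_erasedSymbolsFrom h).2; omega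
  have h2 : 2 * d.sum + 2 ∉ erasedSymbols d := fun h => by
    have := (mem_erasedSymbolsFrom h).1; omega
  have hbot : (genusZeroPermutation (d.sum + 4)).bot =
      (outWord 0 d.sum ++ backWord 0 d.sum) ++ [1, 1, 0] := by
    -- The descending odd symbols run down to 1, which lies outside `backWord` and is the first half
    -- of the final pair `1 1`.
    have : (List.range (d.sum + 1)).reverse.map (fun k => 2 * k + 1) =
        backWord 0 d.sum ++ [1] := by
      rw [List.range_succ_eq_map]
      simp [backWord, Function.comp_def, mul_add, add_assoc]
    simp only [genusZeroPermutation, show d.sum + 4 - 4 = d.sum by omega,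
      show d.sum + 4 - 3 = d.sum + 1 by omega, this]
    simp [outWord]
  rw [TwoLines.eraseSymbols, hbot, List.filter_append, erasedSymbols,
    filter_out_append_back 0 d hd, ← erasedSymbols]
  simp [genusZeroPermutation, TwoLines.folded, h0, h1, show 2 * (d.sum + 4) - 6 = 2 * d.sum + 2 by omega, h2]

theorem isFoldable_nestWord (d : List ℕ) (hd : ∀ x ∈ d, 0 < x) :
    TwoLines.IsFoldable 0 (2 * d.sum + 2) (nestWord 0 d ++ [1, 1]) := by
  have hmem : ∀ a ∈ nestWord 0 d, 2 ≤ a ∧ a ≤ 2 * d.sum + 1 := fun a ha => by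
    simpa using mem_nestWord hd ha
  refine ⟨by omega, ?_, ?_, by simp, ?_⟩
  · simp only [List.mem_append, List.mem_cons, List.not_mem_nil, or_false, not_or]
    exact ⟨fun h => by have := hmem _ h; omega, by omega, by omega⟩
  · simp only [List.mem_append, List.mem_cons, List.not_mem_nil, or_false, not_or]
    exact ⟨fun h => by have := hmem _ h; omega, by omega, by omega⟩
  · intro a ha
    rw [List.count_append]
    by_cases h : a ∈ nestWord 0 d
    · have := hmem _ h
      rw [count_nestWord hd h, List.count_eq_zero_of_not_mem]
      simp; omega
    · obtain rfl : a = 1 := by simpa [h] using ha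
      rw [List.count_eq_zero_of_not_mem h]
      simp

/-! ### The stratum of the glued surface -/

namespace EdgePairing

variable (E : EdgePairing) (H : ℂ) (hH : 0 < H.im)

/-- The point of the surface given by a vertex of the bottom line. -/
noncomputable def vertexPoint (j : ℕ) : (E.cylinder H hH).Surface :=
  (E.cylinder H hH).proj ((E.cylinder H hH).cap false (E.x j))

/-- The point of the surface given by a point of the top line. -/
noncomputable def topPoint (t : ℝ) : (E.cylinder H hH).Surface :=
  (E.cylinder H hH).proj ((E.cylinder H hH).cap true t)

theorem vertexPoint_eq_iff {j j' : ℕ} (hj : j < E.n) (hj' : j' < E.n) :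
    E.vertexPoint H hH j = E.vertexPoint H hH j' ↔ ∃ i, E.next^[i] j = j' := by
  rw [vertexPoint, vertexPoint, FlatCylinder.proj_cap_eq_iff]
  constructor
  · rintro ⟨-, m, hm⟩
    have hk : (0 : ℤ) < (E.cylinder H hH).period false (E.x j) := by
      exact_mod_cast (E.cylinder H hH).period_pos false (E.x j)
    have h1 := Int.emod_nonneg m hk.ne'
    have h2 := ((E.cylinder H hH).cong_it_emod false (E.x j) m).trans hm
    rw [← Int.toNat_of_nonneg h1] at h2
    refine ⟨_, (E.cong_x_iff H hH (E.next_iterate_lt hj _) hj').1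
      ((E.cong_it_x H hH hj _).trans h2)⟩
  · rintro ⟨i, rfl⟩
    exact ⟨rfl, i, (E.cong_it_x H hH hj i).symm⟩

/-- Corners representing the same point lie on one cycle, and each of two minima of a cycle bounds
the other. So distinct minima give distinct points. -/
theorem eq_of_isCycleMin {m m' k k' : ℕ} (hm : m < E.n) (hm' : m' < E.n)
    (h : IsCycleMin E.next m k) (h' : IsCycleMin E.next m' k')
    (heq : E.vertexPoint H hH m = E.vertexPoint H hH m') : m = m' := by
  obtain ⟨i, hi⟩ := (E.vertexPoint_eq_iff H hH hm hm').1 heq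
  obtain ⟨i', hi'⟩ := (E.vertexPoint_eq_iff H hH hm' hm).1 heq.symm
  have h1 := h.le i
  have h2 := h'.le i'
  omega

theorem order_vertexPoint {m k : ℕ} (hm : m < E.n) (h : IsCycleMin E.next m k) :
    (E.cylinder H hH).flatAtlas.order (E.vertexPoint H hH m) = k := by
  rw [vertexPoint, FlatCylinder.order_cap]
  exact E.period_x H hH hm h.1 h.2.1 fun i h0 h1 => (h.2.2 i h0 h1).ne'

theorem vertexPoint_ne_topPoint (j : ℕ) (t : ℝ) :
    E.vertexPoint H hH j ≠ E.topPoint H hH t := by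
  intro h
  have := (FlatCylinder.proj_cap_eq_iff.1 h).1
  simp at this

theorem not_cong_zero_half : ¬ (E.cylinder H hH).Cong 0 (E.x E.n / 2) := by
  rintro ⟨m, hm⟩
  have hL := E.length_pos
  rw [cylinder_L] at hm
  have h1 : (2 * m : ℝ) = 1 := by
    have : E.x E.n * (2 * m) = E.x E.n * 1 := by linarith
    exact mul_left_cancel₀ hL.ne' this
  have h2 : 2 * m = 1 := by exact_mod_cast h1
  omega

theorem topPoint_zero_ne : E.topPoint H hH 0 ≠ E.topPoint H hH (E.x E.n / 2) := by
  intro h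
  obtain ⟨-, m, hm⟩ := FlatCylinder.proj_cap_eq_iff.1 h
  refine E.not_cong_zero_half H hH ?_
  rcases E.it_true H hH m 0 with h1 | h1 <;> simpa [h1] using hm

theorem order_topPoint_zero : (E.cylinder H hH).flatAtlas.order (E.topPoint H hH 0) = 1 := by
  rw [topPoint, FlatCylinder.order_cap]
  exact E.period_true_of_cong H hH ⟨0, by simp⟩

theorem order_topPoint_half :
    (E.cylinder H hH).flatAtlas.order (E.topPoint H hH (E.x E.n / 2)) = 1 := by
  rw [topPoint, FlatCylinder.order_cap]
  exact E.period_true_of_cong H hH ⟨-1, by rw [cylinder_L]; push_cast; ring⟩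

theorem order_eq_two_or (p : (E.cylinder H hH).Surface) :
    (E.cylinder H hH).flatAtlas.order p = 2 ∨ (∃ j < E.n, p = E.vertexPoint H hH j) ∨
      p = E.topPoint H hH 0 ∨ p = E.topPoint H hH (E.x E.n / 2) := by
  obtain ⟨z, hz, rfl⟩ := (E.cylinder H hH).proj_surjective p
  by_cases h : 0 < z.im ∧ z.im < (E.cylinder H hH).H.im
  · exact Or.inl ((E.cylinder H hH).order_interior h.1 h.2)
  · obtain ⟨b, t, rfl⟩ := (E.cylinder H hH).exists_eq_cap hz h
    rw [FlatCylinder.order_cap]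
    cases b
    · rcases E.eq_x_or_interior t with ⟨j, hj, q, rfl⟩ | ⟨j, q, h1, h2⟩
      · exact Or.inr (Or.inl ⟨j, hj,
          FlatCylinder.proj_cap_eq_iff.2 ⟨rfl, 0, -q, by
            rw [cylinder_L, FlatCylinder.it_zero]; push_cast; ring⟩⟩)
      · exact Or.inl (E.period_interior H hH h1 h2)
    · by_cases hc : (E.cylinder H hH).Cong t (-t)
      · obtain ⟨m, hm⟩ := hc
        rw [cylinder_L] at hm
        -- Here `t = -m L / 2`, so the parity of `m` decides between the fold points `0` and `L /
        -- 2`.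
        obtain ⟨l, rfl | rfl⟩ := Int.even_or_odd' m
        · refine Or.inr (Or.inr (Or.inl (FlatCylinder.proj_cap_eq_iff.2 ⟨rfl, 0, l, ?_⟩)))
          rw [cylinder_L, FlatCylinder.it_zero]
          push_cast at hm
          linarith
        · refine Or.inr (Or.inr (Or.inr (FlatCylinder.proj_cap_eq_iff.2 ⟨rfl, 0, l + 1, ?_⟩)))
          rw [cylinder_L, FlatCylinder.it_zero]
          push_cast at hm ⊢
          linarith
      · exact Or.inl (E.period_true_of_not_cong H hH hc)

end EdgePairing

theorem forall₂_replicate_right {α β : Type*} {R : α → β → Prop} {b : β} (l : List α)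
    (h : ∀ a ∈ l, R a b) : List.Forall₂ R l (List.replicate l.length b) := by
  induction l with
  | nil => exact List.Forall₂.nil
  | cons a l ih =>
    exact List.Forall₂.cons (h a (by simp)) (ih fun x hx => h x (List.mem_cons_of_mem _ hx))

theorem FlatAtlas.inStratum_of_list {X : Type} [TopologicalSpace X] (𝒜 : FlatAtlas X) [T2Space X]
    [CompactSpace X] [ConnectedSpace X] {D : List ℤ} (hD : -1 ∈ D) (P : List X) (hP : P.Nodup)
    (hPD : List.Forall₂ (fun p k => (𝒜.order p : ℤ) = k + 2) P D)
    (hreg : ∀ p, p ∉ P → 𝒜.order p = 2) :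
    @QuadraticDifferential.InStratum X _ 𝒜.chartedSpace 𝒜.quadraticDifferential D := by
  have hlen := hPD.length_eq
  refine 𝒜.inStratum hD (fun i => P.get (i.cast hlen.symm)) ?_ ?_ ?_
  · intro i j hij
    have := List.nodup_iff_injective_get.1 hP hij
    simpa [Fin.ext_iff] using this
  · intro i
    exact hPD.get (by rw [hlen]; exact i.2) i.2
  · intro p hp
    refine hreg p fun hmem => hp ?_
    obtain ⟨i, rfl⟩ := List.get_of_mem hmem
    exact ⟨i.cast hlen, rfl⟩

/-! ### The corners of the bottom word form a nest. -/

namespace TwoLines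

variable {d : List ℕ} {a c : ℕ} (hw : IsFoldable a c (nestWord 0 d ++ [1, 1])) {ζ : ℕ → ℂ}
  (hζ : (folded a c (nestWord 0 d ++ [1, 1])).IsSuspensionDatum a ζ)

theorem IsFoldable.next_succ {w : List ℕ} (hw : IsFoldable a c w)
    (hζ : (folded a c w).IsSuspensionDatum a ζ) (i j : ℕ) (hi : i < w.length) (hj : j < w.length)
    (hij : i ≠ j) (h : w[i]? = w[j]?) : (hw.pairing hζ).next (i + 1) = j := by
  rw [EdgePairing.next, if_neg (Nat.succ_ne_zero i), hw.pairing_ι hζ]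
  exact List.partner_eq hw.count hi hj hij.symm h.symm

theorem IsFoldable.isNest :
    IsNest (hw.pairing hζ).next d 0 (nestWord 0 d).length ∧
      (hw.pairing hζ).next ((nestWord 0 d).length + 1) = (nestWord 0 d).length + 1 := by
  set n := (nestWord 0 d).length with hn
  have hlen : (nestWord 0 d ++ [1, 1]).length = n + 2 := by simp [hn]
  have h1 : (nestWord 0 d ++ [1, 1])[n]? = some 1 := by
    rw [List.getElem?_append_right le_rfl]; simp
  have h2 : (nestWord 0 d ++ [1, 1])[n + 1]? = some 1 := by
    rw [List.getElem?_append_right (by omega)]; simp [hn]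
  -- The edge before the corner 0 is cyclically the last one, the second `1`, whose partner has
  -- index `n`. Thus the pair `1 1` closes the nest, and its tip is the fixed corner `n + 1`.
  have h0 : (hw.pairing hζ).next 0 = n := by
    rw [EdgePairing.next, if_pos rfl, hw.pairing_ι hζ, hw.pairing_n hζ, hlen]
    exact List.partner_eq hw.count (by omega) (by omega) (by omega) (h1.trans h2.symm)
  refine ⟨?_, hw.next_succ hζ n (n + 1) (by omega) (by omega) (by omega) (h1.trans h2.symm)⟩
  have := isNest_of_word (hw.next_succ hζ) 0 d [] [1, 1] rfl (by simpa using h0)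
  simpa using this

theorem IsNest.le_of_mem_corners {f : ℕ → ℕ} {l : List ℕ} {o e m : ℕ} (h : IsNest f l o e)
    (hm : m ∈ spineCorners l o ++ leafCorners l o) : m ≤ e := by
  induction l generalizing o e with
  | nil =>
    obtain rfl : m = o := by simpa [spineCorners, leafCorners] using hm
    exact h.1.ge
  | cons x l ih =>
    have h1 := h.1
    have h2 := ih h.2.2.2.2
    simp only [spineCorners, leafCorners, List.mem_append, List.mem_cons, List.mem_map,
      List.mem_range] at hm h2
    rcases hm with (rfl | hm) | ⟨i, _, rfl⟩ | hm
    · omega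
    · have := h2 (Or.inl hm); omega
    · omega
    · have := h2 (Or.inr hm); omega

end TwoLines

/-! ### The list of singularities and their orders. -/

namespace EdgePairing

open TwoLines

variable (E : EdgePairing) (H : ℂ) (hH : 0 < H.im) {d : List ℕ} {e : ℕ}

/-- The points where the differential of a surface glued along a nest has a zero or a pole. -/
noncomputable def singularPoints (d : List ℕ) (e : ℕ) : List (E.cylinder H hH).Surface :=
  (spineCorners d 0 ++ (leafCorners d 0 ++ [e + 1])).map (E.vertexPoint H hH) ++
    [E.topPoint H hH 0, E.topPoint H hH (E.x E.n / 2)]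

variable (h1 : IsNest E.next d 0 e) (h2 : E.next (e + 1) = e + 1) (hn : E.n = e + 2)
include h1 h2 hn

theorem isCycleMin_of_mem {m : ℕ}
    (hm : m ∈ spineCorners d 0 ++ (leafCorners d 0 ++ [e + 1])) :
    m < E.n ∧ ∃ k, IsCycleMin E.next m k := by
  rw [← List.append_assoc, List.mem_append, List.mem_singleton] at hm
  rcases hm with hm | rfl
  · refine ⟨by have := IsNest.le_of_mem_corners h1 hm; omega, ?_⟩
    rcases List.mem_append.1 hm with hm | hm
    · have h := List.forall₂_iff_get.1 h1.isCycleMin_spine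
      obtain ⟨i, rfl⟩ := List.get_of_mem hm
      exact ⟨_, h.2 i i.2 (h.1 ▸ i.2)⟩
    · exact ⟨1, h1.isCycleMin_leaf m hm⟩
  · exact ⟨by omega, 1, isCycleMin_one h2⟩

theorem nodup_singularPoints : (E.singularPoints H hH d e).Nodup := by
  rw [singularPoints, List.nodup_append]
  refine ⟨?_, ?_, ?_⟩
  · refine List.Nodup.map_on ?_ ?_
    · intro m hm m' hm' heq
      obtain ⟨h3, k, h4⟩ := E.isCycleMin_of_mem h1 h2 hn hm
      obtain ⟨h3', k', h4'⟩ := E.isCycleMin_of_mem h1 h2 hn hm'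
      exact E.eq_of_isCycleMin _ _ h3 h3' h4 h4' heq
    · rw [← List.append_assoc, List.nodup_append]
      refine ⟨nodup_corners d 0, by simp, ?_⟩
      intro m hm m' hm'
      have := IsNest.le_of_mem_corners h1 hm
      simp only [List.mem_singleton] at hm'
      omega
  · simpa using E.topPoint_zero_ne H hH
  · intro p hp p' hp' heq
    obtain ⟨m, -, rfl⟩ := List.mem_map.1 hp
    simp only [List.mem_cons, List.not_mem_nil, or_false] at hp'
    rcases hp' with rfl | rfl
    · exact E.vertexPoint_ne_topPoint _ _ m _ heq
    · exact E.vertexPoint_ne_topPoint _ _ m _ heq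

theorem order_singularPoints :
    List.Forall₂ (fun p k => ((E.cylinder H hH).flatAtlas.order p : ℤ) = k + 2)
      (E.singularPoints H hH d e)
      (d.map (fun x : ℕ => (x : ℤ)) ++ List.replicate (d.sum + 4) (-1)) := by
  rw [singularPoints, List.map_append, List.append_assoc]
  refine List.rel_append ?_ ?_
  · rw [List.forall₂_map_left_iff, List.forall₂_map_right_iff]
    have h3 : ∀ m ∈ spineCorners d 0, m < E.n := fun m hm => by
      have := IsNest.le_of_mem_corners h1 (List.mem_append_left _ hm); omega
    have h4 := h1.isCycleMin_spine
    rw [List.forall₂_iff_get] at h4 ⊢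
    refine ⟨h4.1, fun i hi hi' => ?_⟩
    have h5 := E.order_vertexPoint _ hH
      (h3 _ (List.get_mem _ ⟨i, hi⟩)) (h4.2 i hi hi')
    exact_mod_cast h5
  -- The poles: `d.sum + 1` leaves of the nest, the tip of the edge `1`, and the two fold points of
  -- the top.
  · have hl : ((leafCorners d 0 ++ [e + 1]).map (E.vertexPoint H hH) ++
        [E.topPoint H hH 0, E.topPoint H hH (E.x E.n / 2)]).length = d.sum + 4 := by
      simp [length_leafCorners]
    rw [← hl]
    refine forall₂_replicate_right _ fun p hp => ?_
    suffices h : (E.cylinder H hH).flatAtlas.order p = 1 by rw [h]; norm_num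
    simp only [List.mem_append, List.mem_map, List.mem_cons, List.not_mem_nil, or_false] at hp
    rcases hp with ⟨m, hm, rfl⟩ | rfl | rfl
    · rcases hm with hm | rfl
      · refine E.order_vertexPoint _ _ ?_ (h1.isCycleMin_leaf m hm)
        have := IsNest.le_of_mem_corners h1 (List.mem_append_right _ hm); omega
      · exact E.order_vertexPoint _ _ (by omega) (isCycleMin_one h2)
    · exact E.order_topPoint_zero _ _
    · exact E.order_topPoint_half _ _

theorem order_of_notMem {p : (E.cylinder H hH).Surface}
    (hp : p ∉ E.singularPoints H hH d e) : (E.cylinder H hH).flatAtlas.order p = 2 := by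
  rcases E.order_eq_two_or _ hH p with h | ⟨j, hj, rfl⟩ | rfl | rfl
  · exact h
  · exfalso
    have key : ∃ m ∈ spineCorners d 0 ++ (leafCorners d 0 ++ [e + 1]),
        ∃ i, E.next^[i] m = j := by
      rw [← List.append_assoc]
      rcases Nat.lt_or_ge e j with h3 | h3
      · exact ⟨j, List.mem_append_right _ (by rw [List.mem_singleton]; omega), 0, rfl⟩
      · obtain ⟨m, hm, i, hi⟩ := h1.exists_iterate_eq (Nat.zero_le j) h3
        exact ⟨m, List.mem_append_left _ hm, i, hi⟩
    obtain ⟨m, hm, i, hi⟩ := key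
    have h3 := (E.vertexPoint_eq_iff _ hH (E.isCycleMin_of_mem h1 h2 hn hm).1 hj).2 ⟨i, hi⟩
    refine hp (List.mem_append_left _ ?_)
    rw [← h3]
    exact List.mem_map_of_mem hm
  · exact absurd (List.mem_append_right _ (by simp)) hp
  · refine absurd (List.mem_append_right _ ?_) hp
    rw [List.mem_cons, List.mem_singleton]
    exact Or.inr rfl

omit h1 h2 hn in
-- The corner 0 is the first spine corner or, for empty `d`, the first leaf corner, so the head of
-- the list is the left endpoint in both cases.
theorem head?_singularPoints :
    (E.singularPoints H hH d e).head? = some ((E.cylinder H hH).proj 0) := by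
  have hv : E.vertexPoint H hH 0 = (E.cylinder H hH).proj 0 := by
    rw [vertexPoint, E.x_zero, cap_false]
    simp
  rw [← hv]
  cases d <;> rfl

theorem degree_proj_zero : ∀ k ∈
    (d.map (fun x : ℕ => (x : ℤ)) ++ List.replicate (d.sum + 4) (-1)).head?,
    @QuadraticDifferential.degree (E.cylinder H hH).Surface _
      (E.cylinder H hH).flatAtlas.chartedSpace
      (E.cylinder H hH).flatAtlas.quadraticDifferential ((E.cylinder H hH).proj 0) =
        ((k : ℤ) : WithTop ℤ) := by
  intro k hk
  have h0 : (E.singularPoints H hH d e).head? = _ := E.head?_singularPoints H hH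
  have h3 := E.order_singularPoints H hH h1 h2 hn
  rw [FlatAtlas.degree_quadraticDifferential]
  generalize E.singularPoints H hH d e = P at h0 h3
  generalize d.map (fun x : ℕ => (x : ℤ)) ++ List.replicate (d.sum + 4) (-1) = D at hk h3
  cases h3 with
  | nil => simp at h0
  | cons h _ =>
    simp only [List.head?_cons, Option.some_inj, Option.mem_some] at h0 hk
    rw [← h0, h, ← hk]
    congr 1
    ring

end EdgePairing

theorem proposition3p1 (d : List ℕ) (hd : ∀ x ∈ d, 0 < x) (p : ℕ) (hp : p = d.sum + 4) :
    ((genusZeroPermutation p).eraseSymbols (erasedSymbols d)).RepresentsStratum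
      (d.map (fun x : ℕ => (x : ℤ)) ++ List.replicate p (-1)) := by
  subst hp
  rw [eraseSymbols_genusZeroPermutation d hd]
  have hw := isFoldable_nestWord d hd
  refine ⟨hw.isCylindrical, hw.exists_suspension, fun a ζ hζ => ?_⟩
  obtain ⟨rfl, -⟩ := hw.cut_eq hζ
  obtain ⟨h1, h2⟩ := hw.isNest hζ
  have hn : (hw.pairing hζ).n = (nestWord 0 d).length + 2 := by simp [hw.pairing_n hζ]
  have hH := (hw.surface hζ).H_pos
  refine ⟨(hw.surface hζ).Surface, inferInstance, (hw.surface hζ).flatAtlas.chartedSpace,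
    (hw.surface hζ).flatAtlas.quadraticDifferential, (hw.surface hζ).proj,
    hw.isGluedFromPolygon hζ, ?_, (hw.pairing hζ).degree_proj_zero _ hH h1 h2 hn⟩
  exact (hw.surface hζ).flatAtlas.inStratum_of_list (by simp) _
    ((hw.pairing hζ).nodup_singularPoints _ hH h1 h2 hn)
    ((hw.pairing hζ).order_singularPoints _ hH h1 h2 hn)
    fun p hp => (hw.pairing hζ).order_of_notMem _ hH h1 h2 hn hp
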